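/- Let $N\ge 0$ and let $\vec\kappa=(\kappa_0,\kappa_1,\kappa_\infty,\theta_1,\dots,\theta_N)\in\mathbb C^{N+3}$. The Garnier system $\mathcal H_N(\vec\kappa)$ is the Hamiltonian system $$\frac{\partial q_i}{\partial s_j}=\frac{\partial H_j}{\partial p_i},\qquad \frac{\partial p_i}{\partial s_j}=-\frac{\partial H_j}{\partial q_i}\qquad(i,j=1,\dots,N),$$ with $$\begin{aligned}s_i(s_i-1)H_i={}&q_i\Bigl(\alpha+\sum_j q_jp_j\Bigr)\Bigl(\alpha+\kappa_\infty+\sum_j q_jp_j\Bigr)+s_ip_i(q_ip_i-\theta_i)\\&-\sum_{j\ne i}R_{ji}(q_jp_j-\theta_j)q_ip_j-\sum_{j\ne i}S_{ij}(q_ip_i-\theta_i)q_jp_i\\&-\sum_{j\ne i}R_{ij}q_jp_j(q_ip_i-\theta_i)-\sum_{j\ne i}R_{ij}q_ip_i(q_jp_j-\theta_j)\\&-(s_i+1)(q_ip_i-\theta_i)q_ip_i+(\kappa_1s_i+\kappa_0-1)q_ip_i,\end{aligned}$$ where $R_{ij}=s_i(s_j-1)/(s_j-s_i)$, $S_{ij}=s_i(s_i-1)/(s_i-s_j)$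 and $\alpha=-\frac12(\kappa_0+\kappa_1+\kappa_\infty+\sum_i\theta_i-1)$. Treating $\kappa_\infty,\theta_1,\dots,\theta_N,t_1,\dots,t_N$ as indeterminates, let $T_{m,n}\in\mathbb C(\kappa_\infty,\theta,t)$ $(m,n\in\mathbb Z)$ be the special polynomials, determined by $$T_{0,0}=T_{0,1}=1,\quad T_{1,0}=\sum_i\theta_it_i-\kappa_\infty,\quad T_{1,1}=\prod_it_i\Bigl(\kappa_\infty-\sum_j\theta_jt_j^{-1}\Bigr)$$ and the recurrences $$T_{m,n+1}T_{m,n-1}=\Phi_{2n-1}(T_{m,n}),\qquad T_{m+1,n}T_{m-1,n}=\Phi_{2m}(T_{m,n}),$$ $$\begin{aligned}\Phi_c(T)={}&T^2\prod_it_i\,\Bigl\{\Bigl(\sum_i\tfrac{t_i^2-1}{t_i}\tfrac{\partial}{\partial t_i}-2\Bigr)\sum_it_i(t_i^2-1)\tfrac{\partial}{\partial t_i}\log T\\&+\kappa_\infty\sum_i\theta_i\tfrac{t_i^2+1}{t_i}-\tfrac12\sum_{i,j}\theta_i\theta_j\tfrac{t_i^2+t_j^2}{t_it_j}-\kappa_\infty^2+c^2\Bigr\}.\end{aligned}$$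 (The first recurrence is used for $m=0,1$ to obtain $T_{0,n}$ and $T_{1,n}$ for all $n$, then the second one to obtain all $T_{m,n}$.) For complex values of $\kappa_\infty,\theta_i$, let $T_{m,n}=T_{m,n}(t)\in\mathbb C(t)$ be the specialization. Fix $m,n\in\mathbb Z$ and consider the formulas $$q_i=\frac{t_i\frac{\partial}{\partial t_i}\log\frac{T_{m+1,n}}{T_{m,n+1}}}{\sum_jt_j\frac{\partial}{\partial t_j}\log\frac{T_{m+1,n}}{T_{m,n+1}}-2m+2n-1},\qquad 2q_ip_i=\theta_i+m+n+t_i\frac{\partial}{\partial t_i}\log\frac{T_{m,n}}{T_{m,n+1}}\qquad(i=1,\dots,N).\tag{$*$}$$ Say that $(*)$ is well defined at $(\kappa_\infty,\theta)$ if $T_{m,n}$, $T_{m+1,n}$, $T_{m,n+1}$, the denominator of $q_i$ and all the numerators of the $q_i$ are not identically zero as functions of $t$. (1) $(*)$ is well defined for generic $(\kappa_\infty,\theta)$, that is, for all $(\kappa_\infty,\theta)\in\mathbb C^{N+1}$ outside the zero set of some nonzero polynomial. (2) If $\kappa_0=\frac12+m+n$, $\kappa_1=\frac12+m-n$ and $(*)$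 is well defined at $(\kappa_\infty,\theta)$, then $(*)$, with $t_i=\sqrt{s_i}$, is an algebraic solution of $\mathcal H_N(\vec\kappa)$: the rational functions $q_i,p_i$ of $t$ are algebraic over $\mathbb C(s)$, $s_i=t_i^2$, and satisfy the system with $\partial/\partial s_j=\frac1{2t_j}\,\partial/\partial t_j$. -/

import Mathlib

open MvPolynomial

noncomputable section

namespace Garnier

/-! ### Rational functions and their partial derivatives -/

section FracDeriv

variable {k R : Type*} [CommRing k] [CommRing R] [IsDomain R] [Algebra k R]

/-- The quotient rule `(a / b)' = (b a' - a b') / b ^ 2`, for a chosen representation `x = a / b`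
with `a, b ∈ R`. -/
def fracDerivFun (d : Derivation k R R) (x : FractionRing R) : FractionRing R :=
  let a := (IsLocalization.sec (nonZeroDivisors R) x).1
  let b : R := (IsLocalization.sec (nonZeroDivisors R) x).2
  (algebraMap R (FractionRing R) (b * d a - a * d b)) / (algebraMap R (FractionRing R) b) ^ 2

/-- The quotient rule does not depend on the representation of the fraction. -/
theorem fracDerivFun_div (d : Derivation k R R) (a b : R) (hb : b ≠ 0) :
    fracDerivFun d (algebraMap R (FractionRing R) a / algebraMap R (FractionRing R) b) =
      (algebraMap R (FractionRing R) (b * d a - a * d b)) /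
        (algebraMap R (FractionRing R) b) ^ 2 := by
  set x := algebraMap R (FractionRing R) a / algebraMap R (FractionRing R) b with hx
  have hinj := IsFractionRing.injective R (FractionRing R)
  have hb' : algebraMap R (FractionRing R) b ≠ 0 := by
    simpa using (map_ne_zero_iff _ hinj).2 hb
  unfold fracDerivFun
  set a' := (IsLocalization.sec (nonZeroDivisors R) x).1 with ha'
  set b' := (IsLocalization.sec (nonZeroDivisors R) x).2 with hb'def
  have hs : x * algebraMap R (FractionRing R) (b' : R) = algebraMap R (FractionRing R) a' :=
    IsLocalization.sec_spec (nonZeroDivisors R) x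
  have hbn : (b' : R) ≠ 0 := nonZeroDivisors.coe_ne_zero b'
  have hbn' : algebraMap R (FractionRing R) (b' : R) ≠ 0 := (map_ne_zero_iff _ hinj).2 hbn
  have hcross : a * (b' : R) = a' * b := by
    apply hinj
    rw [map_mul, map_mul, ← hs, hx]
    field_simp
  have hd : a * d (b' : R) + (b' : R) * d a = a' * d b + b * d a' := by
    have := congrArg d hcross
    simpa [Derivation.leibniz] using this
  dsimp only
  rw [div_eq_div_iff (pow_ne_zero 2 hbn') (pow_ne_zero 2 hb'), ← map_pow, ← map_pow, ← map_mul,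
    ← map_mul]
  congr 1
  linear_combination (-(b : R) * b') * hd + (b * d (b' : R) + b' * d b) * hcross

/-- The unique extension of a derivation of a domain to its field of fractions. -/
def fracDeriv (d : Derivation k R R) : Derivation k (FractionRing R) (FractionRing R) :=
  Derivation.mk'
    { toFun := fracDerivFun d
      map_add' := by
        intro x y
        obtain ⟨a, b, hb, rfl⟩ := IsFractionRing.div_surjective (A := R) x
        obtain ⟨c, e, he, rfl⟩ := IsFractionRing.div_surjective (A := R) y
        have hb0 := nonZeroDivisors.ne_zero hb
        have he0 := nonZeroDivisors.ne_zero he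
        have hinj := IsFractionRing.injective R (FractionRing R)
        have hb' : algebraMap R (FractionRing R) b ≠ 0 := (map_ne_zero_iff _ hinj).2 hb0
        have he' : algebraMap R (FractionRing R) e ≠ 0 := (map_ne_zero_iff _ hinj).2 he0
        have h : algebraMap R (FractionRing R) a / algebraMap R (FractionRing R) b +
            algebraMap R (FractionRing R) c / algebraMap R (FractionRing R) e =
            algebraMap R (FractionRing R) (a * e + b * c) /
              algebraMap R (FractionRing R) (b * e) := by
          simp only [map_add, map_mul]; field_simp
        rw [h, fracDerivFun_div d _ _ (mul_ne_zero hb0 he0), fracDerivFun_div d _ _ hb0,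
          fracDerivFun_div d _ _ he0]
        simp only [map_add, map_mul, map_sub, Derivation.leibniz, smul_eq_mul]
        field_simp
        ring
      map_smul' := by
        intro r x
        obtain ⟨a, b, hb, rfl⟩ := IsFractionRing.div_surjective (A := R) x
        have hb0 := nonZeroDivisors.ne_zero hb
        have h : r • (algebraMap R (FractionRing R) a / algebraMap R (FractionRing R) b) =
            algebraMap R (FractionRing R) (r • a) / algebraMap R (FractionRing R) b := by
          rw [Algebra.smul_def, Algebra.smul_def, map_mul,
            IsScalarTower.algebraMap_apply k R (FractionRing R), mul_div_assoc]
        have h' : r • (algebraMap R (FractionRing R) (b * d a - a * d b) /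
            algebraMap R (FractionRing R) b ^ 2) =
            algebraMap R (FractionRing R) (r • (b * d a - a * d b)) /
              algebraMap R (FractionRing R) b ^ 2 := by
          simp only [Algebra.smul_def, map_mul,
            IsScalarTower.algebraMap_apply k R (FractionRing R), mul_div_assoc]
        rw [h, fracDerivFun_div d _ _ hb0, fracDerivFun_div d _ _ hb0, RingHom.id_apply, h',
          Derivation.map_smul]
        congr 2
        simp only [Algebra.smul_def]
        ring }
    (by
      intro x y
      obtain ⟨a, b, hb, rfl⟩ := IsFractionRing.div_surjective (A := R) x
      obtain ⟨c, e, he, rfl⟩ := IsFractionRing.div_surjective (A := R) y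
      have hb0 := nonZeroDivisors.ne_zero hb
      have he0 := nonZeroDivisors.ne_zero he
      have hinj := IsFractionRing.injective R (FractionRing R)
      have hb' : algebraMap R (FractionRing R) b ≠ 0 := (map_ne_zero_iff _ hinj).2 hb0
      have he' : algebraMap R (FractionRing R) e ≠ 0 := (map_ne_zero_iff _ hinj).2 he0
      have h : algebraMap R (FractionRing R) a / algebraMap R (FractionRing R) b *
          (algebraMap R (FractionRing R) c / algebraMap R (FractionRing R) e) =
          algebraMap R (FractionRing R) (a * c) / algebraMap R (FractionRing R) (b * e) := by
        simp only [map_mul]; field_simp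
      simp only [LinearMap.coe_mk, AddHom.coe_mk]
      rw [h, fracDerivFun_div d _ _ (mul_ne_zero hb0 he0), fracDerivFun_div d _ _ hb0,
        fracDerivFun_div d _ _ he0]
      simp only [map_add, map_mul, map_sub, Derivation.leibniz, smul_eq_mul]
      field_simp
      ring)

end FracDeriv

/-- The field of rational functions in `t_1, …, t_N` over the fraction field of `A`. -/
abbrev RatFun (N : ℕ) (A : Type) [CommRing A] : Type := FractionRing (MvPolynomial (Fin N) A)

section RatFun

variable {N : ℕ} {A : Type} [CommRing A] [IsDomain A]

/-- The variable `t_i`. -/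
def tvar (i : Fin N) : RatFun N A := algebraMap (MvPolynomial (Fin N) A) (RatFun N A) (X i)

/-- The partial derivative `∂/∂t_i`. -/
def dt (i : Fin N) : Derivation A (RatFun N A) (RatFun N A) :=
  fracDeriv (pderiv i : Derivation A (MvPolynomial (Fin N) A) (MvPolynomial (Fin N) A))

/-- `t_i ∂/∂t_i log f`, for a nonzero rational function `f`. -/
def eulerLog (i : Fin N) (f : RatFun N A) : RatFun N A := tvar i * (dt i f / f)

end RatFun

/-! ### The special polynomials, for indeterminate parameters -/

/-- The ring `ℂ[κ_∞, θ_1, …, θ_N]` of polynomials in the parameters: `none` stands for `κ_∞` and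
`some i` for `θ_i`. -/
abbrev ParamRing (N : ℕ) : Type := MvPolynomial (Option (Fin N)) ℂ

/-- The field `ℂ(κ_∞, θ_1, …, θ_N, t_1, …, t_N)`. -/
abbrev GenericField (N : ℕ) : Type := RatFun N (ParamRing N)

section Special

variable (N : ℕ)

/-- The indeterminate `κ_∞`. -/
def kinf : GenericField N := algebraMap (ParamRing N) (GenericField N) (X none)

/-- The indeterminate `θ_i`. -/
def theta (i : Fin N) : GenericField N :=
  algebraMap (ParamRing N) (GenericField N) (X (some i))

/-- The first order operator `∑_i t_i (t_i² - 1) ∂/∂t_i` applied to `log f`. -/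
def todaInner (f : GenericField N) : GenericField N :=
  ∑ i, tvar i * (tvar i ^ 2 - 1) * (dt i f / f)

/-- The right-hand side of the Toda recurrence: the new member of the sequence, from the
current member `f`, its other neighbour `g`, and the integer `c` (which is `2m` or `2n - 1`). -/
def todaStep (c : ℤ) (f g : GenericField N) : GenericField N :=
  (∏ i, tvar i) *
    ((∑ i, (tvar i ^ 2 - 1) / tvar i * dt i (todaInner N f)) - 2 * todaInner N f
      + kinf N * ∑ i, theta N i * ((tvar i ^ 2 + 1) / tvar i)
      - 1 / 2 * ∑ i, ∑ j, theta N i * theta N j *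
          ((tvar i ^ 2 + tvar j ^ 2) / (tvar i * tvar j))
      - kinf N ^ 2 + (c : GenericField N) ^ 2)
    * (f ^ 2 / g)

/-- `todaUp c a b k = (x_k, x_{k+1})`, where `x_0 = a`, `x_1 = b` and
`x_{k+1}` is obtained from `x_k`, `x_{k-1}` by the Toda recurrence with integer `c k`. -/
def todaUp (c : ℤ → ℤ) (a b : GenericField N) : ℕ → GenericField N × GenericField N
  | 0 => (a, b)
  | k + 1 =>
    let x := todaUp c a b k
    (x.2, todaStep N (c (k + 1)) x.2 x.1)

/-- `todaDown c a b k = (x_{-k}, x_{-k+1})`, where `x_0 = a`, `x_1 = b` and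
`x_{-k-1}` is obtained from `x_{-k}`, `x_{-k+1}` by the Toda recurrence with integer `c (-k)`. -/
def todaDown (c : ℤ → ℤ) (a b : GenericField N) : ℕ → GenericField N × GenericField N
  | 0 => (a, b)
  | k + 1 =>
    let x := todaDown c a b k
    (todaStep N (c (-k)) x.1 x.2, x.1)

/-- The sequence `(x_k)`, `k ∈ ℤ`, with `x_0 = a`, `x_1 = b` that satisfies the Toda recurrence with
integer `c k` at each `k`. -/
def todaSeq (c : ℤ → ℤ) (a b : GenericField N) : ℤ → GenericField N
  | Int.ofNat k => (todaUp N c a b k).1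
  | Int.negSucc k => (todaDown N c a b (k + 1)).1

/-- `T_{0,n}`, from `T_{0,0} = T_{0,1} = 1` by the recurrence in `n`. -/
def specialRowZero (n : ℤ) : GenericField N := todaSeq N (fun n => 2 * n - 1) 1 1 n

/-- `T_{1,n}`, from `T_{1,0} = ∑_i θ_i t_i - κ_∞` and
`T_{1,1} = ∏_i t_i (κ_∞ - ∑_j θ_j t_j⁻¹)` by the recurrence in `n`. -/
def specialRowOne (n : ℤ) : GenericField N :=
  todaSeq N (fun n => 2 * n - 1) ((∑ i, theta N i * tvar i) - kinf N)
    ((∏ i, tvar i) * (kinf N - ∑ j, theta N j * (tvar j)⁻¹)) n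

/-- The special polynomial `T_{m,n}` with indeterminate parameters, as an element of
`ℂ(κ_∞, θ, t)`: the recurrence in `m` is applied to `T_{0,n}` and `T_{1,n}`. -/
def specialGeneric (m n : ℤ) : GenericField N :=
  todaSeq N (fun m => 2 * m) (specialRowZero N n) (specialRowOne N n) m

end Special

/-! ### Specialization of the parameters -/

section Specialize

variable {N : ℕ}

/-- The evaluation `ℂ[κ_∞, θ] → ℂ` at given complex parameters. -/
def evalParam (κinf : ℂ) (θ : Fin N → ℂ) : ParamRing N →+* ℂ :=
  MvPolynomial.eval (fun o => o.elim κinf θ)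

/-- The specialization of `f ∈ ℂ(κ_∞, θ, t)` to complex parameters, an element of `ℂ(t)`:
write `f` as a reduced fraction of elements of `ℂ[κ_∞, θ][t]` and substitute. If the specialized
denominator vanishes, the value is `0`. -/
def specialize (κinf : ℂ) (θ : Fin N → ℂ) (f : GenericField N) : RatFun N ℂ :=
  algebraMap (MvPolynomial (Fin N) ℂ) (RatFun N ℂ)
      (MvPolynomial.map (evalParam κinf θ)
        (IsFractionRing.num (MvPolynomial (Fin N) (ParamRing N)) f)) /
    algebraMap (MvPolynomial (Fin N) ℂ) (RatFun N ℂ)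
      (MvPolynomial.map (evalParam κinf θ)
        (IsFractionRing.den (MvPolynomial (Fin N) (ParamRing N)) f :
          MvPolynomial (Fin N) (ParamRing N)))

/-- The special polynomial `T_{m,n}(t)` for complex parameters `κ_∞`, `θ_1, …, θ_N`. -/
def special (κinf : ℂ) (θ : Fin N → ℂ) (m n : ℤ) : RatFun N ℂ :=
  specialize κinf θ (specialGeneric N m n)

/-- The denominator `∑_j t_j ∂/∂t_j log (T_{m+1,n} / T_{m,n+1}) - 2m + 2n - 1` of `q_i`. -/
def qDenominator (κinf : ℂ) (θ : Fin N → ℂ) (m n : ℤ) : RatFun N ℂ :=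
  (∑ j, eulerLog j (special κinf θ (m + 1) n / special κinf θ m (n + 1))) - 2 * m + 2 * n - 1

/-- The formulas for `q_i` and `q_i p_i` determine rational functions `q_i`, `p_i` of `t`: the special
polynomials in them are not identically zero, nor are the denominator of `q_i` and the numerator
of `q_i` (by which one divides to obtain `p_i`). -/
structure FormulasDefined (κinf : ℂ) (θ : Fin N → ℂ) (m n : ℤ) : Prop where
  special_ne : special κinf θ m n ≠ 0
  special_left_ne : special κinf θ (m + 1) n ≠ 0
  special_right_ne : special κinf θ m (n + 1) ≠ 0
  denominator_ne : qDenominator κinf θ m n ≠ 0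
  numerator_ne : ∀ i, eulerLog i (special κinf θ (m + 1) n / special κinf θ m (n + 1)) ≠ 0

end Specialize

/-! ### The Garnier system -/

/-- The parameters `(κ_0, κ_1, κ_∞, θ_1, …, θ_N)` of the Garnier system. -/
structure Params (N : ℕ) where
  κ₀ : ℂ
  κ₁ : ℂ
  κinf : ℂ
  θ : Fin N → ℂ

/-- `α = -(κ_0 + κ_1 + κ_∞ + ∑ θ_i - 1) / 2`. -/
def Params.α {N : ℕ} (κ : Params N) : ℂ :=
  -(1 / 2) * (κ.κ₀ + κ.κ₁ + κ.κinf + (∑ i, κ.θ i) - 1)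

section System

variable {N : ℕ} {L : Type} [Field L] [Algebra ℂ L]

/-- `R_{ij} = s_i (s_j - 1) / (s_j - s_i)`. -/
def Rcoef (s : Fin N → L) (i j : Fin N) : L := s i * (s j - 1) / (s j - s i)

/-- `S_{ij} = s_i (s_i - 1) / (s_i - s_j)`. -/
def Scoef (s : Fin N → L) (i j : Fin N) : L := s i * (s i - 1) / (s i - s j)

/-- The coordinate `q_i` among the canonical variables. -/
def qvar (i : Fin N) : MvPolynomial (Fin N ⊕ Fin N) L := X (Sum.inl i)

/-- The coordinate `p_i` among the canonical variables. -/
def pvar (i : Fin N) : MvPolynomial (Fin N ⊕ Fin N) L := X (Sum.inr i)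

/-- A complex constant, as a polynomial in the canonical variables. -/
def cst (z : ℂ) : MvPolynomial (Fin N ⊕ Fin N) L := C (algebraMap ℂ L z)

/-- The Hamiltonian `H_i`, a polynomial in the canonical variables `(q, p)` whose coefficients are
rational functions of `s`. -/
def hamiltonian (κ : Params N) (s : Fin N → L) (i : Fin N) : MvPolynomial (Fin N ⊕ Fin N) L :=
  C (s i * (s i - 1))⁻¹ *
    (qvar i * (cst κ.α + ∑ j, qvar j * pvar j) * (cst (κ.α + κ.κinf) + ∑ j, qvar j * pvar j)
      + C (s i) * pvar i * (qvar i * pvar i - cst (κ.θ i))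
      - ∑ j ∈ Finset.univ.erase i,
          C (Rcoef s j i) * (qvar j * pvar j - cst (κ.θ j)) * qvar i * pvar j
      - ∑ j ∈ Finset.univ.erase i,
          C (Scoef s i j) * (qvar i * pvar i - cst (κ.θ i)) * qvar j * pvar i
      - ∑ j ∈ Finset.univ.erase i,
          C (Rcoef s i j) * qvar j * pvar j * (qvar i * pvar i - cst (κ.θ i))
      - ∑ j ∈ Finset.univ.erase i,
          C (Rcoef s i j) * qvar i * pvar i * (qvar j * pvar j - cst (κ.θ j))
      - C (s i + 1) * (qvar i * pvar i - cst (κ.θ i)) * qvar i * pvar i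
      + (cst κ.κ₁ * C (s i) + cst (κ.κ₀ - 1)) * qvar i * pvar i)

/-- `(q, p)` is an algebraic solution of the Garnier system with parameters `κ` in the field `L`.
Here `s_1, …, s_N ∈ L` are independent variables, `ds j` is a derivation of `L` that restricts to
`∂/∂s_j` on `ℂ(s)` (on elements algebraic over `ℂ(s)` there is only one such derivation), the
`q_i` and `p_i` are algebraic functions of `s`, and Hamilton's equations
`∂q_i/∂s_j = ∂H_j/∂p_i`, `∂p_i/∂s_j = -∂H_j/∂q_i` hold. -/
structure IsAlgebraicSolution (κ : Params N) (s : Fin N → L) (ds : Fin N → Derivation ℂ L L)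
    (q p : Fin N → L) : Prop where
  independent : AlgebraicIndependent ℂ s
  ds_s : ∀ i j, ds j (s i) = if i = j then 1 else 0
  q_algebraic : ∀ i, IsAlgebraic (IntermediateField.adjoin ℂ (Set.range s)) (q i)
  p_algebraic : ∀ i, IsAlgebraic (IntermediateField.adjoin ℂ (Set.range s)) (p i)
  q_eq : ∀ i j, ds j (q i) = eval (Sum.elim q p) (pderiv (Sum.inr i) (hamiltonian κ s j))
  p_eq : ∀ i j, ds j (p i) = -eval (Sum.elim q p) (pderiv (Sum.inl i) (hamiltonian κ s j))

end System

/-- `s_i = t_i²`, as an element of `ℂ(t)`. -/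
def svar {N : ℕ} (i : Fin N) : RatFun N ℂ := tvar i ^ 2

/-- `∂/∂s_j = (2 t_j)⁻¹ ∂/∂t_j` on `ℂ(t)`, where `s_j = t_j²`. -/
def dsvar {N : ℕ} (j : Fin N) : Derivation ℂ (RatFun N ℂ) (RatFun N ℂ) :=
  (2 * tvar j : RatFun N ℂ)⁻¹ • dt j

end Garnier

end

noncomputable section

namespace Garnier

/-! The solutions form one orbit of birational symmetries of the Garnier system, and the special
polynomials are the τ-functions along this orbit.

In the coordinates `q_i`, `x_i = q_i p_i` and with `δ_j = s_j ∂/∂s_j`, the system takes a form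
almost symmetric in the indices (`IsFlow`). It admits three involutions: `reflectOne` (κ_1 ↦ -κ_1),
`reflectZero` (κ_0 ↦ -κ_0) and `pointReflect` ((κ_0, κ_1) ↦ (1 - κ_0, 1 - κ_1)). Their products
contain two translations of (κ_0, κ_1), by (1, 1) and (1, -1). These commute (`shift_comm`); the
only relation that needs real computation is that κ_0 ↦ 2 - κ_0 commutes with κ_1 ↦ -κ_1
(`reflectTwo_reflectOne`). At κ_0 = κ_1 = 1/2 there is the seed q_i = θ_i t_i / κ, x_i = θ_i / 2, so
the translations produce a solution for every (m, n).

A state also carries the logarithmic derivatives h_i of a τ-function. The symmetries preserve the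
identity `HasPotential`, which expresses ∑ (s_i - 1) h_i algebraically in q and x. A further
differentiation (`todaOp_potential`) turns the braces in Φ_c into 4 `todaValue` plus a constant,
where `todaValue` = (Q - 1)(Y - ab). Its logarithmic derivative is, up to 1/2, the second difference
of h along a translation (`d_todaValue`, `h_up_add_h_down`). Hence each Toda step produces an
element with the logarithmic derivatives of the next state. Induction identifies T_{m,n} with the
τ-function at (m, n), up to a factor killed by all δ_j (`hasLogDeriv_specialGeneric`), and first
differences of h give the formulas for q_i and q_i p_i.

No denominator vanishes on the way when the parameters are indeterminate: for the valuation at κ = ∞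
all states have the leading behaviour q_i ∼ θ_i t_i / κ, x_i ∼ θ_i / 2 (`IsTame`), which the
involutions preserve.

For complex parameters, both sides of each equation of the flow are specializations of one generic
element, and specialization is single valued (`Specializes.unique`). Since the generic elements
involved are nonzero, the formulas are well defined for generic parameters. Finally, the symmetric
form of the flow is translated back into Hamilton's equations (`hamilton_q`, `hamilton_p`). -/

/-- A differential field with Euler derivations `δ_j = s_j ∂/∂s_j`, constants `θ_i`, `κ`, and a
gauge term `γ`. -/
structure Background (N : ℕ) (K : Type*) [Field K] where
  s : Fin N → K
  θ : Fin N → K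
  κ : K
  γ : K
  δ : Fin N → Derivation ℤ K K
  s_ne_zero : ∀ i, s i ≠ 0
  s_ne_one : ∀ i, s i - 1 ≠ 0
  s_ne : ∀ i j, i ≠ j → s j - s i ≠ 0
  δ_s : ∀ i j, δ j (s i) = if i = j then s i else 0
  δ_θ : ∀ i j, δ j (θ i) = 0
  δ_κ : ∀ j, δ j κ = 0

/-- A point of the phase space in the coordinates `q_i` and `x_i = q_i p_i`, with the parameters
`κ_0`, `κ_1` and the logarithmic derivatives `h_i` of a `τ`-function. -/
@[ext]
structure State (N : ℕ) (K : Type*) where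
  κ₀ : K
  κ₁ : K
  q : Fin N → K
  x : Fin N → K
  h : Fin N → K

/-! ### The Garnier flow in the coordinates (q, x). -/

namespace Background

variable {N : ℕ} {K : Type*} [Field K] (B : Background N K) (S : State N K)

/-- The derivative of x (x - θ_i) at x = x_i, which enters when `q_mul_y` is differentiated. -/
def w (i : Fin N) : K := 2 * S.x i - B.θ i
-- In terms of the momentum p_i = x_i / q_i this is p_i (q_i p_i - θ_i).
def y (i : Fin N) : K := S.x i * (S.x i - B.θ i) / S.q i
def Q (S : State N K) : K := ∑ i, S.q i
def Qs : K := ∑ i, S.q i / B.s i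
def X (S : State N K) : K := ∑ i, S.x i
def Y : K := ∑ i, B.y S i
def Z : K := ∑ i, B.s i * B.y S i

/-- The factor `α + ∑ q_j p_j` of the Hamiltonian. -/
def a : K := X S - (S.κ₀ + S.κ₁ + B.κ + (∑ i, B.θ i) - 1) / 2

/-- The factor `α + κ_∞ + ∑ q_j p_j` of the Hamiltonian. -/
def b : K := B.a S + B.κ

/-- The part of δ_j q_i / q_i that does not depend on i: once it is removed, the equations for q_i
have the same shape as those for x_i, with w in place of y. -/
def g (j : Fin N) : K := (S.q j * (B.a S + B.b S) - B.s j * B.w S j) / (B.s j - 1)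

/-- The Garnier system in the coordinates `(q, x)`. The equations with `i = j` are replaced by
the equations for `∑ q_i` and `∑ x_i`. -/
structure IsFlow : Prop where
  dκ₀ : ∀ j, B.δ j S.κ₀ = 0
  dκ₁ : ∀ j, B.δ j S.κ₁ = 0
  dx : ∀ i j, (B.s j - B.s i) * B.δ j (S.x i) =
    B.s j * B.y S j * S.q i - B.s i * B.y S i * S.q j
  dX : ∀ j, (B.s j - 1) * B.δ j (X S) = B.s j * B.y S j - S.q j * (B.a S * B.b S)
  dq : ∀ i j, (B.s j - B.s i) * (B.δ j (S.q i) - B.g S j * S.q i) =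
    B.s j * B.w S j * S.q i - B.s i * B.w S i * S.q j
  dQ : ∀ j, B.δ j (Q S) = (Q S - 1) * B.g S j + S.κ₁ * S.q j

variable {B S}

theorem g_spec (j : Fin N) :
    (B.s j - 1) * B.g S j = S.q j * (B.a S + B.b S) - B.s j * B.w S j := by
  have := B.s_ne_one j
  unfold g
  field_simp

theorem sum_w [CharZero K] : ∑ i, B.w S i = B.a S + B.b S + S.κ₀ + S.κ₁ - 1 := by
  have : (2 : K) ≠ 0 := two_ne_zero
  simp only [w, b, a, X, Finset.sum_sub_distrib, ← Finset.mul_sum]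
  field_simp
  ring

theorem q_mul_y (hq : ∀ i, S.q i ≠ 0) (i : Fin N) :
    S.q i * B.y S i = S.x i * (S.x i - B.θ i) := by
  have := hq i
  unfold y
  field_simp

theorem IsFlow.q_mul_dy (hq : ∀ i, S.q i ≠ 0) (i j : Fin N) :
    S.q i * B.δ j (B.y S i) = B.w S i * B.δ j (S.x i) - B.y S i * B.δ j (S.q i) := by
  have h := congrArg (B.δ j) (q_mul_y (B := B) hq i)
  simp only [Derivation.leibniz, smul_eq_mul, map_sub, B.δ_θ] at h
  unfold w
  linear_combination h

theorem IsFlow.dy (hS : B.IsFlow S) (hq : ∀ i, S.q i ≠ 0) (i j : Fin N) :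
    (B.s j - B.s i) * (B.δ j (B.y S i) + B.g S j * B.y S i) =
      B.s j * (B.w S i * B.y S j - B.w S j * B.y S i) := by
  apply mul_left_cancel₀ (hq i)
  linear_combination (B.s j - B.s i) * IsFlow.q_mul_dy hq i j + B.w S i * hS.dx i j
    - B.y S i * hS.dq i j

/-- The locus ∑ q_i / s_i = 1 is to κ_0 what ∑ q_i = 1 is to κ_1: it is invariant when the parameter
vanishes. This is the source of `reflectZero`. The parameter κ_0 comes in through `sum_w`. -/
theorem IsFlow.dQs [CharZero K] (hS : B.IsFlow S) (j : Fin N) :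
    B.δ j (B.Qs S) =
      (B.g S j + B.w S j) * (B.Qs S - 1) - S.κ₀ * S.q j / B.s j := by
  have hs := B.s_ne_zero
  -- For i ≠ j this is `dq` divided by (s_j - s_i) and by s_i, up to partial fractions. The last
  -- term, which comes from δ_j s_j = s_j, makes it true for i = j as well, so that it can be summed
  -- over all i.
  have h1 : ∀ i, B.δ j (S.q i / B.s i) = B.δ j (S.q i) / B.s j
      + (B.g S j * (S.q i / B.s i) - B.g S j / B.s j * S.q i)
      + (B.w S j * (S.q i / B.s i) - B.w S i * (S.q j / B.s j))
      - (if i = j then S.q i / B.s i else 0) := by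
    intro i
    have h2 : S.q i / B.s i * B.s i = S.q i := div_mul_cancel₀ _ (hs i)
    have h3 := congrArg (B.δ j) h2
    rw [Derivation.leibniz, B.δ_s, smul_eq_mul, smul_eq_mul] at h3
    have h4 := hS.dq i j
    have := hs i
    have := hs j
    apply mul_left_cancel₀ (hs i)
    apply mul_left_cancel₀ (hs j)
    split_ifs at h3 ⊢ with hij
    · subst hij
      field_simp at h3 ⊢
      linear_combination h3
    · field_simp at h4 ⊢
      linear_combination B.s j * h3 + h4
  have h5 := hS.dQ j
  have h6 := g_spec (B := B) (S := S) j
  unfold Qs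
  rw [map_sum, Finset.sum_congr rfl fun i _ => h1 i]
  simp only [Finset.sum_add_distrib, Finset.sum_sub_distrib, ← Finset.mul_sum, ← Finset.sum_mul,
    ← Finset.sum_div, Finset.sum_ite_eq', Finset.mem_univ, if_true, sum_w]
  rw [← map_sum, show ∑ i, S.q i = Q S from rfl, h5]
  have := hs j
  field_simp
  linear_combination h6

theorem IsFlow.dY [CharZero K] (hS : B.IsFlow S) (hq : ∀ i, S.q i ≠ 0) (j : Fin N) :
    (B.s j - 1) * (B.δ j (B.Y S) + B.g S j * B.Y S + S.κ₁ * B.y S j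
      - (∑ i, B.w S i) * B.y S j + B.w S j * B.Y S) =
      (B.a S + B.b S) * B.y S j - B.w S j * (B.a S * B.b S) := by
  -- A combination of the off-diagonal equations from which s_j - s_i cancels. For i = j it becomes
  -- the product rule for q_i y_i, so the sum may run over all i although the flow has no separate
  -- diagonal equations.
  have h1 : ∀ i, S.q j * B.δ j (B.y S i) - B.w S j * B.δ j (S.x i) + B.y S j * B.δ j (S.q i) =
      S.q j * (B.w S i * B.y S j - B.w S j * B.y S i)
        + B.g S j * (S.q i * B.y S j - S.q j * B.y S i) := by
    intro i
    by_cases hij : i = j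
    · subst hij
      linear_combination IsFlow.q_mul_dy (B := B) hq i i
    · apply mul_left_cancel₀ (B.s_ne i j hij)
      linear_combination S.q j * hS.dy hq i j - B.w S j * hS.dx i j + B.y S j * hS.dq i j
  have h2 := Finset.sum_congr rfl fun i (_ : i ∈ Finset.univ) => h1 i
  simp only [Finset.sum_add_distrib, Finset.sum_sub_distrib, ← Finset.mul_sum, ← Finset.sum_mul,
    ← map_sum] at h2
  change S.q j * B.δ j (B.Y S) - B.w S j * B.δ j (X S) + B.y S j * B.δ j (Q S) =
    S.q j * ((∑ i, B.w S i) * B.y S j - B.w S j * B.Y S)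
      + B.g S j * (Q S * B.y S j - S.q j * B.Y S) at h2
  apply mul_left_cancel₀ (hq j)
  linear_combination (B.s j - 1) * h2 + B.w S j * hS.dX j - (B.s j - 1) * B.y S j * hS.dQ j
    + B.y S j * g_spec (B := B) (S := S) j

theorem IsFlow.dZ [CharZero K] (hS : B.IsFlow S) (hq : ∀ i, S.q i ≠ 0) (j : Fin N) :
    (B.s j - 1) * (B.δ j (B.Z S) + B.g S j * B.Z S - B.s j * B.y S j * (1 - S.κ₁)) =
      B.s j * ((B.a S + B.b S) * B.y S j - B.w S j * (B.a S * B.b S)) := by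
  have h1 : ∀ i, B.δ j (B.s i * B.y S i) = B.s j * B.δ j (B.y S i)
      - B.s j * (B.w S i * B.y S j - B.w S j * B.y S i)
      + B.g S j * (B.s j * B.y S i - B.s i * B.y S i)
      + (if i = j then B.s i * B.y S i else 0) := by
    intro i
    rw [Derivation.leibniz, B.δ_s, smul_eq_mul, smul_eq_mul]
    have := hS.dy hq i j
    split_ifs <;> linear_combination -this
  have h2 : B.δ j (B.Z S) = B.s j * B.δ j (B.Y S)
      - B.s j * ((∑ i, B.w S i) * B.y S j - B.w S j * B.Y S)
      + B.g S j * (B.s j * B.Y S - B.Z S) + B.s j * B.y S j := by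
    unfold Z
    rw [map_sum, Finset.sum_congr rfl fun i _ => h1 i]
    simp only [Finset.sum_add_distrib, Finset.sum_sub_distrib, ← Finset.mul_sum,
      ← Finset.sum_mul, Finset.sum_ite_eq', Finset.mem_univ, if_true, ← map_sum]
    rfl
  linear_combination (B.s j - 1) * h2 + B.s j * hS.dY hq j

theorem IsFlow.d_a (hS : B.IsFlow S) [CharZero K] (j : Fin N) : B.δ j (B.a S) = B.δ j (X S) := by
  have h : 2 * B.a S = 2 * X S - (S.κ₀ + S.κ₁ + B.κ + (∑ i, B.θ i) - 1) := by
    unfold a; ring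
  have h2 := congrArg (B.δ j) h
  simp only [Derivation.leibniz, smul_eq_mul, map_sub, map_add, map_sum, B.δ_θ, B.δ_κ, hS.dκ₀,
    hS.dκ₁, Derivation.map_one_eq_zero] at h2
  have h3 : B.δ j (2 : K) = 0 := by
    simpa using (B.δ j).map_natCast 2
  rw [h3] at h2
  apply mul_left_cancel₀ (two_ne_zero (α := K))
  simpa using h2

theorem IsFlow.d_b (hS : B.IsFlow S) [CharZero K] (j : Fin N) : B.δ j (B.b S) = B.δ j (X S) := by
  simp [b, hS.d_a, B.δ_κ]

theorem IsFlow.dA (hS : B.IsFlow S) [CharZero K] (j : Fin N) :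
    (B.s j - 1) * B.δ j (B.a S * B.b S) =
      (B.a S + B.b S) * (B.s j * B.y S j - S.q j * (B.a S * B.b S)) := by
  rw [Derivation.leibniz, hS.d_a, hS.d_b, smul_eq_mul, smul_eq_mul]
  linear_combination (B.a S + B.b S) * hS.dX j

/-- A third invariant locus, Y = ab, with parameter 1 - κ_0. The point reflection carries it to ∑
q_i / s_i = 1. -/
theorem IsFlow.dYA [CharZero K] (hS : B.IsFlow S) (hq : ∀ i, S.q i ≠ 0) (j : Fin N) :
    B.δ j (B.Y S - B.a S * B.b S) =
      -(B.g S j + B.w S j) * (B.Y S - B.a S * B.b S) - (1 - S.κ₀) * B.y S j := by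
  have h1 := hS.dY hq j
  have h2 := hS.dA j
  have h3 := g_spec (B := B) (S := S) j
  rw [sum_w] at h1
  apply mul_left_cancel₀ (B.s_ne_one j)
  rw [map_sub]
  linear_combination h1 - h2 - B.a S * B.b S * h3

end Background

namespace Background

variable {N : ℕ} {K : Type*} [Field K] (B : Background N K) (S : State N K)

/-! ### Birational symmetries -/

/-- The amount subtracted from every momentum p_i = x_i / q_i by the reflection in κ_1. -/
def mu (S : State N K) : K := S.κ₁ / (Q S - 1)

/-- The symmetry `κ_1 ↦ -κ_1`. -/
def reflectOne (S : State N K) : State N K where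
  κ₀ := S.κ₀
  κ₁ := -S.κ₁
  q := S.q
  x i := S.x i - mu S * S.q i
  h := S.h

/-- The reflection in κ_0 subtracts ν / s_i from p_i. -/
def nu : K := S.κ₀ / (B.Qs S - 1)

/-- The symmetry `κ_0 ↦ -κ_0`. -/
def reflectZero : State N K where
  κ₀ := -S.κ₀
  κ₁ := S.κ₁
  q := S.q
  x i := S.x i - B.nu S * (S.q i / B.s i)
  h i := S.h i + S.κ₀ - B.nu S * (S.q i / B.s i)

/-- The symmetry `(κ_0, κ_1) ↦ (1 - κ_0, 1 - κ_1)`. -/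
def pointReflect : State N K where
  κ₀ := 1 - S.κ₀
  κ₁ := 1 - S.κ₁
  q i := B.s i * B.y S i / (B.a S * B.b S)
  x i := B.θ i - S.x i
  h i := S.h i - B.w S i / 2 + S.κ₀ / 2 - 1 / 4

/-- The value of `∑ (s_j - 1) h_j` along the `τ`-functions. -/
def potential : K :=
  (Q S - 1) * (B.a S * B.b S - B.Z S) + S.κ₁ / 2 * ∑ i, (B.s i - 1) * B.w S i - B.γ
    + (S.κ₀ + S.κ₁ - 1) ^ 2 / 4
    + (S.κ₀ - 1 / 2) * (S.κ₀ - 3 / 2) / 4 * ∑ i, (B.s i - 1)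

def HasPotential : Prop := ∑ i, (B.s i - 1) * S.h i = B.potential S

variable {B S}

/-! #### The symmetry `κ_1 ↦ -κ_1` -/

section ReflectOne

theorem mu_spec (hQ : Q S - 1 ≠ 0) : mu S * (Q S - 1) = S.κ₁ := by
  unfold mu; field_simp

theorem w_reflectOne (i : Fin N) :
    B.w (reflectOne S) i = B.w S i - 2 * mu S * S.q i := by
  simp only [w, reflectOne]; ring

theorem y_reflectOne (hq : ∀ i, S.q i ≠ 0) (i : Fin N) :
    B.y (reflectOne S) i = B.y S i - mu S * B.w S i + mu S ^ 2 * S.q i := by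
  have := hq i
  simp only [w, y, reflectOne]
  field_simp
  ring

theorem Q_reflectOne : Q (reflectOne S) = Q S := rfl

theorem X_reflectOne : X (reflectOne S) = X S - mu S * Q S := by
  simp only [X, Q, reflectOne, Finset.sum_sub_distrib, Finset.mul_sum]

theorem a_reflectOne [CharZero K] (hQ : Q S - 1 ≠ 0) : B.a (reflectOne S) = B.a S - mu S := by
  unfold a
  rw [X_reflectOne]
  simp only [reflectOne]
  field_simp
  linear_combination -2 * mu_spec hQ

theorem b_reflectOne [CharZero K] (hQ : Q S - 1 ≠ 0) : B.b (reflectOne S) = B.b S - mu S := by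
  rw [b, a_reflectOne hQ, b]; ring

theorem Y_reflectOne (hq : ∀ i, S.q i ≠ 0) :
    B.Y (reflectOne S) = B.Y S - mu S * (∑ i, B.w S i) + mu S ^ 2 * Q S := by
  simp only [Y, Q, y_reflectOne hq, Finset.sum_add_distrib, Finset.sum_sub_distrib,
    Finset.mul_sum]

theorem Z_reflectOne (hq : ∀ i, S.q i ≠ 0) :
    B.Z (reflectOne S) =
      B.Z S - mu S * (∑ i, B.s i * B.w S i) + mu S ^ 2 * ∑ i, B.s i * S.q i := by
  simp only [Z, y_reflectOne hq, Finset.mul_sum, ← Finset.sum_add_distrib,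
    ← Finset.sum_sub_distrib]
  exact Finset.sum_congr rfl fun i _ => by ring

theorem g_reflectOne [CharZero K] (hQ : Q S - 1 ≠ 0) (j : Fin N) :
    B.g (reflectOne S) j = B.g S j + 2 * mu S * S.q j := by
  have h := B.s_ne_one j
  apply mul_left_cancel₀ h
  rw [g_spec, a_reflectOne hQ, b_reflectOne hQ, w_reflectOne]
  simp only [reflectOne]
  linear_combination -g_spec (B := B) (S := S) j

/-- The product μ (Q - 1) = κ_1 is constant; substituting it for κ_1 in `dQ` gives a Bernoulli
equation for μ. -/
theorem IsFlow.d_mu (hS : B.IsFlow S) (hQ : Q S - 1 ≠ 0) (j : Fin N) :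
    B.δ j (mu S) = -mu S * (B.g S j + mu S * S.q j) := by
  have h := congrArg (B.δ j) (mu_spec hQ)
  simp only [Derivation.leibniz, smul_eq_mul, map_sub, Derivation.map_one_eq_zero, hS.dκ₁,
    hS.dQ] at h
  apply mul_left_cancel₀ hQ
  linear_combination h + mu S * S.q j * mu_spec hQ

theorem IsFlow.reflectOne [CharZero K] (hS : B.IsFlow S) (hq : ∀ i, S.q i ≠ 0)
    (hQ : Q S - 1 ≠ 0) : B.IsFlow (reflectOne S) where
  dκ₀ := hS.dκ₀
  dκ₁ j := by simp [Background.reflectOne, hS.dκ₁]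
  dx i j := by
    rw [y_reflectOne hq, y_reflectOne hq]
    simp only [Background.reflectOne, Derivation.leibniz, smul_eq_mul, map_sub, hS.d_mu hQ]
    linear_combination hS.dx i j - mu S * hS.dq i j
  dX j := by
    rw [y_reflectOne hq, X_reflectOne, a_reflectOne hQ, b_reflectOne hQ]
    simp only [Background.reflectOne, Derivation.leibniz, smul_eq_mul, map_sub, hS.d_mu hQ, hS.dQ]
    linear_combination hS.dX j + mu S * g_spec (B := B) (S := S) j
      + (B.s j - 1) * mu S * S.q j * mu_spec hQ
  dq i j := by
    rw [g_reflectOne hQ, w_reflectOne, w_reflectOne]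
    simp only [Background.reflectOne]
    linear_combination hS.dq i j
  dQ j := by
    rw [g_reflectOne hQ, Q_reflectOne, hS.dQ]
    simp only [Background.reflectOne]
    linear_combination -2 * S.q j * mu_spec hQ

/-- The h_i do not move, so `potential` itself must be invariant. The change of (Q - 1)(ab - Z) is
compensated by the term (κ_1 / 2) ∑ (s_i - 1) w_i. -/
theorem HasPotential.reflectOne [CharZero K] (hS : B.HasPotential S) (hq : ∀ i, S.q i ≠ 0)
    (hQ : Q S - 1 ≠ 0) : B.HasPotential (reflectOne S) := by
  unfold HasPotential at hS ⊢
  change ∑ i, (B.s i - 1) * S.h i = _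
  have h1 : ∑ i, (B.s i - 1) * B.w (Background.reflectOne S) i =
      ∑ i, B.s i * B.w S i - ∑ i, B.w S i - 2 * mu S * (∑ i, B.s i * S.q i - Q S) := by
    simp only [Q, w_reflectOne, ← Finset.sum_sub_distrib, Finset.mul_sum]
    exact Finset.sum_congr rfl fun i _ => by ring
  have h2 : ∑ i, (B.s i - 1) * B.w S i = ∑ i, B.s i * B.w S i - ∑ i, B.w S i := by
    simp only [← Finset.sum_sub_distrib]
    exact Finset.sum_congr rfl fun i _ => by ring
  rw [hS, potential, potential, h1, h2, Z_reflectOne hq, a_reflectOne hQ, b_reflectOne hQ, sum_w,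
    Q_reflectOne]
  simp only [Background.reflectOne]
  rw [← mu_spec hQ]
  field_simp
  ring

theorem mu_reflectOne : mu (reflectOne S) = -mu S := by
  rw [mu, Q_reflectOne, mu]
  simp only [reflectOne]
  ring

theorem reflectOne_reflectOne : reflectOne (reflectOne S) = S := by
  ext i
  · rfl
  · simp [reflectOne]
  · rfl
  · change (S.x i - mu S * S.q i) - mu (reflectOne S) * S.q i = _
    rw [mu_reflectOne]; ring
  · rfl

end ReflectOne

/-! #### The symmetry `κ_0 ↦ -κ_0` -/

section ReflectZero

theorem nu_spec (hQ : B.Qs S - 1 ≠ 0) : B.nu S * (B.Qs S - 1) = S.κ₀ := by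
  unfold nu; field_simp

theorem w_reflectZero (i : Fin N) :
    B.w (B.reflectZero S) i = B.w S i - 2 * B.nu S * (S.q i / B.s i) := by
  simp only [w, reflectZero]; ring

theorem y_reflectZero (hq : ∀ i, S.q i ≠ 0) (i : Fin N) :
    B.y (B.reflectZero S) i =
      B.y S i - B.nu S * (B.w S i / B.s i) + B.nu S ^ 2 * (S.q i / B.s i ^ 2) := by
  have := hq i
  have := B.s_ne_zero i
  simp only [w, y, reflectZero]
  field_simp
  ring

theorem Q_reflectZero : Q (B.reflectZero S) = Q S := rfl

theorem Qs_reflectZero : B.Qs (B.reflectZero S) = B.Qs S := rfl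

theorem X_reflectZero : X (B.reflectZero S) = X S - B.nu S * B.Qs S := by
  simp only [X, Qs, reflectZero, Finset.sum_sub_distrib, Finset.mul_sum]

theorem a_reflectZero [CharZero K] (hQ : B.Qs S - 1 ≠ 0) :
    B.a (B.reflectZero S) = B.a S - B.nu S := by
  unfold a
  rw [X_reflectZero]
  simp only [reflectZero]
  field_simp
  linear_combination -2 * nu_spec hQ

theorem b_reflectZero [CharZero K] (hQ : B.Qs S - 1 ≠ 0) :
    B.b (B.reflectZero S) = B.b S - B.nu S := by
  rw [b, a_reflectZero hQ, b]; ring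

theorem Z_reflectZero (hq : ∀ i, S.q i ≠ 0) :
    B.Z (B.reflectZero S) =
      B.Z S - B.nu S * (∑ i, B.w S i) + B.nu S ^ 2 * B.Qs S := by
  simp only [Z, Qs, y_reflectZero hq, Finset.mul_sum, ← Finset.sum_add_distrib,
    ← Finset.sum_sub_distrib]
  refine Finset.sum_congr rfl fun i _ => ?_
  have := B.s_ne_zero i
  field_simp

theorem g_reflectZero [CharZero K] (hQ : B.Qs S - 1 ≠ 0) (j : Fin N) :
    B.g (B.reflectZero S) j = B.g S j := by
  have h := B.s_ne_one j
  apply mul_left_cancel₀ h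
  rw [g_spec, a_reflectZero hQ, b_reflectZero hQ, w_reflectZero]
  simp only [reflectZero]
  have := B.s_ne_zero j
  have h3 : B.s j * (S.q j / B.s j) = S.q j := by field_simp
  linear_combination -g_spec (B := B) (S := S) j + 2 * B.nu S * h3

theorem IsFlow.d_nu [CharZero K] (hS : B.IsFlow S) (hQ : B.Qs S - 1 ≠ 0) (j : Fin N) :
    B.δ j (B.nu S) = -B.nu S * (B.g S j + B.w S j - B.nu S * (S.q j / B.s j)) := by
  have h := congrArg (B.δ j) (nu_spec hQ)
  simp only [Derivation.leibniz, smul_eq_mul, map_sub, Derivation.map_one_eq_zero, hS.dκ₀,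
    hS.dQs] at h
  apply mul_left_cancel₀ hQ
  linear_combination h - B.nu S * (S.q j / B.s j) * nu_spec hQ

theorem s_mul_d_div (i j : Fin N) (f : K) :
    B.s i * B.δ j (f / B.s i) = B.δ j f - if i = j then f else 0 := by
  have hs := B.s_ne_zero i
  have h2 : f / B.s i * B.s i = f := div_mul_cancel₀ _ hs
  have h3 := congrArg (B.δ j) h2
  rw [Derivation.leibniz, B.δ_s, smul_eq_mul, smul_eq_mul] at h3
  rw [← h3]
  split_ifs <;> field_simp <;> ring

theorem IsFlow.reflectZero [CharZero K] (hS : B.IsFlow S) (hq : ∀ i, S.q i ≠ 0)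
    (hQ : B.Qs S - 1 ≠ 0) : B.IsFlow (B.reflectZero S) where
  dκ₀ j := by simp [Background.reflectZero, hS.dκ₀]
  dκ₁ := hS.dκ₁
  dx i j := by
    rw [y_reflectZero hq, y_reflectZero hq]
    simp only [Background.reflectZero, Derivation.leibniz, smul_eq_mul, map_sub, hS.d_nu hQ]
    have hi := B.s_ne_zero i
    have hj := B.s_ne_zero j
    have h1 := s_mul_d_div (B := B) i j (S.q i)
    have h2 := hS.dx i j
    have h3 := hS.dq i j
    by_cases hij : i = j
    · subst hij; ring
    · rw [if_neg hij] at h1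
      apply mul_left_cancel₀ hi
      generalize B.δ j (S.q i / B.s i) = u at *
      field_simp
      linear_combination B.s j * B.s i * h2 - B.nu S * B.s j * h3
         - B.nu S * (B.s j * (B.s j - B.s i)) * h1
  dX j := by
    rw [y_reflectZero hq, X_reflectZero, a_reflectZero hQ, b_reflectZero hQ]
    simp only [Background.reflectZero, Derivation.leibniz, smul_eq_mul, map_sub, hS.d_nu hQ, hS.dQs]
    have hj := B.s_ne_zero j
    have h1 := hS.dX j
    have h2 := nu_spec hQ
    have h3 := g_spec (B := B) (S := S) j
    rw [← h2]
    field_simp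
    linear_combination B.s j * h1 + B.s j * B.nu S * h3
  dq i j := by
    rw [g_reflectZero hQ, w_reflectZero, w_reflectZero]
    simp only [Background.reflectZero]
    have hi := B.s_ne_zero i
    have hj := B.s_ne_zero j
    rw [hS.dq i j]
    field_simp
    ring
  dQ j := by
    rw [g_reflectZero hQ, Q_reflectZero, hS.dQ]
    rfl

/-- Under κ_0 ↦ -κ_0 the quadratic coefficient of ∑ (s_i - 1) in `potential` grows by exactly κ_0,
which accounts for the summand κ_0 in the new h_i. -/
theorem HasPotential.reflectZero [CharZero K] (hS : B.HasPotential S) (hq : ∀ i, S.q i ≠ 0)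
    (hQ : B.Qs S - 1 ≠ 0) : B.HasPotential (B.reflectZero S) := by
  unfold HasPotential at hS ⊢
  have h0 : ∑ i, (B.s i - 1) * (B.reflectZero S).h i =
      ∑ i, (B.s i - 1) * S.h i + S.κ₀ * ∑ i, (B.s i - 1) - B.nu S * (Q S - B.Qs S) := by
    simp only [Q, Qs, Background.reflectZero, ← Finset.sum_sub_distrib, Finset.mul_sum,
      ← Finset.sum_add_distrib]
    refine Finset.sum_congr rfl fun i _ => ?_
    have hi := B.s_ne_zero i
    field_simp
  have h1 : ∑ i, (B.s i - 1) * B.w (B.reflectZero S) i =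
      ∑ i, (B.s i - 1) * B.w S i - 2 * B.nu S * (Q S - B.Qs S) := by
    simp only [Q, Qs, w_reflectZero, ← Finset.sum_sub_distrib, Finset.mul_sum]
    refine Finset.sum_congr rfl fun i _ => ?_
    have hi := B.s_ne_zero i
    field_simp
  rw [h0, hS, potential, potential, h1, Z_reflectZero hq, a_reflectZero hQ, b_reflectZero hQ,
    sum_w, Q_reflectZero]
  simp only [Background.reflectZero]
  rw [← nu_spec hQ]
  field_simp
  ring

theorem nu_reflectZero : B.nu (B.reflectZero S) = -B.nu S := by
  rw [nu, Qs_reflectZero, nu]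
  simp only [reflectZero]
  ring

theorem reflectZero_reflectZero : B.reflectZero (B.reflectZero S) = S := by
  ext i
  · simp [reflectZero]
  · rfl
  · rfl
  · change (S.x i - B.nu S * (S.q i / B.s i)) - B.nu (B.reflectZero S) * (S.q i / B.s i) = _
    rw [nu_reflectZero]; ring
  · change (S.h i + S.κ₀ - B.nu S * (S.q i / B.s i)) + -S.κ₀
      - B.nu (B.reflectZero S) * (S.q i / B.s i) = _
    rw [nu_reflectZero]; ring

theorem reflectZero_reflectOne :
    B.reflectZero (reflectOne S) = reflectOne (B.reflectZero S) := by
  ext i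
  · rfl
  · rfl
  · rfl
  · change S.x i - mu S * S.q i - B.nu S * (S.q i / B.s i)
      = S.x i - B.nu S * (S.q i / B.s i) - mu S * S.q i
    ring
  · rfl

end ReflectZero

/-! #### The symmetry `(κ_0, κ_1) ↦ (1 - κ_0, 1 - κ_1)` -/

section PointReflect

theorem w_pointReflect (i : Fin N) : B.w (B.pointReflect S) i = -B.w S i := by
  simp only [w, pointReflect]; ring

theorem y_pointReflect (hq : ∀ i, S.q i ≠ 0) (hA : B.a S * B.b S ≠ 0) (hy : ∀ i, B.y S i ≠ 0)
    (i : Fin N) : B.y (B.pointReflect S) i = S.q i * (B.a S * B.b S) / B.s i := by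
  have h1 := hy i
  have h2 := B.s_ne_zero i
  have h3 := q_mul_y (B := B) hq i
  simp only [y, pointReflect]
  rw [← y]
  generalize B.a S * B.b S = A at *
  field_simp
  linear_combination -h3

theorem Q_pointReflect : Q (B.pointReflect S) = B.Z S / (B.a S * B.b S) := by
  simp only [Q, Z, pointReflect, Finset.sum_div]

theorem Qs_pointReflect : B.Qs (B.pointReflect S) = B.Y S / (B.a S * B.b S) := by
  simp only [Qs, Y, pointReflect, Finset.sum_div]
  refine Finset.sum_congr rfl fun i _ => ?_
  have := B.s_ne_zero i
  rw [div_div, mul_comm (B.s i) (B.y S i), mul_div_mul_right _ _ this]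

theorem X_pointReflect : X (B.pointReflect S) = (∑ i, B.θ i) - X S := by
  simp only [X, pointReflect, Finset.sum_sub_distrib]

theorem a_pointReflect [CharZero K] : B.a (B.pointReflect S) = -B.b S := by
  simp only [b, a, X_pointReflect]
  simp only [pointReflect]
  field_simp
  ring

theorem b_pointReflect [CharZero K] : B.b (B.pointReflect S) = -B.a S := by
  rw [b, a_pointReflect, b]; ring

theorem Z_pointReflect (hq : ∀ i, S.q i ≠ 0) (hA : B.a S * B.b S ≠ 0) (hy : ∀ i, B.y S i ≠ 0) :
    B.Z (B.pointReflect S) = Q S * (B.a S * B.b S) := by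
  simp only [Z, Q, y_pointReflect hq hA hy, Finset.sum_mul]
  refine Finset.sum_congr rfl fun i _ => ?_
  have := B.s_ne_zero i
  field_simp

theorem g_pointReflect [CharZero K] (j : Fin N) :
    (B.s j - 1) * B.g (B.pointReflect S) j =
      B.s j * B.w S j - B.s j * B.y S j / (B.a S * B.b S) * (B.a S + B.b S) := by
  rw [g_spec, a_pointReflect, b_pointReflect, w_pointReflect]
  simp only [pointReflect]
  ring

theorem d_div (j : Fin N) (f A : K) (hA : A ≠ 0) :
    A * B.δ j (f / A) = B.δ j f - f / A * B.δ j A := by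
  have h2 : f / A * A = f := div_mul_cancel₀ _ hA
  have h3 := congrArg (B.δ j) h2
  rw [Derivation.leibniz, smul_eq_mul, smul_eq_mul] at h3
  rw [← h3]
  ring

/-- The involution exchanges q_i with s_i y_i / (ab). The new `dq` is therefore the old `dy`,
corrected by the logarithmic derivative of ab from `dA`; the new `dQ` comes from `dZ` in the same
way. -/
theorem IsFlow.pointReflect [CharZero K] (hS : B.IsFlow S) (hq : ∀ i, S.q i ≠ 0)
    (hA : B.a S * B.b S ≠ 0) (hy : ∀ i, B.y S i ≠ 0) : B.IsFlow (B.pointReflect S) where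
  dκ₀ j := by simp [Background.pointReflect, hS.dκ₀]
  dκ₁ j := by simp [Background.pointReflect, hS.dκ₁]
  dx i j := by
    rw [y_pointReflect hq hA hy, y_pointReflect hq hA hy]
    simp only [Background.pointReflect, map_sub, B.δ_θ]
    have hi := B.s_ne_zero i
    have hj := B.s_ne_zero j
    have h1 := hS.dx i j
    generalize B.a S * B.b S = A at *
    field_simp
    linear_combination -h1
  dX j := by
    rw [y_pointReflect hq hA hy, X_pointReflect, a_pointReflect, b_pointReflect]
    simp only [Background.pointReflect, map_sub, map_sum, B.δ_θ, Finset.sum_const_zero]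
    have hj := B.s_ne_zero j
    have h1 := hS.dX j
    have h2 : -B.b S * -B.a S = B.a S * B.b S := by ring
    rw [h2]
    generalize B.a S * B.b S = A at *
    field_simp
    linear_combination -h1
  dq i j := by
    have h1 := hS.dy hq i j
    have h2 := hS.dA j
    have h3 := g_pointReflect (B := B) (S := S) j
    have h4 := g_spec (B := B) (S := S) j
    have h5 := B.s_ne_one j
    have hi := B.s_ne_zero i
    by_cases hij : i = j
    · subst hij; ring
    rw [w_pointReflect, w_pointReflect]
    simp only [Background.pointReflect]
    have h6 := d_div (B := B) j (B.s i * B.y S i) _ hA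
    rw [Derivation.leibniz, B.δ_s, if_neg hij, smul_eq_mul, smul_eq_mul] at h6
    have ei : B.s i * B.y S i / (B.a S * B.b S) * (B.a S * B.b S) = B.s i * B.y S i :=
      div_mul_cancel₀ _ hA
    have ej : B.s j * B.y S j / (B.a S * B.b S) * (B.a S * B.b S) = B.s j * B.y S j :=
      div_mul_cancel₀ _ hA
    change (B.s j - B.s i) * (_ - B.g (B.pointReflect S) j * _) = _
    generalize B.s i * B.y S i / (B.a S * B.b S) = qi at *
    generalize B.s j * B.y S j / (B.a S * B.b S) = qj at *
    generalize B.g (B.pointReflect S) j = g' at *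
    generalize B.a S * B.b S = A at *
    apply mul_left_cancel₀ (mul_ne_zero hA h5)
    linear_combination (B.s j - 1) * (B.s j - B.s i) * h6 - (B.s j - B.s i) * qi * h2
      + (B.s j - 1) * B.s i * h1 - B.s i * B.y S i * (B.s j - B.s i) * h4
      - A * qi * (B.s j - B.s i) * h3
      + ((B.s j - B.s i) * (B.a S + B.b S) * qi - (B.s j - 1) * B.s i * B.w S i) * ej
      + ((B.s j - B.s i) * (B.a S + B.b S) * S.q j + (B.s i - 1) * B.s j * B.w S j) * ei
  dQ j := by
    rw [Q_pointReflect]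
    have h1 := hS.dZ hq j
    have h2 := hS.dA j
    have h3 := g_pointReflect (B := B) (S := S) j
    have h4 := g_spec (B := B) (S := S) j
    have h5 := B.s_ne_one j
    simp only [Background.pointReflect]
    have h6 := d_div (B := B) j (B.Z S) _ hA
    have ez : B.Z S / (B.a S * B.b S) * (B.a S * B.b S) = B.Z S := div_mul_cancel₀ _ hA
    have ej : B.s j * B.y S j / (B.a S * B.b S) * (B.a S * B.b S) = B.s j * B.y S j :=
      div_mul_cancel₀ _ hA
    change _ = (B.Z S / (B.a S * B.b S) - 1) * B.g (B.pointReflect S) j + _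
    generalize B.Z S / (B.a S * B.b S) = z at *
    generalize B.s j * B.y S j / (B.a S * B.b S) = qj at *
    generalize B.g (B.pointReflect S) j = g' at *
    generalize B.a S * B.b S = A at *
    apply mul_left_cancel₀ (mul_ne_zero hA h5)
    linear_combination (B.s j - 1) * h6 - z * h2 + h1 - B.Z S * h4 - A * (z - 1) * h3
      + ((B.a S + B.b S) * S.q j - B.s j * B.w S j) * ez
      + (z * (B.a S + B.b S) - (B.a S + B.b S) - (B.s j - 1) * (1 - S.κ₁)) * ej

/-- The product (Q - 1)(ab - Z) is invariant, because Q - 1 becomes (Z - ab) / (ab) and ab - Z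
becomes ab (1 - Q). The remaining terms change by the elementary shift built into h_i. -/
theorem HasPotential.pointReflect [CharZero K] (hS : B.HasPotential S) (hq : ∀ i, S.q i ≠ 0)
    (hA : B.a S * B.b S ≠ 0) (hy : ∀ i, B.y S i ≠ 0) : B.HasPotential (B.pointReflect S) := by
  unfold HasPotential at hS ⊢
  have h0 : ∑ i, (B.s i - 1) * (B.pointReflect S).h i =
      ∑ i, (B.s i - 1) * S.h i + (S.κ₀ / 2 - 1 / 4) * ∑ i, (B.s i - 1)
        - (∑ i, (B.s i - 1) * B.w S i) / 2 := by
    simp only [Background.pointReflect, ← Finset.sum_sub_distrib, Finset.mul_sum,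
      ← Finset.sum_add_distrib, Finset.sum_div]
    exact Finset.sum_congr rfl fun i _ => by ring
  have h1 : ∑ i, (B.s i - 1) * B.w (B.pointReflect S) i = -∑ i, (B.s i - 1) * B.w S i := by
    simp only [w_pointReflect, mul_neg, Finset.sum_neg_distrib]
  have h2 : -B.b S * -B.a S = B.a S * B.b S := by ring
  rw [h0, hS, potential, potential, h1, Z_pointReflect hq hA hy, a_pointReflect, b_pointReflect,
    Q_pointReflect, h2]
  simp only [Background.pointReflect]
  generalize B.a S * B.b S = A at *
  field_simp
  ring

theorem pointReflect_pointReflect [CharZero K] (hq : ∀ i, S.q i ≠ 0) (hA : B.a S * B.b S ≠ 0)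
    (hy : ∀ i, B.y S i ≠ 0) : B.pointReflect (B.pointReflect S) = S := by
  ext i
  · simp [pointReflect]
  · simp [pointReflect]
  · change B.s i * B.y (B.pointReflect S) i / (B.a (B.pointReflect S) * B.b (B.pointReflect S)) = _
    rw [y_pointReflect hq hA hy, a_pointReflect, b_pointReflect, neg_mul_neg,
      mul_comm (B.b S) (B.a S)]
    have := B.s_ne_zero i
    generalize B.a S * B.b S = A at *
    field_simp
  · simp [pointReflect]
  · change S.h i - B.w S i / 2 + S.κ₀ / 2 - 1 / 4 - B.w (B.pointReflect S) i / 2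
      + (1 - S.κ₀) / 2 - 1 / 4 = S.h i
    rw [w_pointReflect]
    field_simp
    ring

end PointReflect

end Background

namespace Background

variable {N : ℕ} {K : Type*} [Field K] (B : Background N K) (S : State N K)

/-! ### The reflection `κ_0 ↦ 2 - κ_0` commutes with `κ_1 ↦ -κ_1` -/

/-- Up to the factor ab, this is ν after the point reflection (`nu_pointReflect`). It belongs to the
locus Y = ab. -/
def lam : K := (1 - S.κ₀) / (B.Y S - B.a S * B.b S)

/-- The symmetry `κ_0 ↦ 2 - κ_0`. -/
def reflectTwo : State N K := B.pointReflect (B.reflectZero (B.pointReflect S))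

variable {B S}

theorem lam_spec (hY : B.Y S - B.a S * B.b S ≠ 0) :
    B.lam S * (B.Y S - B.a S * B.b S) = 1 - S.κ₀ := by
  unfold lam; field_simp

theorem Qs_pointReflect_sub_one (hA : B.a S * B.b S ≠ 0) :
    B.Qs (B.pointReflect S) - 1 = (B.Y S - B.a S * B.b S) / (B.a S * B.b S) := by
  rw [Qs_pointReflect, sub_div, div_self hA]

theorem nu_pointReflect (hA : B.a S * B.b S ≠ 0) :
    B.nu (B.pointReflect S) = B.a S * B.b S * B.lam S := by
  rw [nu, Qs_pointReflect_sub_one hA, lam]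
  simp only [pointReflect]
  rw [div_div_eq_mul_div, mul_comm, mul_div_assoc]

/-- The quantity `ν q_i / s_i` after the point reflection. -/
theorem nu_mul_pointReflect (hA : B.a S * B.b S ≠ 0) (i : Fin N) :
    B.nu (B.pointReflect S) * ((B.pointReflect S).q i / B.s i) = B.lam S * B.y S i := by
  rw [nu_pointReflect hA]
  simp only [pointReflect]
  have := B.s_ne_zero i
  generalize B.a S * B.b S = A at *
  field_simp

theorem reflectTwo_κ₀ : (B.reflectTwo S).κ₀ = 2 - S.κ₀ := by
  simp only [reflectTwo, pointReflect, reflectZero]; ring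

theorem reflectTwo_κ₁ : (B.reflectTwo S).κ₁ = S.κ₁ := by
  simp only [reflectTwo, pointReflect, reflectZero]; ring

theorem reflectTwo_x (hA : B.a S * B.b S ≠ 0) (i : Fin N) :
    (B.reflectTwo S).x i = S.x i + B.lam S * B.y S i := by
  have h := nu_mul_pointReflect hA i
  change B.θ i - (B.θ i - S.x i - B.nu (B.pointReflect S) * ((B.pointReflect S).q i / B.s i)) = _
  rw [h]; ring

/-- The changes of h from the three factors cancel: like the reflection in κ_1, this one fixes the
τ-function. -/
theorem reflectTwo_h [CharZero K] (hA : B.a S * B.b S ≠ 0) (i : Fin N) :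
    (B.reflectTwo S).h i = S.h i := by
  have h := nu_mul_pointReflect hA i
  change S.h i - B.w S i / 2 + S.κ₀ / 2 - 1 / 4 + (1 - S.κ₀)
    - B.nu (B.pointReflect S) * ((B.pointReflect S).q i / B.s i)
    - B.w (B.reflectZero (B.pointReflect S)) i / 2 + -(1 - S.κ₀) / 2 - 1 / 4 = S.h i
  rw [w_reflectZero, w_pointReflect, mul_assoc, h]
  field_simp
  ring

theorem ab_reflectZero_pointReflect [CharZero K] (hA : B.a S * B.b S ≠ 0)
    (hY : B.Y S - B.a S * B.b S ≠ 0) :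
    B.a (B.reflectZero (B.pointReflect S)) * B.b (B.reflectZero (B.pointReflect S)) =
      ((1 + B.lam S * B.a S) * (1 + B.lam S * B.b S)) * (B.a S * B.b S) := by
  have hQ : B.Qs (B.pointReflect S) - 1 ≠ 0 := by
    rw [Qs_pointReflect_sub_one hA]; exact div_ne_zero hY hA
  rw [a_reflectZero hQ, b_reflectZero hQ, a_pointReflect, b_pointReflect, nu_pointReflect hA]
  ring

theorem reflectTwo_q [CharZero K] (hq : ∀ i, S.q i ≠ 0) (hA : B.a S * B.b S ≠ 0)
    (hy : ∀ i, B.y S i ≠ 0) (hY : B.Y S - B.a S * B.b S ≠ 0) (i : Fin N) :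
    (B.reflectTwo S).q i = (S.q i + B.lam S * B.w S i + B.lam S ^ 2 * B.y S i) /
      ((1 + B.lam S * B.a S) * (1 + B.lam S * B.b S)) := by
  have h := nu_mul_pointReflect hA i
  have hs := B.s_ne_zero i
  have hq' : ∀ i, (B.pointReflect S).q i ≠ 0 := fun i =>
    div_ne_zero (mul_ne_zero (B.s_ne_zero i) (hy i)) hA
  change B.s i * B.y (B.reflectZero (B.pointReflect S)) i /
    (B.a (B.reflectZero (B.pointReflect S)) * B.b (B.reflectZero (B.pointReflect S))) = _
  have h1 : B.s i * B.y (B.reflectZero (B.pointReflect S)) i =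
      (S.q i + B.lam S * B.w S i + B.lam S ^ 2 * B.y S i) * (B.a S * B.b S) := by
    rw [y_reflectZero hq', y_pointReflect hq hA hy, w_pointReflect, nu_pointReflect hA]
    simp only [pointReflect]
    generalize B.a S * B.b S = A at *
    field_simp
    ring
  rw [h1, ab_reflectZero_pointReflect hA hY, mul_div_mul_right _ _ hA]

theorem Q_reflectTwo_sub_one [CharZero K] (hq : ∀ i, S.q i ≠ 0) (hA : B.a S * B.b S ≠ 0)
    (hy : ∀ i, B.y S i ≠ 0) (hY : B.Y S - B.a S * B.b S ≠ 0)
    (hab : (1 + B.lam S * B.a S) * (1 + B.lam S * B.b S) ≠ 0) (hQ : Q S - 1 ≠ 0) :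
    (Q (B.reflectTwo S) - 1) * ((1 + B.lam S * B.a S) * (1 + B.lam S * B.b S)) =
      (Q S - 1) * (1 + B.lam S * mu S) := by
  have h1 : Q (B.reflectTwo S) * ((1 + B.lam S * B.a S) * (1 + B.lam S * B.b S)) =
      Q S + B.lam S * (∑ i, B.w S i) + B.lam S ^ 2 * B.Y S := by
    simp only [Q, reflectTwo_q hq hA hy hY, ← Finset.sum_div, Y, Finset.mul_sum,
      ← Finset.sum_add_distrib]
    exact div_mul_cancel₀ _ hab
  rw [sub_mul, h1, sum_w]
  linear_combination B.lam S * lam_spec hY - B.lam S * mu_spec hQ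

theorem YA_reflectOne [CharZero K] (hq : ∀ i, S.q i ≠ 0) (hQ : Q S - 1 ≠ 0) :
    B.Y (reflectOne S) - B.a (reflectOne S) * B.b (reflectOne S) =
      B.Y S - B.a S * B.b S + (1 - S.κ₀) * mu S := by
  rw [Y_reflectOne hq, a_reflectOne hQ, b_reflectOne hQ, sum_w]
  linear_combination mu S * mu_spec hQ

/-- Both composites are computed explicitly. With d = 1 + λμ, the first reflection replaces λ by λ /
d, and the second replaces μ by μ (1 + λa)(1 + λb) / d; with these two rules the expressions for q
and x agree. -/
theorem reflectTwo_reflectOne [CharZero K] (hq : ∀ i, S.q i ≠ 0) (hA : B.a S * B.b S ≠ 0)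
    (hy : ∀ i, B.y S i ≠ 0) (hY : B.Y S - B.a S * B.b S ≠ 0) (hQ : Q S - 1 ≠ 0)
    (hab : (1 + B.lam S * B.a S) * (1 + B.lam S * B.b S) ≠ 0)
    (hA' : B.a (reflectOne S) * B.b (reflectOne S) ≠ 0) (hy' : ∀ i, B.y (reflectOne S) i ≠ 0)
    (hY' : B.Y (reflectOne S) - B.a (reflectOne S) * B.b (reflectOne S) ≠ 0) :
    B.reflectTwo (reflectOne S) = reflectOne (B.reflectTwo S) := by
  -- Indeed (Y - ab)(1 + λμ) is the value of Y - ab at the reflected state, which is nonzero by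
  -- assumption.
  have hD : 1 + B.lam S * mu S ≠ 0 := by
    intro h
    rw [YA_reflectOne hq hQ, ← lam_spec hY] at hY'
    apply hY'
    linear_combination (B.Y S - B.a S * B.b S) * h
  have hl : B.lam (reflectOne S) = B.lam S / (1 + B.lam S * mu S) := by
    rw [eq_div_iff hD]
    apply mul_right_cancel₀ hY
    have h := lam_spec hY'
    rw [YA_reflectOne hq hQ] at h
    change _ = 1 - S.κ₀ at h
    linear_combination h + (mu S * B.lam (reflectOne S) - 1) * lam_spec hY
  have hm : mu (B.reflectTwo S) * (1 + B.lam S * mu S) =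
      mu S * ((1 + B.lam S * B.a S) * (1 + B.lam S * B.b S)) := by
    have h1 := Q_reflectTwo_sub_one hq hA hy hY hab hQ
    have h2 : Q (B.reflectTwo S) - 1 ≠ 0 := by
      intro h0
      rw [h0, zero_mul] at h1
      exact mul_ne_zero hQ hD h1.symm
    have h3 := mu_spec h2
    rw [reflectTwo_κ₁] at h3
    apply mul_left_cancel₀ (mul_ne_zero h2 hQ)
    linear_combination ((1 + B.lam S * mu S) * (Q S - 1)) * h3
      - S.κ₁ * h1 - (Q (B.reflectTwo S) - 1) *
      ((1 + B.lam S * B.a S) * (1 + B.lam S * B.b S)) * mu_spec hQ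
  ext i
  · rw [reflectTwo_κ₀]
    change _ = (B.reflectTwo S).κ₀
    rw [reflectTwo_κ₀]; rfl
  · rw [reflectTwo_κ₁]
    change _ = -(B.reflectTwo S).κ₁
    rw [reflectTwo_κ₁]; rfl
  · rw [reflectTwo_q (S := reflectOne S) hq hA' hy' hY', hl, w_reflectOne, y_reflectOne hq, a_reflectOne hQ,
      b_reflectOne hQ]
    change _ = (B.reflectTwo S).q i
    rw [reflectTwo_q hq hA hy hY]
    change (S.q i + _ + _) / _ = _
    have e1 : S.q i + B.lam S / (1 + B.lam S * mu S) * (B.w S i - 2 * mu S * S.q i)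
        + (B.lam S / (1 + B.lam S * mu S)) ^ 2 * (B.y S i - mu S * B.w S i + mu S ^ 2 * S.q i) =
        (S.q i + B.lam S * B.w S i + B.lam S ^ 2 * B.y S i) / (1 + B.lam S * mu S) ^ 2 := by
      field_simp
      ring
    have e2 : (1 + B.lam S / (1 + B.lam S * mu S) * (B.a S - mu S)) *
        (1 + B.lam S / (1 + B.lam S * mu S) * (B.b S - mu S)) =
        ((1 + B.lam S * B.a S) * (1 + B.lam S * B.b S)) / (1 + B.lam S * mu S) ^ 2 := by
      field_simp
      ring
    rw [e1, e2, div_div_div_cancel_right₀ (pow_ne_zero 2 hD)]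
  · rw [reflectTwo_x hA', hl, y_reflectOne hq]
    change S.x i - mu S * S.q i + _ = (B.reflectTwo S).x i
      - mu (B.reflectTwo S) * (B.reflectTwo S).q i
    rw [reflectTwo_x hA, reflectTwo_q hq hA hy hY]
    have h3 : mu (B.reflectTwo S) =
        mu S * ((1 + B.lam S * B.a S) * (1 + B.lam S * B.b S)) / (1 + B.lam S * mu S) := by
      rw [eq_div_iff hD, hm]
    rw [h3]
    generalize (1 + B.lam S * B.a S) * (1 + B.lam S * B.b S) = P at *
    generalize hd : 1 + B.lam S * mu S = d at *
    field_simp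
    linear_combination (mu S * S.q i + B.lam S * B.y S i) * hd
  · rw [reflectTwo_h hA']
    change _ = (B.reflectTwo S).h i
    rw [reflectTwo_h hA]
    rfl

/-! ### The Toda equation -/

/-- The operator `∑ (s_j - 1) / s_j δ_j`. -/
def todaOp (B : Background N K) (f : K) : K := ∑ j, (B.s j - 1) / B.s j * B.δ j f

theorem IsFlow.d_first (hS : B.IsFlow S) [CharZero K] (hq : ∀ i, S.q i ≠ 0) (j : Fin N) :
    B.δ j ((Q S - 1) * (B.a S * B.b S - B.Z S)) =
      -(1 - S.κ₁) * (Q S - 1) * (B.s j * B.y S j) + S.κ₁ * S.q j * (B.a S * B.b S - B.Z S) := by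
  have h1 := hS.dZ hq j
  have h2 := hS.dA j
  have h3 := g_spec (B := B) (S := S) j
  apply mul_left_cancel₀ (B.s_ne_one j)
  rw [Derivation.leibniz, map_sub _ (Q S), Derivation.map_one_eq_zero, hS.dQ, map_sub]
  simp only [smul_eq_mul]
  linear_combination (Q S - 1) * h2 - (Q S - 1) * h1 + (Q S - 1) * (B.a S * B.b S) * h3

theorem d_two [CharZero K] (j : Fin N) : B.δ j (2 : K) = 0 := by
  simpa using (B.δ j).map_natCast 2

theorem IsFlow.d_second (hS : B.IsFlow S) [CharZero K] (j : Fin N) :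
    B.δ j (∑ i, (B.s i - 1) * B.w S i) =
      -2 * (B.s j * B.y S j) * (Q S - 1) + 2 * S.q j * (B.Z S - B.a S * B.b S)
        + B.s j * B.w S j := by
  have h1 : ∀ i, B.δ j ((B.s i - 1) * B.w S i) = 2 * (B.s j - 1) * B.δ j (S.x i)
      - 2 * (B.s j * B.y S j * S.q i - B.s i * B.y S i * S.q j)
      + if i = j then B.s i * B.w S i else 0 := by
    intro i
    have := hS.dx i j
    simp only [w, Derivation.leibniz, smul_eq_mul, map_sub, B.δ_θ, B.δ_s, d_two,
      Derivation.map_one_eq_zero]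
    split_ifs <;> linear_combination -2 * this
  rw [map_sum, Finset.sum_congr rfl fun i _ => h1 i]
  simp only [Finset.sum_add_distrib, Finset.sum_sub_distrib, ← Finset.mul_sum,
      ← Finset.sum_mul, Finset.sum_ite_eq', Finset.mem_univ, if_true, ← map_sum]
  change 2 * (B.s j - 1) * B.δ j (X S) - 2 * (B.s j * B.y S j * Q S - B.Z S * S.q j) + _ = _
  linear_combination 2 * hS.dX j

theorem IsFlow.d_potential (hS : B.IsFlow S) [CharZero K] (hq : ∀ i, S.q i ≠ 0) (j : Fin N) :
    B.δ j (B.potential S) = -(Q S - 1) * (B.s j * B.y S j) + S.κ₁ / 2 * (B.s j * B.w S j)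
      - B.δ j B.γ + (S.κ₀ - 1 / 2) * (S.κ₀ - 3 / 2) / 4 * B.s j := by
  have h1 := hS.d_first hq j
  have h2 := hS.d_second j
  have h3 : B.δ j (∑ i, (B.s i - 1)) = B.s j := by
    simp [map_sum, B.δ_s]
  have c1 : ∀ n : ℕ, [n.AtLeastTwo] → B.δ j (OfNat.ofNat n : K) = 0 := fun n _ => by
    have := (B.δ j).map_natCast (OfNat.ofNat n)
    rwa [Nat.cast_ofNat] at this
  have hk : B.δ j (S.κ₁ / 2) = 0 := by
    rw [Derivation.leibniz_div, hS.dκ₁, c1]; simp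
  have hf : B.δ j ((S.κ₀ - 1 / 2) * (S.κ₀ - 3 / 2) / 4) = 0 := by
    simp [Derivation.leibniz_div, Derivation.leibniz, Derivation.leibniz_inv, hS.dκ₀, c1]
  have hc : B.δ j ((S.κ₀ + S.κ₁ - 1) ^ 2 / 4) = 0 := by
    simp [Derivation.leibniz_div, Derivation.leibniz_pow, hS.dκ₀, hS.dκ₁, c1]
  unfold potential
  rw [map_add, map_add, map_sub, map_add, h1, Derivation.leibniz, Derivation.leibniz, h2, h3, hk,
    hf, hc]
  simp only [smul_eq_mul]
  field_simp
  ring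

/-- By `d_potential`, the weights (s_j - 1) / s_j turn the terms s_j y_j into Z - Y. Subtracting the
potential then removes Z and the sum of the w_i, leaving a product of two invariant loci. -/
theorem IsFlow.todaOp_potential (hS : B.IsFlow S) [CharZero K] (hq : ∀ i, S.q i ≠ 0) :
    B.todaOp (B.potential S) - B.potential S =
      (Q S - 1) * (B.Y S - B.a S * B.b S) - (B.todaOp B.γ - B.γ)
        - (S.κ₀ + S.κ₁ - 1) ^ 2 / 4 := by
  have h1 : B.todaOp (B.potential S) = -(Q S - 1) * (B.Z S - B.Y S)
      + S.κ₁ / 2 * (∑ i, (B.s i - 1) * B.w S i) - B.todaOp B.γ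
      + (S.κ₀ - 1 / 2) * (S.κ₀ - 3 / 2) / 4 * ∑ i, (B.s i - 1) := by
    simp only [todaOp, hS.d_potential hq, Z, Y, ← Finset.sum_sub_distrib, Finset.mul_sum,
      ← Finset.sum_add_distrib]
    refine Finset.sum_congr rfl fun i _ => ?_
    have := B.s_ne_zero i
    field_simp
  rw [h1, potential]
  ring

/-- The right-hand side of the Toda equation, up to elementary factors. -/
def todaValue (B : Background N K) (S : State N K) : K :=
  (Q S - 1) * (B.Y S - B.a S * B.b S)

/-- The factor Q - 1 has logarithmic derivative g_j + μ q_j and Y - ab has -(g_j + w_j) - λ y_j; the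
g_j cancel. -/
theorem IsFlow.d_todaValue (hS : B.IsFlow S) [CharZero K] (hq : ∀ i, S.q i ≠ 0)
    (hQ : Q S - 1 ≠ 0) (hY : B.Y S - B.a S * B.b S ≠ 0) (j : Fin N) :
    B.δ j (B.todaValue S) =
      B.todaValue S * (-B.w S j + mu S * S.q j - B.lam S * B.y S j) := by
  unfold todaValue
  rw [Derivation.leibniz, map_sub _ (Q S), Derivation.map_one_eq_zero, hS.dQ, hS.dYA hq,
    ← mu_spec hQ, ← lam_spec hY]
  simp only [smul_eq_mul]
  ring

/-- The two Toda directions are exchanged by the reflection in κ_1. The difference found here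
accounts for the two values of c in the recurrences. -/
theorem todaValue_reflectOne [CharZero K] (hq : ∀ i, S.q i ≠ 0) (hQ : Q S - 1 ≠ 0) :
    B.todaValue (reflectOne S) = B.todaValue S + S.κ₁ * (1 - S.κ₀) := by
  rw [todaValue, YA_reflectOne hq hQ, Q_reflectOne, todaValue]
  linear_combination (1 - S.κ₀) * mu_spec hQ

theorem h_up [CharZero K] (i : Fin N) :
    (B.pointReflect (B.reflectZero (reflectOne S))).h i =
      S.h i - B.w S i / 2 + mu S * S.q i + S.κ₀ / 2 - 1 / 4 := by
  change S.h i + S.κ₀ - B.nu S * (S.q i / B.s i) - B.w (B.reflectZero (reflectOne S)) i / 2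
    + -S.κ₀ / 2 - 1 / 4 = _
  rw [w_reflectZero, w_reflectOne]
  change S.h i + S.κ₀ - B.nu S * (S.q i / B.s i) -
    (B.w S i - 2 * mu S * S.q i - 2 * B.nu S * (S.q i / B.s i)) / 2
    + -S.κ₀ / 2 - 1 / 4 = _
  field_simp
  ring

theorem h_down [CharZero K] (hA : B.a S * B.b S ≠ 0) (i : Fin N) :
    (reflectOne (B.reflectZero (B.pointReflect S))).h i =
      S.h i - B.w S i / 2 - B.lam S * B.y S i - S.κ₀ / 2 + 3 / 4 := by
  change S.h i - B.w S i / 2 + S.κ₀ / 2 - 1 / 4 + (1 - S.κ₀)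
    - B.nu (B.pointReflect S) * ((B.pointReflect S).q i / B.s i) = _
  rw [nu_mul_pointReflect hA]
  field_simp
  ring

/-- Together with `d_todaValue` this is the Toda equation in logarithmic form; the summand 1/2 is
the logarithmic derivative of ∏ t_i. -/
theorem h_up_add_h_down [CharZero K] (hA : B.a S * B.b S ≠ 0) (i : Fin N) :
    (B.pointReflect (B.reflectZero (reflectOne S))).h i
      + (reflectOne (B.reflectZero (B.pointReflect S))).h i - 2 * S.h i =
      1 / 2 + (-B.w S i + mu S * S.q i - B.lam S * B.y S i) := by
  rw [h_up, h_down hA]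
  field_simp
  ring

end Background

/-! ### Units congruent to one for a valuation -/

section OneUnit

variable {K Γ₀ : Type*} [Field K] [LinearOrderedCommGroupWithZero Γ₀] (v : Valuation K Γ₀)

/-- The element `f` is congruent to `1` modulo the maximal ideal of the valuation ring. -/
def IsOneUnit (f : K) : Prop := v (f - 1) < 1

variable {v} {f g : K}

theorem IsOneUnit.val (hf : IsOneUnit v f) : v f = 1 := by
  have h := v.map_one_add_of_lt hf
  rwa [add_sub_cancel] at h

theorem IsOneUnit.ne_zero (hf : IsOneUnit v f) : f ≠ 0 := by
  intro h
  have := hf.val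
  simp [h] at this

theorem IsOneUnit.mul (hf : IsOneUnit v f) (hg : IsOneUnit v g) : IsOneUnit v (f * g) := by
  have h : f * g - 1 = f * (g - 1) + (f - 1) := by ring
  unfold IsOneUnit
  rw [h]
  refine v.map_add_lt ?_ hf
  rw [map_mul, hf.val, one_mul]
  exact hg

theorem IsOneUnit.inv (hf : IsOneUnit v f) : IsOneUnit v f⁻¹ := by
  have h0 := hf.ne_zero
  have h : f⁻¹ - 1 = -(f⁻¹ * (f - 1)) := by field_simp; ring
  unfold IsOneUnit
  rw [h, Valuation.map_neg, map_mul, map_inv₀, hf.val, inv_one, one_mul]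
  exact hf

theorem IsOneUnit.div (hf : IsOneUnit v f) (hg : IsOneUnit v g) : IsOneUnit v (f / g) := by
  rw [div_eq_mul_inv]
  exact hf.mul hg.inv

end OneUnit

theorem eq_add_of_step {K : Type*} [Field K] {f : ℤ → K} {c : K} (h : ∀ k, f (k + 1) = f k + c) (k : ℤ) :
    f k = f 0 + k * c := by
  induction k with
  | zero => simp
  | succ k ih => rw [h, ih]; push_cast; ring
  | pred k ih =>
    have := h (-k - 1)
    rw [sub_add_cancel, ih] at this
    push_cast at this ⊢
    linear_combination -this

/-! ### Tame states at κ = ∞. -/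

namespace Background

variable {N : ℕ} {K Γ₀ : Type*} [Field K] [LinearOrderedCommGroupWithZero Γ₀]

/-- A valuation for which `κ` is infinitely large, and the `θ_i` and `t_i = √s_i` are units. -/
structure IsLarge (B : Background N K) (v : Valuation K Γ₀) (t : Fin N → K) : Prop where
  t_sq : ∀ i, t i ^ 2 = B.s i
  v_two : v 2 = 1
  v_κ : 1 < v B.κ
  v_θ : ∀ i, v (B.θ i) = 1
  v_t : ∀ i, v (t i) = 1

/-- The state `S` has the leading behaviour `q_i ∼ θ_i t_i / κ`, `x_i ∼ θ_i / 2` as `κ → ∞`. -/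
structure IsTame (B : Background N K) (v : Valuation K Γ₀) (t : Fin N → K) (S : State N K) :
    Prop where
  v_κ₀ : v S.κ₀ ≤ 1
  v_κ₁ : v S.κ₁ ≤ 1
  x_sub : ∀ i, v (S.x i - B.θ i / 2) < 1
  q_unit : ∀ i, IsOneUnit v (B.κ * S.q i / (B.θ i * t i))

variable {B : Background N K} {v : Valuation K Γ₀} {t : Fin N → K} {S : State N K}

namespace IsLarge

variable (hB : B.IsLarge v t)
include hB

theorem two_ne : (2 : K) ≠ 0 := v.ne_zero_iff.1 (by rw [hB.v_two]; exact one_ne_zero)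

theorem κ_ne : B.κ ≠ 0 := v.ne_zero_iff.1 (ne_of_gt (zero_lt_one.trans hB.v_κ))

theorem θ_ne (i : Fin N) : B.θ i ≠ 0 := v.ne_zero_iff.1 (by rw [hB.v_θ]; exact one_ne_zero)

theorem t_ne (i : Fin N) : t i ≠ 0 := v.ne_zero_iff.1 (by rw [hB.v_t]; exact one_ne_zero)

theorem v_s (i : Fin N) : v (B.s i) = 1 := by rw [← hB.t_sq, map_pow, hB.v_t, one_pow]

end IsLarge

namespace IsTame

theorem v_q (hS : B.IsTame v t S) (hB : B.IsLarge v t) (i : Fin N) : v (S.q i) = (v B.κ)⁻¹ := by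
  have h := (hS.q_unit i).val
  rw [map_div₀, map_mul, map_mul, hB.v_θ, hB.v_t, mul_one, div_one] at h
  exact eq_inv_of_mul_eq_one_right h

theorem v_q_lt (hS : B.IsTame v t S) (hB : B.IsLarge v t) (i : Fin N) : v (S.q i) < 1 := by
  rw [hS.v_q hB]
  exact inv_lt_one_of_one_lt₀ hB.v_κ

theorem q_ne (hS : B.IsTame v t S) (hB : B.IsLarge v t) (i : Fin N) : S.q i ≠ 0 := by
  apply v.ne_zero_iff.1
  rw [hS.v_q hB]
  exact inv_ne_zero (v.ne_zero_iff.2 hB.κ_ne)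

theorem v_Q (hS : B.IsTame v t S) (hB : B.IsLarge v t) : v (Q S - 1) = 1 := by
  rw [Valuation.map_sub_swap]
  exact v.map_one_sub_of_lt (v.map_sum_lt one_ne_zero fun i _ => hS.v_q_lt hB i)

theorem Q_ne (hS : B.IsTame v t S) (hB : B.IsLarge v t) : Q S - 1 ≠ 0 :=
  v.ne_zero_iff.1 (by rw [hS.v_Q hB]; exact one_ne_zero)

theorem v_q_div (hS : B.IsTame v t S) (hB : B.IsLarge v t) (i : Fin N) :
    v (S.q i / B.s i) < 1 := by
  rw [map_div₀, hB.v_s, div_one]; exact hS.v_q_lt hB i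

theorem v_Qs (hS : B.IsTame v t S) (hB : B.IsLarge v t) : v (B.Qs S - 1) = 1 := by
  rw [Valuation.map_sub_swap]
  exact v.map_one_sub_of_lt (v.map_sum_lt one_ne_zero fun i _ => hS.v_q_div hB i)

theorem Qs_ne (hS : B.IsTame v t S) (hB : B.IsLarge v t) : B.Qs S - 1 ≠ 0 :=
  v.ne_zero_iff.1 (by rw [hS.v_Qs hB]; exact one_ne_zero)

theorem v_mu (hS : B.IsTame v t S) (hB : B.IsLarge v t) : v (mu S) ≤ 1 := by
  rw [mu, map_div₀, hS.v_Q hB, div_one]; exact hS.v_κ₁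

theorem v_nu (hS : B.IsTame v t S) (hB : B.IsLarge v t) : v (B.nu S) ≤ 1 := by
  rw [nu, map_div₀, hS.v_Qs hB, div_one]; exact hS.v_κ₀

theorem v_w (hS : B.IsTame v t S) (hB : B.IsLarge v t) (i : Fin N) : v (B.w S i) < 1 := by
  have h2 := hB.two_ne
  have : B.w S i = 2 * (S.x i - B.θ i / 2) := by unfold w; field_simp
  rw [this, map_mul, hB.v_two, one_mul]
  exact hS.x_sub i

theorem x_unit (hS : B.IsTame v t S) (hB : B.IsLarge v t) (i : Fin N) :
    IsOneUnit v (2 * S.x i / B.θ i) := by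
  have h := hB.θ_ne i
  have : 2 * S.x i / B.θ i - 1 = B.w S i / B.θ i := by unfold w; field_simp
  rw [IsOneUnit, this, map_div₀, hB.v_θ, div_one]
  exact hS.v_w hB i

theorem x_sub_unit (hS : B.IsTame v t S) (hB : B.IsLarge v t) (i : Fin N) :
    IsOneUnit v (-2 * (S.x i - B.θ i) / B.θ i) := by
  have h := hB.θ_ne i
  have : -2 * (S.x i - B.θ i) / B.θ i - 1 = -(B.w S i / B.θ i) := by
    unfold w; field_simp; ring
  rw [IsOneUnit, this, Valuation.map_neg, map_div₀, hB.v_θ, div_one]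
  exact hS.v_w hB i

theorem y_unit (hS : B.IsTame v t S) (hB : B.IsLarge v t) (i : Fin N) :
    IsOneUnit v (-4 * B.y S i * t i / (B.κ * B.θ i)) := by
  have h := ((hS.x_unit hB i).mul (hS.x_sub_unit hB i)).div (hS.q_unit i)
  convert h using 1
  have h1 := hB.θ_ne i
  have h2 := hB.t_ne i
  have h3 := hB.κ_ne
  have h4 := hS.q_ne hB i
  unfold y
  field_simp
  ring

theorem v_four (hB : B.IsLarge v t) : v 4 = 1 := by
  rw [show (4 : K) = 2 * 2 by norm_num, map_mul, hB.v_two, one_mul]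

theorem v_y (hS : B.IsTame v t S) (hB : B.IsLarge v t) (i : Fin N) : v (B.y S i) = v B.κ := by
  have h := (hS.y_unit hB i).val
  have hκ := v.ne_zero_iff.2 hB.κ_ne
  rw [map_div₀, map_mul, map_mul, map_mul, Valuation.map_neg, v_four hB, hB.v_t, hB.v_θ, one_mul,
    mul_one, mul_one, div_eq_one_iff_eq hκ] at h
  exact h

theorem y_ne (hS : B.IsTame v t S) (hB : B.IsLarge v t) (i : Fin N) : B.y S i ≠ 0 := by
  apply v.ne_zero_iff.1
  rw [hS.v_y hB]
  exact v.ne_zero_iff.2 hB.κ_ne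

theorem v_shift [CharZero K] (hS : B.IsTame v t S) (hB : B.IsLarge v t) :
    v (B.a S + B.b S) ≤ 1 := by
  have h : B.a S + B.b S = (∑ i, B.w S i) - (S.κ₀ + S.κ₁ - 1) := by rw [sum_w]; ring
  rw [h]
  refine (v.map_sub _ _).trans (max_le (v.map_sum_le fun i _ => (hS.v_w hB i).le) ?_)
  refine (v.map_sub _ _).trans (max_le (v.map_add_le hS.v_κ₀ hS.v_κ₁) (by simp))

theorem v_div_κ {f : K} (hB : B.IsLarge v t) (hf : v f ≤ 1) : v (f / B.κ) < 1 := by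
  rw [map_div₀]
  exact (div_lt_one₀ (zero_lt_one.trans hB.v_κ)).2 (hf.trans_lt hB.v_κ)

/-- Since b - a = κ while a + b is integral, a ∼ -κ / 2 and b ∼ κ / 2. -/
theorem ab_unit [CharZero K] (hS : B.IsTame v t S) (hB : B.IsLarge v t) :
    IsOneUnit v (-4 * (B.a S * B.b S) / B.κ ^ 2) := by
  have h3 := hB.κ_ne
  have hb : B.b S = B.a S + B.κ := rfl
  have h1 : IsOneUnit v (-2 * B.a S / B.κ) := by
    have : -2 * B.a S / B.κ - 1 = -((B.a S + B.b S) / B.κ) := by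
      rw [hb]; field_simp; ring
    rw [IsOneUnit, this, Valuation.map_neg]
    exact v_div_κ hB (hS.v_shift hB)
  have h2 : IsOneUnit v (2 * B.b S / B.κ) := by
    have : 2 * B.b S / B.κ - 1 = ((B.a S + B.b S) / B.κ) := by
      rw [hb]; field_simp; ring
    rw [IsOneUnit, this]
    exact v_div_κ hB (hS.v_shift hB)
  convert h1.mul h2 using 1
  field_simp
  ring

theorem v_ab [CharZero K] (hS : B.IsTame v t S) (hB : B.IsLarge v t) :
    v (B.a S * B.b S) = v B.κ ^ 2 := by
  have h := (hS.ab_unit hB).val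
  have hκ := pow_ne_zero 2 (v.ne_zero_iff.2 hB.κ_ne)
  rw [map_div₀, map_mul, Valuation.map_neg, v_four hB, one_mul, map_pow,
    div_eq_one_iff_eq hκ] at h
  exact h

theorem ab_ne [CharZero K] (hS : B.IsTame v t S) (hB : B.IsLarge v t) : B.a S * B.b S ≠ 0 := by
  apply v.ne_zero_iff.1
  rw [hS.v_ab hB]
  exact pow_ne_zero 2 (v.ne_zero_iff.2 hB.κ_ne)

/-- No cancellation is possible: Y has valuation at most that of κ, whereas ab has that of κ². -/
theorem YA_ne [CharZero K] (hS : B.IsTame v t S) (hB : B.IsLarge v t) :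
    B.Y S - B.a S * B.b S ≠ 0 := by
  have h1 : v (B.Y S) < v (B.a S * B.b S) := by
    rw [hS.v_ab hB]
    refine (v.map_sum_le fun i _ => (hS.v_y hB i).le).trans_lt ?_
    rw [sq]
    exact lt_mul_of_one_lt_left (zero_lt_one.trans hB.v_κ) hB.v_κ
  intro h
  rw [sub_eq_zero] at h
  exact h1.ne (congrArg v h)

theorem todaValue_ne [CharZero K] (hS : B.IsTame v t S) (hB : B.IsLarge v t) :
    B.todaValue S ≠ 0 := mul_ne_zero (hS.Q_ne hB) (hS.YA_ne hB)

theorem reflectOne (hS : B.IsTame v t S) (hB : B.IsLarge v t) :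
    B.IsTame v t (reflectOne S) where
  v_κ₀ := hS.v_κ₀
  v_κ₁ := by
    change v (-S.κ₁) ≤ 1
    rw [Valuation.map_neg]; exact hS.v_κ₁
  x_sub i := by
    change v (S.x i - mu S * S.q i - B.θ i / 2) < 1
    rw [sub_right_comm]
    refine v.map_sub_lt (hS.x_sub i) ?_
    rw [map_mul]
    exact (mul_le_of_le_one_left zero_le (hS.v_mu hB)).trans_lt (hS.v_q_lt hB i)
  q_unit := hS.q_unit

theorem reflectZero (hS : B.IsTame v t S) (hB : B.IsLarge v t) :
    B.IsTame v t (B.reflectZero S) where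
  v_κ₀ := by
    change v (-S.κ₀) ≤ 1
    rw [Valuation.map_neg]; exact hS.v_κ₀
  v_κ₁ := hS.v_κ₁
  x_sub i := by
    change v (S.x i - B.nu S * (S.q i / B.s i) - B.θ i / 2) < 1
    rw [sub_right_comm]
    refine v.map_sub_lt (hS.x_sub i) ?_
    rw [map_mul]
    exact (mul_le_of_le_one_left zero_le (hS.v_nu hB)).trans_lt (hS.v_q_div hB i)
  q_unit := hS.q_unit

/-- From y_i ∼ -κ θ_i / (4 t_i) and ab ∼ -κ² / 4 one gets s_i y_i / (ab) ∼ θ_i t_i / κ again. Sizes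
alone would not give this, which is why `IsTame` records leading coefficients. -/
theorem pointReflect [CharZero K] (hS : B.IsTame v t S) (hB : B.IsLarge v t) :
    B.IsTame v t (B.pointReflect S) where
  v_κ₀ := (v.map_sub _ _).trans (max_le (by simp) hS.v_κ₀)
  v_κ₁ := (v.map_sub _ _).trans (max_le (by simp) hS.v_κ₁)
  x_sub i := by
    have h2 := hB.two_ne
    have : B.θ i - S.x i - B.θ i / 2 = -(S.x i - B.θ i / 2) := by field_simp; ring
    change v (B.θ i - S.x i - B.θ i / 2) < 1
    rw [this, Valuation.map_neg]
    exact hS.x_sub i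
  q_unit i := by
    convert (hS.y_unit hB i).div (hS.ab_unit hB) using 1
    have h1 := hB.θ_ne i
    have h2 := hB.t_ne i
    have h3 := hB.κ_ne
    have h4 := hS.ab_ne hB
    change B.κ * (B.s i * B.y S i / (B.a S * B.b S)) / _ = _
    generalize B.a S * B.b S = A at *
    rw [← hB.t_sq]
    field_simp

end IsTame

/-! ### The lattice of solutions -/

/-- Tame solutions of the Garnier system with the logarithmic derivatives of their `τ`-function. -/
structure IsGood (B : Background N K) (v : Valuation K Γ₀) (t : Fin N → K) (S : State N K) :
    Prop where
  flow : B.IsFlow S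
  pot : B.HasPotential S
  tame : B.IsTame v t S

section Lattice

variable [CharZero K] (hB : B.IsLarge v t)
include hB

theorem IsGood.reflectOne (hS : B.IsGood v t S) : B.IsGood v t (reflectOne S) :=
  ⟨hS.flow.reflectOne (hS.tame.q_ne hB) (hS.tame.Q_ne hB),
    hS.pot.reflectOne (hS.tame.q_ne hB) (hS.tame.Q_ne hB), hS.tame.reflectOne hB⟩

theorem IsGood.reflectZero (hS : B.IsGood v t S) : B.IsGood v t (B.reflectZero S) :=
  ⟨hS.flow.reflectZero (hS.tame.q_ne hB) (hS.tame.Qs_ne hB),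
    hS.pot.reflectZero (hS.tame.q_ne hB) (hS.tame.Qs_ne hB), hS.tame.reflectZero hB⟩

theorem IsGood.pointReflect (hS : B.IsGood v t S) : B.IsGood v t (B.pointReflect S) :=
  ⟨hS.flow.pointReflect (hS.tame.q_ne hB) (hS.tame.ab_ne hB) (hS.tame.y_ne hB),
    hS.pot.pointReflect (hS.tame.q_ne hB) (hS.tame.ab_ne hB) (hS.tame.y_ne hB),
    hS.tame.pointReflect hB⟩

/-- `κ_1 ↦ -κ_1` as a permutation of the tame solutions. -/
def permOne : Equiv.Perm {S // B.IsGood v t S} :=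
  Function.Involutive.toPerm (fun S => ⟨Background.reflectOne S.1, S.2.reflectOne hB⟩)
    fun _ => Subtype.ext reflectOne_reflectOne

/-- `κ_0 ↦ -κ_0` as a permutation of the tame solutions. -/
def permZero : Equiv.Perm {S // B.IsGood v t S} :=
  Function.Involutive.toPerm (fun S => ⟨B.reflectZero S.1, S.2.reflectZero hB⟩)
    fun _ => Subtype.ext reflectZero_reflectZero

/-- `(κ_0, κ_1) ↦ (1 - κ_0, 1 - κ_1)` as a permutation of the tame solutions. -/
def permPoint : Equiv.Perm {S // B.IsGood v t S} :=
  Function.Involutive.toPerm (fun S => ⟨B.pointReflect S.1, S.2.pointReflect hB⟩)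
    fun S => Subtype.ext (pointReflect_pointReflect (S.2.tame.q_ne hB) (S.2.tame.ab_ne hB)
      (S.2.tame.y_ne hB))

theorem permOne_mul_self : permOne hB * permOne hB = 1 :=
  Equiv.ext fun _ => Subtype.ext reflectOne_reflectOne

theorem permZero_mul_self : permZero hB * permZero hB = 1 :=
  Equiv.ext fun _ => Subtype.ext reflectZero_reflectZero

theorem permPoint_mul_self : permPoint hB * permPoint hB = 1 :=
  Equiv.ext fun S => Subtype.ext (pointReflect_pointReflect (S.2.tame.q_ne hB)
    (S.2.tame.ab_ne hB) (S.2.tame.y_ne hB))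

theorem permZero_mul_permOne : permZero hB * permOne hB = permOne hB * permZero hB :=
  Equiv.ext fun _ => Subtype.ext reflectZero_reflectOne

theorem IsGood.reflectTwo_reflectOne (hS : B.IsGood v t S) :
    B.reflectTwo (Background.reflectOne S) = Background.reflectOne (B.reflectTwo S) := by
  have h := hS.tame
  have h' := (hS.reflectOne hB).tame
  refine Background.reflectTwo_reflectOne (h.q_ne hB) (h.ab_ne hB) (h.y_ne hB) (h.YA_ne hB)
    (h.Q_ne hB) ?_ (h'.ab_ne hB) (h'.y_ne hB) (h'.YA_ne hB)
  have h2 := ((hS.pointReflect hB).reflectZero hB).tame.ab_ne hB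
  rw [ab_reflectZero_pointReflect (h.ab_ne hB) (h.YA_ne hB)] at h2
  exact left_ne_zero_of_mul h2

theorem permTwo_mul_permOne :
    permPoint hB * permZero hB * permPoint hB * permOne hB =
      permOne hB * (permPoint hB * permZero hB * permPoint hB) :=
  Equiv.ext fun S => Subtype.ext (S.2.reflectTwo_reflectOne hB)

/-- The translation `(κ_0, κ_1) ↦ (κ_0 + 1, κ_1 + 1)`. -/
def shiftLeft : Equiv.Perm {S // B.IsGood v t S} := permPoint hB * permZero hB * permOne hB

/-- The translation `(κ_0, κ_1) ↦ (κ_0 + 1, κ_1 - 1)`. -/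
def shiftRight : Equiv.Perm {S // B.IsGood v t S} := permOne hB * permPoint hB * permZero hB

theorem shiftLeft_symm : (shiftLeft hB)⁻¹ = permOne hB * permZero hB * permPoint hB := by
  rw [inv_eq_iff_mul_eq_one, shiftLeft]
  simp only [mul_assoc]
  rw [← mul_assoc (permOne hB) (permOne hB), permOne_mul_self, one_mul,
    ← mul_assoc (permZero hB) (permZero hB), permZero_mul_self, one_mul, permPoint_mul_self]

theorem shiftRight_symm : (shiftRight hB)⁻¹ = permZero hB * permPoint hB * permOne hB := by
  rw [inv_eq_iff_mul_eq_one, shiftRight]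
  simp only [mul_assoc]
  rw [← mul_assoc (permZero hB) (permZero hB), permZero_mul_self, one_mul,
    ← mul_assoc (permPoint hB) (permPoint hB), permPoint_mul_self, one_mul, permOne_mul_self]

/-- Both products reduce to the word (`permPoint` `permZero`)². In the second one, `permOne` has to
be moved past the reflections κ_0 ↦ 2 - κ_0 and κ_0 ↦ -κ_0. -/
theorem shift_comm : Commute (shiftLeft hB) (shiftRight hB) := by
  have h1 : shiftLeft hB * shiftRight hB =
      permPoint hB * permZero hB * permPoint hB * permZero hB := by
    rw [shiftLeft, shiftRight]
    simp only [mul_assoc]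
    rw [← mul_assoc (permOne hB) (permOne hB), permOne_mul_self, one_mul]
  have h2 : shiftRight hB * shiftLeft hB =
      permPoint hB * permZero hB * permPoint hB * permZero hB := by
    calc shiftRight hB * shiftLeft hB
        = permOne hB * (permPoint hB * permZero hB * permPoint hB) *
            (permZero hB * permOne hB) := by
          rw [shiftLeft, shiftRight]; simp only [mul_assoc]
      _ = permPoint hB * permZero hB * permPoint hB * permZero hB *
            (permOne hB * permOne hB) := by
          rw [← permTwo_mul_permOne, permZero_mul_permOne]
          simp only [mul_assoc]
          rw [← mul_assoc (permOne hB) (permOne hB), permOne_mul_self, one_mul, mul_one]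
      _ = _ := by rw [permOne_mul_self, mul_one]
  exact h1.trans h2.symm

/-- The two-dimensional lattice of solutions generated from a seed. -/
def lattice (S₀ : {S // B.IsGood v t S}) (m n : ℤ) : {S // B.IsGood v t S} :=
  (shiftLeft hB ^ m * shiftRight hB ^ n) S₀

variable (S₀ : {S // B.IsGood v t S})

theorem lattice_succ_left (m n : ℤ) :
    lattice hB S₀ (m + 1) n = shiftLeft hB (lattice hB S₀ m n) := by
  simp only [lattice, add_comm m, zpow_add, zpow_one, mul_assoc]
  rfl

/-- The commutation of the two translations enters the lattice here. -/
theorem lattice_succ_right (m n : ℤ) :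
    lattice hB S₀ m (n + 1) = shiftRight hB (lattice hB S₀ m n) := by
  have h : shiftLeft hB ^ m * shiftRight hB ^ (n + 1) =
      shiftRight hB * (shiftLeft hB ^ m * shiftRight hB ^ n) := by
    rw [add_comm n, zpow_add, zpow_one, ← mul_assoc, ← mul_assoc,
      ((shift_comm hB).zpow_left m).eq]
  simp only [lattice, h]
  rfl

theorem lattice_pred_left (m n : ℤ) :
    lattice hB S₀ (m - 1) n = (shiftLeft hB)⁻¹ (lattice hB S₀ m n) := by
  rw [Equiv.Perm.eq_inv_iff_eq, ← lattice_succ_left, sub_add_cancel]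

theorem lattice_pred_right (m n : ℤ) :
    lattice hB S₀ m (n - 1) = (shiftRight hB)⁻¹ (lattice hB S₀ m n) := by
  rw [Equiv.Perm.eq_inv_iff_eq, ← lattice_succ_right, sub_add_cancel]

theorem shiftLeft_κ₀ (S : {S // B.IsGood v t S}) : (shiftLeft hB S).1.κ₀ = S.1.κ₀ + 1 := by
  change 1 - -S.1.κ₀ = _; ring

theorem shiftLeft_κ₁ (S : {S // B.IsGood v t S}) : (shiftLeft hB S).1.κ₁ = S.1.κ₁ + 1 := by
  change 1 - -S.1.κ₁ = _; ring

theorem shiftRight_κ₀ (S : {S // B.IsGood v t S}) : (shiftRight hB S).1.κ₀ = S.1.κ₀ + 1 := by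
  change 1 - -S.1.κ₀ = _; ring

theorem shiftRight_κ₁ (S : {S // B.IsGood v t S}) : (shiftRight hB S).1.κ₁ = S.1.κ₁ - 1 := by
  change -(1 - S.1.κ₁) = _; ring

theorem lattice_κ₀ (m n : ℤ) : (lattice hB S₀ m n).1.κ₀ = S₀.1.κ₀ + m + n := by
  rw [eq_add_of_step (f := fun m => (lattice hB S₀ m n).1.κ₀) (c := 1)
      (fun k => by rw [lattice_succ_left, shiftLeft_κ₀]),
    eq_add_of_step (f := fun n => (lattice hB S₀ 0 n).1.κ₀) (c := 1)
      (fun k => by rw [lattice_succ_right, shiftRight_κ₀])]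
  simp only [lattice, zpow_zero, mul_one, Equiv.Perm.coe_one, id]
  ring

theorem lattice_κ₁ (m n : ℤ) : (lattice hB S₀ m n).1.κ₁ = S₀.1.κ₁ + m - n := by
  rw [eq_add_of_step (f := fun m => (lattice hB S₀ m n).1.κ₁) (c := 1)
      (fun k => by rw [lattice_succ_left, shiftLeft_κ₁]),
    eq_add_of_step (f := fun n => (lattice hB S₀ 0 n).1.κ₁) (c := -1)
      (fun k => by rw [lattice_succ_right, shiftRight_κ₁]; ring)]
  simp only [lattice, zpow_zero, mul_one, Equiv.Perm.coe_one, id]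
  ring

theorem shiftLeft_h (S : {S // B.IsGood v t S}) (i : Fin N) :
    (shiftLeft hB S).1.h i =
      S.1.h i - B.w S.1 i / 2 + mu S.1 * S.1.q i + S.1.κ₀ / 2 - 1 / 4 :=
  h_up i

theorem shiftRight_h (S : {S // B.IsGood v t S}) (i : Fin N) :
    (shiftRight hB S).1.h i = S.1.h i - B.w S.1 i / 2 + S.1.κ₀ / 2 - 1 / 4 := by
  have h := h_up (B := B) (S := Background.reflectOne S.1) i
  rw [reflectOne_reflectOne, w_reflectOne, mu_reflectOne] at h
  change (B.pointReflect (B.reflectZero S.1)).h i = _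
  rw [h]
  simp only [Background.reflectOne]
  ring

theorem shiftLeft_h_add (S : {S // B.IsGood v t S}) (i : Fin N) :
    (shiftLeft hB S).1.h i + ((shiftLeft hB)⁻¹ S).1.h i - 2 * S.1.h i =
      1 / 2 + (-B.w S.1 i + mu S.1 * S.1.q i - B.lam S.1 * B.y S.1 i) := by
  rw [shiftLeft_symm]
  exact h_up_add_h_down (S.2.tame.ab_ne hB) i

/-- `shiftRight` is the conjugate of `shiftLeft` by `permOne`, and `permOne` does not change h. -/
theorem shiftRight_h_add (S : {S // B.IsGood v t S}) (i : Fin N) :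
    (shiftRight hB S).1.h i + ((shiftRight hB)⁻¹ S).1.h i - 2 * S.1.h i =
      (shiftLeft hB (permOne hB S)).1.h i + ((shiftLeft hB)⁻¹ (permOne hB S)).1.h i
        - 2 * (permOne hB S).1.h i := by
  rw [shiftRight_symm, shiftLeft_symm]
  congr 2
  change (B.pointReflect (B.reflectZero S.1)).h i = (B.pointReflect (B.reflectZero
    (Background.reflectOne (Background.reflectOne S.1)))).h i
  rw [reflectOne_reflectOne]

end Lattice

end Background

/-! ### Fields of rational functions as differential fields -/

theorem fracDeriv_algebraMap {k R : Type*} [CommRing k] [CommRing R] [IsDomain R] [Algebra k R]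
    (d : Derivation k R R) (a : R) :
    fracDeriv d (algebraMap R (FractionRing R) a) = algebraMap R (FractionRing R) (d a) := by
  have h := fracDerivFun_div d a 1 one_ne_zero
  simp only [map_one, div_one, one_mul, Derivation.map_one_eq_zero, mul_zero, sub_zero,
    one_pow] at h
  exact h

/-- A derivation of a field, multiplied by a scalar and regarded as a derivation over `ℤ`. -/
def scaledDeriv {A K : Type*} [CommRing A] [Field K] [Algebra A K] (c : K) (d : Derivation A K K) :
    Derivation ℤ K K := Derivation.restrictScalars ℤ (c • d)

theorem scaledDeriv_apply {A K : Type*} [CommRing A] [Field K] [Algebra A K] (c : K)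
    (d : Derivation A K K) (f : K) : scaledDeriv c d f = c * d f := rfl

section RatFun

variable {N : ℕ} {A : Type} [CommRing A]

theorem dt_tvar [IsDomain A] (i j : Fin N) : dt j (tvar i : RatFun N A) = if i = j then 1 else 0 := by
  rw [dt, tvar, fracDeriv_algebraMap, pderiv_X, Pi.single_apply]
  split_ifs <;> simp

theorem algebraMap_ratFun_ne_zero (p : MvPolynomial (Fin N) A) (x : Fin N → A)
    (hp : eval x p ≠ 0) : algebraMap (MvPolynomial (Fin N) A) (RatFun N A) p ≠ 0 := by
  rw [Ne, FaithfulSMul.algebraMap_eq_zero_iff]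
  rintro rfl
  exact hp (map_zero _)

variable [IsDomain A]

theorem tvar_ne_zero (i : Fin N) : (tvar i : RatFun N A) ≠ 0 :=
  algebraMap_ratFun_ne_zero _ (fun _ => 1) (by simp)

theorem tvar_sq_ne_one (i : Fin N) : (tvar i : RatFun N A) ^ 2 - 1 ≠ 0 := by
  have h := algebraMap_ratFun_ne_zero (N := N) (A := A) (X i ^ 2 - 1) (fun _ => 0) (by simp)
  simpa [tvar] using h

theorem tvar_sq_ne (i j : Fin N) (hij : i ≠ j) :
    (tvar j : RatFun N A) ^ 2 - tvar i ^ 2 ≠ 0 := by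
  have h := algebraMap_ratFun_ne_zero (N := N) (A := A) (X j ^ 2 - X i ^ 2) (Pi.single j 1)
    (by simp [hij])
  simpa [tvar] using h

variable [CharZero A]

variable (N A) in
/-- The background for the Garnier system on the field of rational functions in `t`. -/
def ratBackground (κ : A) (θ : Fin N → A) : Background N (RatFun N A) where
  s i := tvar i ^ 2
  θ i := algebraMap A (RatFun N A) (θ i)
  κ := algebraMap A (RatFun N A) κ
  γ := ((∑ i, algebraMap A (RatFun N A) (θ i) * tvar i) - algebraMap A (RatFun N A) κ) ^ 2 / 4
  δ j := scaledDeriv (tvar j / 2) (dt j)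
  s_ne_zero i := pow_ne_zero 2 (tvar_ne_zero i)
  s_ne_one := tvar_sq_ne_one
  s_ne := tvar_sq_ne
  δ_s i j := by
    rw [scaledDeriv_apply, Derivation.leibniz_pow, dt_tvar]
    split_ifs with h
    · subst h
      simp only [smul_eq_mul, nsmul_eq_mul, Nat.cast_ofNat, mul_one,
        Nat.add_one_sub_one, pow_one]
      field_simp
    · simp
  δ_θ i j := by rw [scaledDeriv_apply, Derivation.map_algebraMap, mul_zero]
  δ_κ j := by rw [scaledDeriv_apply, Derivation.map_algebraMap, mul_zero]

end RatFun

/-! ### The valuation at infinite `κ` -/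

section Valuation

variable (N : ℕ)

/-- Polynomials in `κ, θ, t` as polynomials in `κ` with coefficients polynomials in `θ, t`. -/
def asPolynomial : MvPolynomial (Fin N) (ParamRing N) ≃+*
    Polynomial (MvPolynomial (Fin N ⊕ Fin N) ℂ) :=
  ((sumAlgEquiv ℂ (Fin N) (Option (Fin N))).symm.toRingEquiv.trans
    (renameEquiv ℂ (⟨Sum.elim (fun i => some (Sum.inl i)) (Option.map Sum.inr),
      fun o => o.elim (Sum.inr none) (Sum.elim Sum.inl fun i => Sum.inr (some i)),
      by rintro (i | _ | i) <;> rfl, by rintro (_ | i | i) <;> rfl⟩ :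
      Fin N ⊕ Option (Fin N) ≃ Option (Fin N ⊕ Fin N))).toRingEquiv).trans
    (optionEquivLeft ℂ (Fin N ⊕ Fin N)).toRingEquiv

theorem asPolynomial_X (i : Fin N) :
    asPolynomial N (X i) = Polynomial.C (X (Sum.inl i)) := by
  simp [asPolynomial]

theorem asPolynomial_C_X_some (i : Fin N) :
    asPolynomial N (C (X (some i))) = Polynomial.C (X (Sum.inr i)) := by
  simp [asPolynomial]

theorem asPolynomial_C_X_none : asPolynomial N (C (X none)) = Polynomial.X := by
  simp [asPolynomial]

/-- The field of coefficients `ℂ(θ, t)`. -/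
abbrev CoeffField : Type := FractionRing (MvPolynomial (Fin N ⊕ Fin N) ℂ)

/-- Here κ becomes the variable over the field ℂ(θ, t), so that the valuation at infinity measures
the degree in κ. -/
def toRatFunc : MvPolynomial (Fin N) (ParamRing N) →+* RatFunc (CoeffField N) :=
  (algebraMap (Polynomial (CoeffField N)) (RatFunc (CoeffField N))).comp
    ((Polynomial.mapRingHom (algebraMap _ (CoeffField N))).comp (asPolynomial N).toRingHom)

theorem toRatFunc_injective : Function.Injective (toRatFunc N) := by
  refine (RatFunc.algebraMap_injective (CoeffField N)).comp
    ((Polynomial.map_injective _ (IsFractionRing.injective _ _)).comp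
      (asPolynomial N).injective)

open Classical in
/-- The valuation of `ℂ(κ, θ, t)` at `κ = ∞`. -/
def inftyVal : Valuation (GenericField N) (WithZero (Multiplicative ℤ)) :=
  (RatFunc.inftyValuation (CoeffField N)).comap
    (IsFractionRing.lift (K := GenericField N) (toRatFunc_injective N))

theorem inftyVal_of_C (p : MvPolynomial (Fin N) (ParamRing N))
    (c : MvPolynomial (Fin N ⊕ Fin N) ℂ) (hc : c ≠ 0) (h : asPolynomial N p = Polynomial.C c) :
    inftyVal N (algebraMap _ (GenericField N) p) = 1 := by
  classical
  rw [inftyVal, Valuation.comap_apply, IsFractionRing.lift_algebraMap, toRatFunc]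
  simp only [RingHom.comp_apply, RingEquiv.toRingHom_eq_coe, RingHom.coe_coe, h,
    Polynomial.coe_mapRingHom, Polynomial.map_C, RatFunc.algebraMap_C]
  exact RatFunc.inftyValuation.C _
    ((map_ne_zero_iff _ (IsFractionRing.injective _ _)).2 hc)

theorem inftyVal_tvar (i : Fin N) : inftyVal N (tvar i) = 1 :=
  inftyVal_of_C N _ _ (X_ne_zero _) (asPolynomial_X N i)

theorem inftyVal_theta (i : Fin N) : inftyVal N (theta N i) = 1 := by
  rw [theta, IsScalarTower.algebraMap_apply _ (MvPolynomial (Fin N) (ParamRing N))]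
  exact inftyVal_of_C N _ _ (X_ne_zero _) (asPolynomial_C_X_some N i)

theorem inftyVal_two : inftyVal N 2 = 1 := by
  have h := inftyVal_of_C N 2 2 two_ne_zero (by rw [map_ofNat, map_ofNat])
  rwa [map_ofNat] at h

theorem one_lt_inftyVal_kinf : 1 < inftyVal N (kinf N) := by
  classical
  rw [kinf, IsScalarTower.algebraMap_apply _ (MvPolynomial (Fin N) (ParamRing N)), inftyVal,
    Valuation.comap_apply, IsFractionRing.lift_algebraMap, toRatFunc]
  simp only [RingHom.comp_apply, RingEquiv.toRingHom_eq_coe, RingHom.coe_coe,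
    algebraMap_eq, asPolynomial_C_X_none, Polynomial.coe_mapRingHom, Polynomial.map_X,
    RatFunc.algebraMap_X]
  rw [RatFunc.inftyValuation.X, ← WithZero.exp_zero, WithZero.exp_lt_exp]
  exact one_pos

end Valuation

namespace Background

variable {N : ℕ} {K Γ₀ : Type*} [Field K] [LinearOrderedCommGroupWithZero Γ₀]
  {B : Background N K} {v : Valuation K Γ₀} {t : Fin N → K}

/-! ### The seed solution -/

/-- The solution `q_i = θ_i t_i / κ`, `q_i p_i = θ_i / 2`, for `κ_0 = κ_1 = 1 / 2`. -/
def seed (B : Background N K) (t : Fin N → K) : State N K where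
  κ₀ := 1 / 2
  κ₁ := 1 / 2
  q i := B.θ i * t i / B.κ
  x i := B.θ i / 2
  h _ := 0

section Seed

theorem Q_seed : Q (B.seed t) = (∑ i, B.θ i * t i) / B.κ := by
  simp only [Q, seed, Finset.sum_div]

theorem d_div_κ (hB : B.IsLarge v t) (j : Fin N) (f : K) : B.δ j (f / B.κ) = B.δ j f / B.κ := by
  have h := d_div (B := B) j f B.κ hB.κ_ne
  rw [B.δ_κ, mul_zero, sub_zero] at h
  rw [← h, mul_div_cancel_left₀ _ hB.κ_ne]

theorem isTame_seed (hB : B.IsLarge v t) : B.IsTame v t (B.seed t) where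
  v_κ₀ := by simp [seed, hB.v_two]
  v_κ₁ := by simp [seed, hB.v_two]
  x_sub i := by simp [seed]
  q_unit i := by
    have h1 := hB.θ_ne i
    have h2 := hB.t_ne i
    have h3 := hB.κ_ne
    have : B.κ * (B.seed t).q i / (B.θ i * t i) = 1 := by
      simp only [seed]; field_simp
    rw [this]
    simp [IsOneUnit]

variable [CharZero K]

theorem w_seed (i : Fin N) : B.w (B.seed t) i = 0 := by
  simp only [w, seed]; field_simp; ring

theorem a_seed : B.a (B.seed t) = -B.κ / 2 := by
  simp only [a, X, seed, ← Finset.sum_div]; field_simp; ring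

theorem b_seed : B.b (B.seed t) = B.κ / 2 := by
  rw [b, a_seed]; field_simp; ring

theorem g_seed (j : Fin N) : B.g (B.seed t) j = 0 := by
  rw [g, w_seed, a_seed, b_seed]; ring

variable (hB : B.IsLarge v t)
include hB

theorem d_t (i j : Fin N) : B.δ j (t i) = if i = j then t i / 2 else 0 := by
  have h := B.δ_s i j
  have ht := hB.t_ne i
  rw [← hB.t_sq, Derivation.leibniz_pow] at h
  simp only [smul_eq_mul, nsmul_eq_mul, Nat.cast_ofNat, Nat.add_one_sub_one, pow_one] at h
  split_ifs at h ⊢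
  · field_simp
    apply mul_left_cancel₀ ht
    linear_combination h
  · simpa [ht] using h

theorem y_seed (i : Fin N) : B.y (B.seed t) i = -(B.θ i * B.κ) / (4 * t i) := by
  have h1 := hB.θ_ne i
  have h2 := hB.t_ne i
  have h3 := hB.κ_ne
  simp only [y, seed]
  field_simp
  ring

theorem s_mul_y_seed (i : Fin N) : B.s i * B.y (B.seed t) i = -(B.κ * (B.θ i * t i)) / 4 := by
  have h2 := hB.t_ne i
  rw [y_seed hB, ← hB.t_sq]
  field_simp

theorem d_θ_mul_t (i j : Fin N) :
    B.δ j (B.θ i * t i) = if i = j then B.θ i * t i / 2 else 0 := by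
  rw [Derivation.leibniz, d_t hB, B.δ_θ]
  split_ifs <;> simp [mul_div_assoc]

/-- At the seed w_i = 0 and a + b = 0, hence g_j = 0; moreover s_i y_i = ab q_i. All right-hand
sides therefore vanish except that of `dQ`, which is q_j / 2, in agreement with δ_j t_j = t_j / 2.
-/
theorem isFlow_seed : B.IsFlow (B.seed t) where
  dκ₀ j := by
    change B.δ j (1 / 2) = 0
    simp [Derivation.leibniz_inv, d_two]
  dκ₁ j := by
    change B.δ j (1 / 2) = 0
    simp [Derivation.leibniz_inv, d_two]
  dx i j := by
    have : B.δ j ((B.seed t).x i) = 0 := by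
      simp [seed, Derivation.leibniz_div, d_two, B.δ_θ]
    have h3 := hB.κ_ne
    rw [this, s_mul_y_seed hB, s_mul_y_seed hB]
    simp only [seed]
    ring
  dX j := by
    have : B.δ j (X (B.seed t)) = 0 := by
      simp [X, seed, Derivation.leibniz_div, d_two, B.δ_θ]
    have h3 := hB.κ_ne
    rw [this, s_mul_y_seed hB, a_seed, b_seed]
    simp only [seed]
    field_simp
    ring
  dq i j := by
    rw [g_seed, w_seed, w_seed]
    simp only [seed, d_div_κ hB, d_θ_mul_t hB]
    split_ifs with h
    · subst h; ring
    · ring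
  dQ j := by
    have h3 := hB.κ_ne
    rw [g_seed, Q_seed, d_div_κ hB, map_sum, Finset.sum_congr rfl fun i _ => d_θ_mul_t hB i j]
    simp only [seed, Finset.sum_ite_eq', Finset.mem_univ, if_true]
    field_simp
    ring

theorem Z_seed : B.Z (B.seed t) = -(B.κ * ∑ i, B.θ i * t i) / 4 := by
  simp only [Z, s_mul_y_seed hB, ← Finset.sum_div, Finset.sum_neg_distrib, Finset.mul_sum]

/-- The seed has τ-function 1, so its potential must be 0; this dictates the value of γ. -/
theorem hasPotential_seed (hγ : B.γ = ((∑ i, B.θ i * t i) - B.κ) ^ 2 / 4) :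
    B.HasPotential (B.seed t) := by
  have h3 := hB.κ_ne
  unfold HasPotential potential
  rw [Z_seed hB, Q_seed, a_seed, b_seed, hγ]
  simp only [w_seed]
  simp only [seed, mul_zero, Finset.sum_const_zero]
  field_simp
  ring

theorem isGood_seed (hγ : B.γ = ((∑ i, B.θ i * t i) - B.κ) ^ 2 / 4) : B.IsGood v t (B.seed t) :=
  ⟨isFlow_seed hB, hasPotential_seed hB hγ, isTame_seed hB⟩

/-- Up to sign, this is the part of Φ_c that depends on κ_∞ and θ explicitly; compare `const_eq`. -/
theorem todaOp_gauge (hγ : B.γ = ((∑ i, B.θ i * t i) - B.κ) ^ 2 / 4) :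
    4 * (B.γ - B.todaOp B.γ) =
      ((∑ i, B.θ i * t i) - B.κ) * ((∑ i, B.θ i * (t i)⁻¹) - B.κ) := by
  have h1 : ∀ j, B.δ j B.γ = ((∑ i, B.θ i * t i) - B.κ) * (B.θ j * t j) / 4 := by
    intro j
    have h4 : 4 * B.γ = ((∑ i, B.θ i * t i) - B.κ) ^ 2 := by rw [hγ]; field_simp
    have h := congrArg (B.δ j) h4
    rw [Derivation.leibniz, Derivation.leibniz_pow, map_sub, B.δ_κ, map_sum,
      Finset.sum_congr rfl fun i _ => d_θ_mul_t hB i j,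
      show (4 : K) = 2 * 2 by norm_num, Derivation.leibniz, d_two] at h
    simp only [smul_eq_mul, nsmul_eq_mul, Nat.cast_ofNat, Nat.add_one_sub_one, pow_one,
      Finset.sum_ite_eq', Finset.mem_univ, if_true] at h
    field_simp
    linear_combination h
  have h2 : B.todaOp B.γ = ((∑ i, B.θ i * t i) - B.κ) / 4 *
      ((∑ i, B.θ i * t i) - ∑ i, B.θ i * (t i)⁻¹) := by
    simp only [todaOp, h1]
    rw [← Finset.sum_sub_distrib, Finset.mul_sum]
    refine Finset.sum_congr rfl fun j _ => ?_
    have := hB.t_ne j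
    rw [← hB.t_sq]
    field_simp
  rw [h2, hγ]
  field_simp
  ring

end Seed

/-! ### Logarithmic derivatives -/

/-- The nonzero element `f` has logarithmic derivatives `h_j`. -/
def HasLogDeriv (B : Background N K) (f : K) (h : Fin N → K) : Prop :=
  f ≠ 0 ∧ ∀ j, B.δ j f = h j * f

namespace HasLogDeriv

variable {f f' : K} {h h' : Fin N → K}

theorem mul (hf : B.HasLogDeriv f h) (hf' : B.HasLogDeriv f' h') :
    B.HasLogDeriv (f * f') (h + h') := by
  refine ⟨mul_ne_zero hf.1 hf'.1, fun j => ?_⟩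
  rw [Derivation.leibniz, hf.2, hf'.2, Pi.add_apply, smul_eq_mul, smul_eq_mul]
  ring

theorem inv (hf : B.HasLogDeriv f h) : B.HasLogDeriv f⁻¹ (-h) := by
  refine ⟨inv_ne_zero hf.1, fun j => ?_⟩
  have h0 := hf.1
  rw [Derivation.leibniz_inv, hf.2, Pi.neg_apply, smul_eq_mul]
  field_simp

theorem div (hf : B.HasLogDeriv f h) (hf' : B.HasLogDeriv f' h') :
    B.HasLogDeriv (f / f') (h - h') := by
  rw [div_eq_mul_inv, sub_eq_add_neg]
  exact hf.mul hf'.inv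

theorem congr (hf : B.HasLogDeriv f h) (hh : ∀ j, h j = h' j) : B.HasLogDeriv f h' :=
  funext hh ▸ hf

theorem four [CharZero K] : B.HasLogDeriv (4 : K) 0 := by
  refine ⟨by norm_num, fun j => ?_⟩
  rw [show (4 : K) = 2 * 2 by norm_num, Derivation.leibniz, d_two]
  simp

theorem one : B.HasLogDeriv (1 : K) 0 := ⟨one_ne_zero, fun j => by simp⟩

theorem prod_t [CharZero K] (hB : B.IsLarge v t) :
    B.HasLogDeriv (∏ i, t i) fun _ => 1 / 2 := by
  have h : ∀ s : Finset (Fin N), B.HasLogDeriv (∏ i ∈ s, t i)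
      (fun j => if j ∈ s then 1 / 2 else 0) := by
    intro s
    induction s using Finset.induction_on with
    | empty =>
      simp only [Finset.prod_empty, Finset.notMem_empty, if_false]
      exact one
    | insert a s ha ih =>
      rw [Finset.prod_insert ha]
      have h1 : B.HasLogDeriv (t a) (fun j => if j = a then 1 / 2 else 0) := by
        refine ⟨hB.t_ne a, fun j => ?_⟩
        rw [d_t hB]
        by_cases hj : j = a
        · simp [hj]; ring
        · simp [hj, Ne.symm hj]
      refine (h1.mul ih).congr fun j => ?_
      by_cases hj : j = a
      · simp [hj, ha]
      · simp [hj]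
  simpa using h Finset.univ

end HasLogDeriv

section Lattice

variable [CharZero K] (hB : B.IsLarge v t)
include hB

/-- One step of the Toda recurrence in the direction `shiftLeft`. -/
theorem HasLogDeriv.toda_left {S : {S // B.IsGood v t S}} {f g : K} {hg h' : Fin N → K}
    (hf : B.HasLogDeriv f S.1.h) (hg' : B.HasLogDeriv g hg)
    (hh : ∀ j, h' j + hg j - 2 * S.1.h j =
      (shiftLeft hB S).1.h j + ((shiftLeft hB)⁻¹ S).1.h j - 2 * S.1.h j) :
    B.HasLogDeriv ((∏ i, t i) * (4 * B.todaValue S.1) * (f ^ 2 / g)) h' := by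
  have h1 : B.HasLogDeriv (B.todaValue S.1)
      (fun i => -B.w S.1 i + mu S.1 * S.1.q i - B.lam S.1 * B.y S.1 i) := by
    refine ⟨S.2.tame.todaValue_ne hB, fun j => ?_⟩
    rw [S.2.flow.d_todaValue (S.2.tame.q_ne hB) (S.2.tame.Q_ne hB) (S.2.tame.YA_ne hB), mul_comm]
  rw [sq]
  refine (((HasLogDeriv.prod_t hB).mul (HasLogDeriv.four.mul h1)).mul
    ((hf.mul hf).div hg')).congr fun j => ?_
  have h2 := hh j
  rw [shiftLeft_h_add] at h2
  simp only [Pi.add_apply, Pi.sub_apply, Pi.zero_apply]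
  linear_combination -h2

/-- One step of the Toda recurrence in the direction `shiftRight`. -/
theorem HasLogDeriv.toda_right {S : {S // B.IsGood v t S}} {f g : K} {hg h' : Fin N → K}
    (hf : B.HasLogDeriv f S.1.h) (hg' : B.HasLogDeriv g hg)
    (hh : ∀ j, h' j + hg j - 2 * S.1.h j =
      (shiftRight hB S).1.h j + ((shiftRight hB)⁻¹ S).1.h j - 2 * S.1.h j) :
    B.HasLogDeriv ((∏ i, t i) * (4 * (B.todaValue S.1 + S.1.κ₁ * (1 - S.1.κ₀))) * (f ^ 2 / g))
      h' := by
  have h1 := todaValue_reflectOne (B := B) (S.2.tame.q_ne hB) (S.2.tame.Q_ne hB)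
  rw [← h1]
  refine HasLogDeriv.toda_left hB (S := permOne hB S) hf hg' fun j => ?_
  rw [← shiftRight_h_add]
  exact hh j

end Lattice

end Background

/-! ### The special polynomials as τ-functions for indeterminate parameters. -/

section Generic

open Background

variable (N : ℕ)

/-- The background for indeterminate parameters. -/
abbrev genericBackground : Background N (GenericField N) :=
  ratBackground N (ParamRing N) (X none) fun i => X (some i)

theorem genericBackground_isLarge :
    (genericBackground N).IsLarge (inftyVal N) tvar where
  t_sq _ := rfl
  v_two := inftyVal_two N
  v_κ := one_lt_inftyVal_kinf N
  v_θ := inftyVal_theta N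
  v_t := inftyVal_tvar N

/-- The algebraic solutions for indeterminate parameters. -/
def genericState (m n : ℤ) : {S // (genericBackground N).IsGood (inftyVal N) tvar S} :=
  lattice (genericBackground_isLarge N) ⟨_, isGood_seed (genericBackground_isLarge N) rfl⟩ m n

theorem genericState_κ₀ (m n : ℤ) : (genericState N m n).1.κ₀ = 1 / 2 + m + n :=
  lattice_κ₀ _ _ m n

theorem genericState_κ₁ (m n : ℤ) : (genericState N m n).1.κ₁ = 1 / 2 + m - n :=
  lattice_κ₁ _ _ m n

variable {N}

theorem _root_.Garnier.Background.HasLogDeriv.dt_div {A : Type} [CommRing A] [IsDomain A]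
    [CharZero A] {κ : A} {θ : Fin N → A} {f : RatFun N A} {h : Fin N → RatFun N A}
    (hf : (ratBackground N A κ θ).HasLogDeriv f h) (i : Fin N) :
    tvar i * (dt i f / f) = 2 * h i := by
  have h1 : tvar i / 2 * dt i f = h i * f := hf.2 i
  have h2 := hf.1
  field_simp at h1 ⊢
  exact h1

theorem todaInner_eq {f : GenericField N} {h : Fin N → GenericField N}
    (hf : (genericBackground N).HasLogDeriv f h) :
    todaInner N f = 2 * ∑ i, ((genericBackground N).s i - 1) * h i := by
  rw [todaInner, Finset.mul_sum]
  refine Finset.sum_congr rfl fun i _ => ?_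
  have h1 := hf.dt_div i
  change _ = 2 * ((tvar i ^ 2 - 1) * h i)
  linear_combination (tvar i ^ 2 - 1) * h1

theorem sum_dt_eq_todaOp (f : GenericField N) :
    ∑ i, (tvar i ^ 2 - 1) / tvar i * dt i (2 * f) = 4 * (genericBackground N).todaOp f := by
  rw [todaOp, Finset.mul_sum]
  refine Finset.sum_congr rfl fun i _ => ?_
  have h1 : (genericBackground N).δ i f = tvar i / 2 * dt i f := rfl
  have h2 : dt i (2 * f) = 2 * dt i f := by
    rw [two_mul, map_add, two_mul]
  have h3 := tvar_ne_zero (A := ParamRing N) i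
  rw [h1, h2]
  change _ = 4 * ((tvar i ^ 2 - 1) / tvar i ^ 2 * _)
  field_simp
  ring

theorem const_eq :
    kinf N * ∑ i, theta N i * ((tvar i ^ 2 + 1) / tvar i)
      - 1 / 2 * ∑ i, ∑ j, theta N i * theta N j *
          ((tvar i ^ 2 + tvar j ^ 2) / (tvar i * tvar j)) - kinf N ^ 2 =
    -(((∑ i, theta N i * tvar i) - kinf N) * ((∑ i, theta N i * (tvar i)⁻¹) - kinf N)) := by
  have h1 : ∑ i, theta N i * ((tvar i ^ 2 + 1) / tvar i) =
      (∑ i, theta N i * tvar i) + ∑ i, theta N i * (tvar i)⁻¹ := by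
    rw [← Finset.sum_add_distrib]
    refine Finset.sum_congr rfl fun i _ => ?_
    have h3 := tvar_ne_zero (A := ParamRing N) i
    field_simp
  have h2 : ∑ i, ∑ j, theta N i * theta N j * ((tvar i ^ 2 + tvar j ^ 2) / (tvar i * tvar j)) =
      (∑ i, theta N i * tvar i) * (∑ i, theta N i * (tvar i)⁻¹)
      + (∑ i, theta N i * (tvar i)⁻¹) * (∑ i, theta N i * tvar i) := by
    simp only [Finset.sum_mul_sum, ← Finset.sum_add_distrib]
    refine Finset.sum_congr rfl fun i _ => Finset.sum_congr rfl fun j _ => ?_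
    have h3 := tvar_ne_zero (A := ParamRing N) i
    have h4 := tvar_ne_zero (A := ParamRing N) j
    field_simp
  rw [h1, h2]
  field_simp
  ring

/-- `HasPotential` makes the inner operator algebraic in q and x, and `todaOp_potential` does the
same for the outer one. The derivatives of γ cancel the explicit terms in κ_∞ and θ. -/
theorem todaStep_eq {S : State N (GenericField N)}
    (hS : (genericBackground N).IsGood (inftyVal N) tvar S) (c : ℤ) {f : GenericField N}
    (g : GenericField N) (hf : (genericBackground N).HasLogDeriv f S.h) :
    todaStep N c f g = (∏ i, tvar i) *
      (4 * (genericBackground N).todaValue S - (S.κ₀ + S.κ₁ - 1) ^ 2 + (c : GenericField N) ^ 2) *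
        (f ^ 2 / g) := by
  have hB := genericBackground_isLarge N
  have h1 := todaInner_eq hf
  rw [hS.pot] at h1
  have h2 := hS.flow.todaOp_potential (hS.tame.q_ne hB)
  have h3 := todaOp_gauge hB rfl
  have h4 := const_eq (N := N)
  change 4 * ((genericBackground N).γ - (genericBackground N).todaOp (genericBackground N).γ) =
    ((∑ i, theta N i * tvar i) - kinf N) * ((∑ i, theta N i * (tvar i)⁻¹) - kinf N) at h3
  rw [todaStep, h1, sum_dt_eq_todaOp, todaValue]
  congr 2
  linear_combination 4 * h2 + h4 + h3

theorem todaSeq_induction (c : ℤ → ℤ) (a b : GenericField N) (P : ℤ → GenericField N → Prop)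
    (h0 : P 0 a) (h1 : P 1 b)
    (up : ∀ k f g, P k f → P (k - 1) g → P (k + 1) (todaStep N (c k) f g))
    (down : ∀ k f g, P k f → P (k + 1) g → P (k - 1) (todaStep N (c k) f g)) (k : ℤ) :
    P k (todaSeq N c a b k) := by
  have hu : ∀ k : ℕ, P k (todaUp N c a b k).1 ∧ P (k + 1) (todaUp N c a b k).2 := by
    intro k
    induction k with
    | zero => exact ⟨h0, h1⟩
    | succ k ih =>
      refine ⟨by exact_mod_cast ih.2, ?_⟩
      have := up (k + 1) _ _ ih.2 (by rw [add_sub_cancel_right]; exact ih.1)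
      simpa [todaUp] using this
  have hd : ∀ k : ℕ, P (-k) (todaDown N c a b k).1 ∧ P (-k + 1) (todaDown N c a b k).2 := by
    intro k
    induction k with
    | zero => exact ⟨h0, h1⟩
    | succ k ih =>
      have := down (-k) _ _ ih.1 ih.2
      have e : -((k + 1 : ℕ) : ℤ) = -k - 1 := by push_cast; ring
      rw [e, sub_add_cancel]
      exact ⟨this, ih.1⟩
  cases k with
  | ofNat k => exact (hu k).1
  | negSucc k => exact (hd (k + 1)).1

/-- Only the sum h' + hg is prescribed, so the same statement serves the recurrence upwards and
downwards. -/
theorem hasLogDeriv_step_left (m n : ℤ) {f g : GenericField N} {hg h' : Fin N → GenericField N}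
    (hf : (genericBackground N).HasLogDeriv f (genericState N m n).1.h)
    (hg' : (genericBackground N).HasLogDeriv g hg)
    (hh : ∀ j, h' j + hg j =
      (genericState N (m + 1) n).1.h j + (genericState N (m - 1) n).1.h j) :
    (genericBackground N).HasLogDeriv (todaStep N (2 * m) f g) h' := by
  have h1 := HasLogDeriv.toda_left (genericBackground_isLarge N) (h' := h') hf hg' fun j => by
    rw [hh, genericState, genericState, lattice_succ_left, lattice_pred_left]
    rfl
  rw [todaStep_eq (genericState N m n).2 _ _ hf, genericState_κ₀, genericState_κ₁]
  -- Here κ_0 + κ_1 - 1 = 2m is the integer c of this recurrence, and the two squares cancel.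
  convert h1 using 3
  push_cast
  field_simp
  ring

theorem hasLogDeriv_step_right (m n : ℤ) {f g : GenericField N} {hg h' : Fin N → GenericField N}
    (hf : (genericBackground N).HasLogDeriv f (genericState N m n).1.h)
    (hg' : (genericBackground N).HasLogDeriv g hg)
    (hh : ∀ j, h' j + hg j =
      (genericState N m (n + 1)).1.h j + (genericState N m (n - 1)).1.h j) :
    (genericBackground N).HasLogDeriv (todaStep N (2 * n - 1) f g) h' := by
  have h1 := HasLogDeriv.toda_right (genericBackground_isLarge N) (h' := h') hf hg' fun j => by
    rw [hh, genericState, genericState, lattice_succ_right, lattice_pred_right]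
    rfl
  rw [genericState_κ₀, genericState_κ₁] at h1
  rw [todaStep_eq (genericState N m n).2 _ _ hf, genericState_κ₀, genericState_κ₁]
  -- Now c = 2n - 1, and (2n - 1)² - (2m)² = 4 κ_1 (1 - κ_0), the correction from
  -- `todaValue_reflectOne`.
  convert h1 using 3
  push_cast
  field_simp
  ring

theorem genericState_zero_zero : (genericState N 0 0).1 = (genericBackground N).seed tvar := by
  simp [genericState, lattice]

theorem genericState_zero_one_h (i : Fin N) : (genericState N 0 1).1.h i = 0 := by
  have h := shiftRight_h (genericBackground_isLarge N) (genericState N 0 0) i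
  rw [genericState, ← zero_add 1, lattice_succ_right]
  refine h.trans ?_
  rw [genericState_zero_zero, w_seed]
  simp only [seed]
  field_simp
  ring

theorem genericState_one_zero_h (i : Fin N) : (genericState N 1 0).1.h i =
    theta N i * tvar i / 2 / ((∑ i, theta N i * tvar i) - kinf N) := by
  have h := shiftLeft_h (genericBackground_isLarge N) (genericState N 0 0) i
  rw [genericState, ← zero_add 1, lattice_succ_left]
  refine h.trans ?_
  have hk := (genericBackground_isLarge N).κ_ne
  have hQ := (genericState N 0 0).2.tame.Q_ne (genericBackground_isLarge N)
  rw [genericState_zero_zero] at hQ ⊢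
  rw [mu, w_seed]
  rw [Q_seed] at hQ ⊢
  change kinf N ≠ 0 at hk
  change (∑ i, theta N i * tvar i) / kinf N - 1 ≠ 0 at hQ
  have e : (∑ i, theta N i * tvar i) / kinf N - 1 =
    ((∑ i, theta N i * tvar i) - kinf N) / kinf N := by field_simp
  have hQ' : (∑ i, theta N i * tvar i) - kinf N ≠ 0 := by
    rw [e] at hQ; exact (div_ne_zero_iff.1 hQ).1
  change 0 - 0 / 2 + 1 / 2 / ((∑ i, theta N i * tvar i) / kinf N - 1) *
    (theta N i * tvar i / kinf N) + 1 / 2 / 2 - 1 / 4 = _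
  rw [e]
  field_simp
  ring

theorem Qs_seed_eq : (genericBackground N).Qs ((genericBackground N).seed tvar) =
    (∑ i, theta N i * (tvar i)⁻¹) / kinf N := by
  rw [Qs, Finset.sum_div]
  refine Finset.sum_congr rfl fun i _ => ?_
  have h3 := tvar_ne_zero (A := ParamRing N) i
  change theta N i * tvar i / kinf N / tvar i ^ 2 = _
  field_simp

/-- In the composite of the two translations the factors `reflectOne` cancel, leaving κ_0 ↦ 2 - κ_0
after κ_0 ↦ -κ_0. The former fixes h, so h can be read off from the reflected seed. -/
theorem genericState_one_one_h (i : Fin N) : (genericState N 1 1).1.h i =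
    1 / 2 + theta N i * (tvar i)⁻¹ / 2 / (kinf N - ∑ i, theta N i * (tvar i)⁻¹) := by
  have hB := genericBackground_isLarge N
  have h0 : (genericState N 1 1).1 =
      (genericBackground N).reflectTwo
        ((genericBackground N).reflectZero ((genericBackground N).seed tvar)) := by
    have e : genericState N 1 1 =
        shiftLeft hB (shiftRight hB (genericState N 0 0)) := by
      simp only [genericState, ← lattice_succ_left, ← lattice_succ_right, zero_add]
    rw [e, ← genericState_zero_zero]
    change (genericBackground N).pointReflect ((genericBackground N).reflectZero
      (reflectOne (reflectOne _))) = _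
    rw [reflectOne_reflectOne]
    rfl
  have hS := isGood_seed hB rfl
  have hQ := hS.tame.Qs_ne hB
  have hk := hB.κ_ne
  change kinf N ≠ 0 at hk
  rw [h0, reflectTwo_h ((hS.reflectZero hB).tame.ab_ne hB)]
  have e1 := Qs_seed_eq (N := N)
  have e : (∑ i, theta N i * (tvar i)⁻¹) / kinf N - 1 =
    ((∑ i, theta N i * (tvar i)⁻¹) - kinf N) / kinf N := by field_simp
  rw [e1, e] at hQ
  have hQ' := (div_ne_zero_iff.1 hQ).1
  have hQ'' : kinf N - ∑ i, theta N i * (tvar i)⁻¹ ≠ 0 := by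
    rw [← neg_sub]; exact neg_ne_zero.2 hQ'
  change 0 + 1 / 2 - 1 / 2 / ((genericBackground N).Qs ((genericBackground N).seed tvar) - 1) *
    (theta N i * tvar i / kinf N / tvar i ^ 2) = _
  have h3 := tvar_ne_zero (A := ParamRing N) i
  rw [e1, e, ← neg_sub (∑ i, theta N i * (tvar i)⁻¹)]
  generalize (∑ i, theta N i * (tvar i)⁻¹) - kinf N = u at *
  field_simp
  ring

theorem δ_kinf (j : Fin N) : (genericBackground N).δ j (kinf N) = 0 :=
  (genericBackground N).δ_κ j

theorem hasLogDeriv_one_zero : (genericBackground N).HasLogDeriv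
    ((∑ i, theta N i * tvar i) - kinf N) (genericState N 1 0).1.h := by
  have hB := genericBackground_isLarge N
  have hQ := (genericState N 0 0).2.tame.Q_ne hB
  have hk := hB.κ_ne
  rw [genericState_zero_zero, Q_seed] at hQ
  change (∑ i, theta N i * tvar i) / kinf N - 1 ≠ 0 at hQ
  change kinf N ≠ 0 at hk
  have hQ' : (∑ i, theta N i * tvar i) - kinf N ≠ 0 := by
    intro h0
    apply hQ
    rw [div_sub_one hk, h0, zero_div]
  refine ⟨hQ', fun j => ?_⟩
  rw [genericState_one_zero_h]
  have h1 : ∀ i, (genericBackground N).δ j (theta N i * tvar i) =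
      if i = j then theta N i * tvar i / 2 else 0 := fun i => d_θ_mul_t hB i j
  rw [map_sub, map_sum, Finset.sum_congr rfl fun i _ => h1 i, δ_kinf]
  simp only [Finset.sum_ite_eq', Finset.mem_univ, if_true]
  field_simp
  ring

theorem hasLogDeriv_one_one : (genericBackground N).HasLogDeriv
    ((∏ i, tvar i) * (kinf N - ∑ j, theta N j * (tvar j)⁻¹)) (genericState N 1 1).1.h := by
  have hB := genericBackground_isLarge N
  have hQ := (genericState N 0 0).2.tame.Qs_ne hB
  have hk := hB.κ_ne
  have e1 := Qs_seed_eq (N := N)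
  rw [genericState_zero_zero, e1] at hQ
  change kinf N ≠ 0 at hk
  have hQ' : kinf N - ∑ j, theta N j * (tvar j)⁻¹ ≠ 0 := by
    intro h0
    apply hQ
    rw [div_sub_one hk, ← neg_sub, h0, neg_zero, zero_div]
  have h1 : (genericBackground N).HasLogDeriv (kinf N - ∑ j, theta N j * (tvar j)⁻¹)
      (fun i => theta N i * (tvar i)⁻¹ / 2 / (kinf N - ∑ i, theta N i * (tvar i)⁻¹)) := by
    refine ⟨hQ', fun j => ?_⟩
    have h1 : ∀ i, (genericBackground N).δ j (theta N i * (tvar i)⁻¹) =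
        if i = j then -(theta N i * (tvar i)⁻¹ / 2) else 0 := by
      intro i
      have ht := tvar_ne_zero (A := ParamRing N) i
      change tvar j / 2 * dt j (theta N i * (tvar i)⁻¹) = _
      rw [Derivation.leibniz, Derivation.leibniz_inv, theta, Derivation.map_algebraMap, dt_tvar]
      simp only [smul_eq_mul]
      split_ifs with h
      · subst h
        field_simp
        ring
      · ring
    rw [map_sub, map_sum, Finset.sum_congr rfl fun i _ => h1 i, δ_kinf]
    simp only [Finset.sum_ite_eq', Finset.mem_univ, if_true]
    rw [div_mul_cancel₀ _ hQ']
    ring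
  refine ((HasLogDeriv.prod_t hB).mul h1).congr fun j => ?_
  rw [genericState_one_one_h]
  rfl

theorem hasLogDeriv_rowZero (n : ℤ) : (genericBackground N).HasLogDeriv
    (specialRowZero N n) (genericState N 0 n).1.h := by
  refine todaSeq_induction (fun n => 2 * n - 1) 1 1
    (fun n f => (genericBackground N).HasLogDeriv f (genericState N 0 n).1.h) ?_ ?_ ?_ ?_ n
  · rw [genericState_zero_zero]
    exact HasLogDeriv.one
  · exact HasLogDeriv.one.congr fun j => (genericState_zero_one_h j).symm
  · exact fun k f g hf hg => hasLogDeriv_step_right 0 k hf hg fun j => rfl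
  · exact fun k f g hf hg => hasLogDeriv_step_right 0 k hf hg fun j => add_comm _ _

theorem hasLogDeriv_rowOne (n : ℤ) : (genericBackground N).HasLogDeriv
    (specialRowOne N n) (genericState N 1 n).1.h := by
  refine todaSeq_induction (fun n => 2 * n - 1) _ _
    (fun n f => (genericBackground N).HasLogDeriv f (genericState N 1 n).1.h)
    hasLogDeriv_one_zero hasLogDeriv_one_one ?_ ?_ n
  · exact fun k f g hf hg => hasLogDeriv_step_right 1 k hf hg fun j => rfl
  · exact fun k f g hf hg => hasLogDeriv_step_right 1 k hf hg fun j => add_comm _ _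

/-- The special polynomials are the `τ`-functions of the lattice of solutions. -/
theorem hasLogDeriv_specialGeneric (m n : ℤ) : (genericBackground N).HasLogDeriv
    (specialGeneric N m n) (genericState N m n).1.h := by
  refine todaSeq_induction (fun m => 2 * m) _ _
    (fun m f => (genericBackground N).HasLogDeriv f (genericState N m n).1.h)
    (hasLogDeriv_rowZero n) (hasLogDeriv_rowOne n) ?_ ?_ m
  · exact fun k f g hf hg => hasLogDeriv_step_left k n hf hg fun j => rfl
  · exact fun k f g hf hg => hasLogDeriv_step_left k n hf hg fun j => add_comm _ _

theorem specialGeneric_ne_zero (m n : ℤ) : specialGeneric N m n ≠ 0 :=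
  (hasLogDeriv_specialGeneric m n).1

theorem half_add_ne_zero (k : ℤ) : (1 / 2 + k : GenericField N) ≠ 0 := by
  intro h
  have h2 : ((1 + 2 * k : ℤ) : GenericField N) = 0 := by
    push_cast
    linear_combination 2 * h
  rw [Int.cast_eq_zero] at h2
  omega

theorem genericState_succ_left_h (m n : ℤ) (i : Fin N) :
    (genericState N (m + 1) n).1.h i = (genericState N m n).1.h i
      - (genericBackground N).w (genericState N m n).1 i / 2
      + mu (genericState N m n).1 * (genericState N m n).1.q i
      + (genericState N m n).1.κ₀ / 2 - 1 / 4 := by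
  rw [genericState, lattice_succ_left]
  exact shiftLeft_h _ _ i

theorem genericState_succ_right_h (m n : ℤ) (i : Fin N) :
    (genericState N m (n + 1)).1.h i = (genericState N m n).1.h i
      - (genericBackground N).w (genericState N m n).1 i / 2
      + (genericState N m n).1.κ₀ / 2 - 1 / 4 := by
  rw [genericState, lattice_succ_right]
  exact shiftRight_h _ _ i

/-- The changes of h under the two translations differ only by μ q_i. The factor 2 is due to t_i
∂/∂t_i = 2 δ_i. -/
theorem eulerLog_left_div_right (m n : ℤ) (i : Fin N) :
    eulerLog i (specialGeneric N (m + 1) n / specialGeneric N m (n + 1)) =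
      2 * mu (genericState N m n).1 * (genericState N m n).1.q i := by
  have h := ((hasLogDeriv_specialGeneric (m + 1) n).div
    (hasLogDeriv_specialGeneric (N := N) m (n + 1))).dt_div i
  rw [eulerLog, h, Pi.sub_apply, genericState_succ_left_h, genericState_succ_right_h]
  ring

theorem eulerLog_div_right (m n : ℤ) (i : Fin N) :
    eulerLog i (specialGeneric N m n / specialGeneric N m (n + 1)) =
      2 * (genericState N m n).1.x i - theta N i - m - n := by
  have h := ((hasLogDeriv_specialGeneric m n).div
    (hasLogDeriv_specialGeneric (N := N) m (n + 1))).dt_div i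
  rw [eulerLog, h, Pi.sub_apply, genericState_succ_right_h, genericState_κ₀, w]
  change 2 * (_ - (_ - (2 * (genericState N m n).1.x i - theta N i) / 2 + _ - _)) = _
  field_simp
  ring

/-- Because 2κ_1 = 1 + 2m - 2n, the left side is 2μQ - 2κ_1, and κ_1 = μ (Q - 1). -/
theorem sum_eulerLog_left_div_right (m n : ℤ) :
    (∑ j, eulerLog j (specialGeneric N (m + 1) n / specialGeneric N m (n + 1)))
      - 2 * m + 2 * n - 1 = 2 * mu (genericState N m n).1 := by
  have hQ := (genericState N m n).2.tame.Q_ne (genericBackground_isLarge N)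
  have h := mu_spec hQ
  rw [genericState_κ₁] at h
  simp only [eulerLog_left_div_right, ← Finset.mul_sum]
  change 2 * mu (genericState N m n).1 * Q (genericState N m n).1 - _ + _ - _ = _
  linear_combination 2 * h

/-- On the lattice κ_1 lies in 1/2 + ℤ and so is never zero. -/
theorem mu_genericState_ne_zero (m n : ℤ) : mu (genericState N m n).1 ≠ 0 := by
  have hQ := (genericState N m n).2.tame.Q_ne (genericBackground_isLarge N)
  refine div_ne_zero ?_ hQ
  rw [genericState_κ₁]
  have := half_add_ne_zero (N := N) (m - n)
  push_cast at this
  rwa [add_sub_assoc]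

end Generic

/-! ### Specialization of the parameters -/

section Specialization

open Background

variable {N : ℕ} (κ : ℂ) (θ : Fin N → ℂ)

/-- The rational function `g` is the specialization of `f`, through some representation of `f` as a
fraction whose denominator does not vanish identically at the parameters `κ`, `θ`. -/
def Specializes (f : GenericField N) (g : RatFun N ℂ) : Prop :=
  ∃ a b : MvPolynomial (Fin N) (ParamRing N), MvPolynomial.map (evalParam κ θ) b ≠ 0 ∧
    f = algebraMap _ (GenericField N) a / algebraMap _ (GenericField N) b ∧
    g = algebraMap _ (RatFun N ℂ) (MvPolynomial.map (evalParam κ θ) a) /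
      algebraMap _ (RatFun N ℂ) (MvPolynomial.map (evalParam κ θ) b)

variable {κ θ}

theorem algebraMap_ne_zero_of_ne {A : Type} [CommRing A] [IsDomain A]
    {b : MvPolynomial (Fin N) A} (hb : b ≠ 0) : algebraMap _ (RatFun N A) b ≠ 0 :=
  (map_ne_zero_iff _ (IsFractionRing.injective _ _)).2 hb

theorem ne_zero_of_map_ne_zero {b : MvPolynomial (Fin N) (ParamRing N)}
    (hb : MvPolynomial.map (evalParam κ θ) b ≠ 0) : b ≠ 0 := by
  rintro rfl
  exact hb (map_zero _)

namespace Specializes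

variable {f f' : GenericField N} {g g' : RatFun N ℂ}

/-- Cross-multiplying two representations gives an identity of polynomials, which survives
substitution of the parameters. -/
theorem unique (h : Specializes κ θ f g) (h' : Specializes κ θ f g') : g = g' := by
  obtain ⟨a, b, hb, rfl, rfl⟩ := h
  obtain ⟨c, d, hd, hf, rfl⟩ := h'
  rw [div_eq_div_iff (algebraMap_ne_zero_of_ne (ne_zero_of_map_ne_zero hb))
    (algebraMap_ne_zero_of_ne (ne_zero_of_map_ne_zero hd)), ← map_mul, ← map_mul] at hf
  have h2 := IsFractionRing.injective _ _ hf
  rw [div_eq_div_iff (algebraMap_ne_zero_of_ne hb) (algebraMap_ne_zero_of_ne hd), ← map_mul,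
    ← map_mul, ← map_mul, ← map_mul, h2]

theorem of_poly (a : MvPolynomial (Fin N) (ParamRing N)) :
    Specializes κ θ (algebraMap _ (GenericField N) a)
      (algebraMap _ (RatFun N ℂ) (MvPolynomial.map (evalParam κ θ) a)) :=
  ⟨a, 1, by simp, by simp, by simp⟩

theorem add (h : Specializes κ θ f g) (h' : Specializes κ θ f' g') :
    Specializes κ θ (f + f') (g + g') := by
  obtain ⟨a, b, hb, rfl, rfl⟩ := h
  obtain ⟨c, d, hd, rfl, rfl⟩ := h'
  refine ⟨a * d + b * c, b * d, by rw [map_mul]; exact mul_ne_zero hb hd, ?_, ?_⟩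
  · rw [div_add_div _ _ (algebraMap_ne_zero_of_ne (ne_zero_of_map_ne_zero hb))
      (algebraMap_ne_zero_of_ne (ne_zero_of_map_ne_zero hd))]
    simp only [map_add, map_mul]
  · rw [div_add_div _ _ (algebraMap_ne_zero_of_ne hb) (algebraMap_ne_zero_of_ne hd)]
    simp only [map_add, map_mul]

theorem mul (h : Specializes κ θ f g) (h' : Specializes κ θ f' g') :
    Specializes κ θ (f * f') (g * g') := by
  obtain ⟨a, b, hb, rfl, rfl⟩ := h
  obtain ⟨c, d, hd, rfl, rfl⟩ := h'
  refine ⟨a * c, b * d, by rw [map_mul]; exact mul_ne_zero hb hd, ?_, ?_⟩ <;>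
  · rw [div_mul_div_comm]
    simp only [map_mul]

theorem neg (h : Specializes κ θ f g) : Specializes κ θ (-f) (-g) := by
  obtain ⟨a, b, hb, rfl, rfl⟩ := h
  exact ⟨-a, b, hb, by rw [map_neg]; exact (neg_div _ _).symm,
    by rw [map_neg, map_neg]; exact (neg_div _ _).symm⟩

theorem sub (h : Specializes κ θ f g) (h' : Specializes κ θ f' g') :
    Specializes κ θ (f - f') (g - g') := by
  rw [sub_eq_add_neg, sub_eq_add_neg]
  exact h.add h'.neg

theorem inv (h : Specializes κ θ f g) (hg : g ≠ 0) : Specializes κ θ f⁻¹ g⁻¹ := by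
  obtain ⟨a, b, hb, rfl, rfl⟩ := h
  refine ⟨b, a, ?_, inv_div _ _, inv_div _ _⟩
  intro h0
  rw [h0, map_zero, zero_div] at hg
  exact hg rfl

theorem div (h : Specializes κ θ f g) (h' : Specializes κ θ f' g') (hg : g' ≠ 0) :
    Specializes κ θ (f / f') (g / g') := by
  rw [div_eq_mul_inv, div_eq_mul_inv]
  exact h.mul (h'.inv hg)

theorem intCast (k : ℤ) : Specializes κ θ (k : GenericField N) (k : RatFun N ℂ) := by
  simpa using of_poly (κ := κ) (θ := θ) (k : MvPolynomial (Fin N) (ParamRing N))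

theorem one : Specializes κ θ (1 : GenericField N) (1 : RatFun N ℂ) := by
  simpa using intCast (κ := κ) (θ := θ) 1

theorem two : Specializes κ θ (2 : GenericField N) (2 : RatFun N ℂ) := by
  simpa using intCast (κ := κ) (θ := θ) 2

theorem tvar (i : Fin N) : Specializes κ θ (Garnier.tvar i) (Garnier.tvar i) := by
  simpa [Garnier.tvar] using of_poly (κ := κ) (θ := θ) (X i)

theorem param (p : ParamRing N) : Specializes κ θ (algebraMap _ (GenericField N) p)
    (algebraMap ℂ (RatFun N ℂ) (evalParam κ θ p)) := by
  have h := of_poly (κ := κ) (θ := θ) (C p)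
  rw [map_C, ← algebraMap_eq, ← algebraMap_eq, ← IsScalarTower.algebraMap_apply,
    ← IsScalarTower.algebraMap_apply] at h
  exact h

theorem kinf : Specializes κ θ (Garnier.kinf N) (algebraMap ℂ (RatFun N ℂ) κ) := by
  simpa [evalParam, Garnier.kinf] using param (κ := κ) (θ := θ) (X none)

theorem theta (i : Fin N) :
    Specializes κ θ (Garnier.theta N i) (algebraMap ℂ (RatFun N ℂ) (θ i)) := by
  simpa [evalParam, Garnier.theta] using param (κ := κ) (θ := θ) (X (some i))

theorem sum {ι : Type*} (s : Finset ι) {F : ι → GenericField N} {G : ι → RatFun N ℂ}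
    (h : ∀ i, Specializes κ θ (F i) (G i)) : Specializes κ θ (∑ i ∈ s, F i) (∑ i ∈ s, G i) := by
  classical
  induction s using Finset.induction_on with
  | empty => simpa using intCast (κ := κ) (θ := θ) 0
  | insert a s ha ih =>
    rw [Finset.sum_insert ha, Finset.sum_insert ha]
    exact (h a).add ih

theorem dt (h : Specializes κ θ f g) (j : Fin N) :
    Specializes κ θ (Garnier.dt j f) (Garnier.dt j g) := by
  obtain ⟨a, b, hb, rfl, rfl⟩ := h
  refine ⟨b * pderiv j a - a * pderiv j b, b ^ 2, ?_, ?_, ?_⟩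
  · rw [map_pow]
    exact pow_ne_zero 2 hb
  · rw [map_pow]
    exact fracDerivFun_div _ a b (ne_zero_of_map_ne_zero hb)
  · rw [map_pow, map_pow, map_sub, map_mul, map_mul, ← pderiv_map, ← pderiv_map]
    exact fracDerivFun_div _ _ _ hb

theorem eulerLog (h : Specializes κ θ f g) (hg : g ≠ 0) (j : Fin N) :
    Specializes κ θ (Garnier.eulerLog j f) (Garnier.eulerLog j g) :=
  (tvar j).mul ((h.dt j).div h hg)

theorem δ (h : Specializes κ θ f g) (j : Fin N) :
    Specializes κ θ ((genericBackground N).δ j f) ((ratBackground N ℂ κ θ).δ j g) :=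
  ((tvar j).div two two_ne_zero).mul (h.dt j)

/-- `specialize` returns 0 when the specialized denominator vanishes, so a nonzero value certifies
that the reduced fraction is a valid representation. -/
theorem of_specialize_ne_zero (h : specialize κ θ f ≠ 0) :
    Specializes κ θ f (specialize κ θ f) := by
  refine ⟨_, _, ?_, (IsFractionRing.mk'_num_den' _ f).symm, rfl⟩
  intro h0
  apply h
  rw [specialize, h0, map_zero, div_zero]

end Specializes

theorem exists_param_map_ne_zero {p : MvPolynomial (Fin N) (ParamRing N)} (hp : p ≠ 0) :
    ∃ c : ParamRing N, c ≠ 0 ∧ ∀ (κ : ℂ) (θ : Fin N → ℂ),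
      eval (fun o : Option (Fin N) => o.elim κ θ) c ≠ 0 →
        MvPolynomial.map (evalParam κ θ) p ≠ 0 := by
  obtain ⟨d, hd⟩ := ne_zero_iff.1 hp
  refine ⟨coeff d p, hd, fun κ θ h h0 => h ?_⟩
  have := congrArg (coeff d) h0
  rwa [coeff_map, coeff_zero] at this

/-- A nonzero element of `ℂ(κ, θ, t)` has nonzero specialization for generic parameters. -/
theorem exists_param_specialize_ne_zero {f : GenericField N} (hf : f ≠ 0) :
    ∃ c : ParamRing N, c ≠ 0 ∧ ∀ (κ : ℂ) (θ : Fin N → ℂ),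
      eval (fun o : Option (Fin N) => o.elim κ θ) c ≠ 0 → specialize κ θ f ≠ 0 := by
  have hn : IsFractionRing.num (MvPolynomial (Fin N) (ParamRing N)) f ≠ 0 := by
    intro h
    apply hf
    rw [← IsFractionRing.mk'_num_den' (MvPolynomial (Fin N) (ParamRing N)) f, h, map_zero, zero_div]
  obtain ⟨c, hc, h1⟩ := exists_param_map_ne_zero hn
  obtain ⟨d, hd, h2⟩ := exists_param_map_ne_zero (nonZeroDivisors.coe_ne_zero
    (IsFractionRing.den (MvPolynomial (Fin N) (ParamRing N)) f))
  refine ⟨c * d, mul_ne_zero hc hd, fun κ θ h => ?_⟩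
  rw [map_mul] at h
  exact div_ne_zero (algebraMap_ne_zero_of_ne (h1 κ θ (left_ne_zero_of_mul h)))
    (algebraMap_ne_zero_of_ne (h2 κ θ (right_ne_zero_of_mul h)))

/-! ### The formulas for complex parameters. -/

section Formulas

variable {m n : ℤ}

theorem specializes_special (h : special κ θ m n ≠ 0) :
    Specializes κ θ (specialGeneric N m n) (special κ θ m n) :=
  Specializes.of_specialize_ne_zero h

theorem specializes_eulerLog_left (hl : special κ θ (m + 1) n ≠ 0)
    (hr : special κ θ m (n + 1) ≠ 0) (i : Fin N) :
    Specializes κ θ (eulerLog i (specialGeneric N (m + 1) n / specialGeneric N m (n + 1)))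
      (eulerLog i (special κ θ (m + 1) n / special κ θ m (n + 1))) :=
  ((specializes_special hl).div (specializes_special hr) hr).eulerLog (div_ne_zero hl hr) i

theorem specializes_eulerLog (h : special κ θ m n ≠ 0)
    (hr : special κ θ m (n + 1) ≠ 0) (i : Fin N) :
    Specializes κ θ (eulerLog i (specialGeneric N m n / specialGeneric N m (n + 1)))
      (eulerLog i (special κ θ m n / special κ θ m (n + 1))) :=
  ((specializes_special h).div (specializes_special hr) hr).eulerLog (div_ne_zero h hr) i

theorem specializes_qDenominator (hl : special κ θ (m + 1) n ≠ 0)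
    (hr : special κ θ m (n + 1) ≠ 0) :
    Specializes κ θ (2 * mu (genericState N m n).1) (qDenominator κ θ m n) := by
  rw [← sum_eulerLog_left_div_right]
  exact (((Specializes.sum _ fun i => specializes_eulerLog_left hl hr i).sub
    (Specializes.two.mul (Specializes.intCast m))).add
    (Specializes.two.mul (Specializes.intCast n))).sub Specializes.one

/-- For generic parameters, the formulas are well defined. -/
theorem exists_formulasDefined (N : ℕ) (m n : ℤ) :
    ∃ G : MvPolynomial (Option (Fin N)) ℂ, G ≠ 0 ∧
      ∀ (κ : ℂ) (θ : Fin N → ℂ), eval (fun o : Option (Fin N) => o.elim κ θ) G ≠ 0 →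
        FormulasDefined κ θ m n := by
  have hμ := mu_genericState_ne_zero (N := N) m n
  have hq := (genericState N m n).2.tame.q_ne (genericBackground_isLarge N)
  obtain ⟨c₁, hc₁, h₁⟩ := exists_param_specialize_ne_zero (specialGeneric_ne_zero (N := N) m n)
  obtain ⟨c₂, hc₂, h₂⟩ :=
    exists_param_specialize_ne_zero (specialGeneric_ne_zero (N := N) (m + 1) n)
  obtain ⟨c₃, hc₃, h₃⟩ :=
    exists_param_specialize_ne_zero (specialGeneric_ne_zero (N := N) m (n + 1))
  obtain ⟨c₄, hc₄, h₄⟩ := exists_param_specialize_ne_zero (mul_ne_zero two_ne_zero hμ)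
  choose c hc h using fun i => exists_param_specialize_ne_zero
    (mul_ne_zero (mul_ne_zero two_ne_zero hμ) (hq i))
  refine ⟨c₁ * c₂ * c₃ * c₄ * ∏ i, c i, mul_ne_zero (mul_ne_zero (mul_ne_zero
    (mul_ne_zero hc₁ hc₂) hc₃) hc₄) (Finset.prod_ne_zero_iff.2 fun i _ => hc i),
    fun κ θ hG => ?_⟩
  simp only [map_mul, map_prod, mul_ne_zero_iff, Finset.prod_ne_zero_iff] at hG
  obtain ⟨⟨⟨⟨g₁, g₂⟩, g₃⟩, g₄⟩, g⟩ := hG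
  have e₂ := h₂ κ θ g₂
  have e₃ := h₃ κ θ g₃
  have e₄ := h₄ κ θ g₄
  refine ⟨h₁ κ θ g₁, e₂, e₃, ?_, fun i => ?_⟩
  -- The denominator is a specialization of 2μ, so by uniqueness it equals the value that is known
  -- to be nonzero.
  · rw [(specializes_qDenominator e₂ e₃).unique (Specializes.of_specialize_ne_zero e₄)]
    exact e₄
  · have e := h i κ θ (g i (Finset.mem_univ i))
    have s := specializes_eulerLog_left e₂ e₃ i
    rw [eulerLog_left_div_right] at s
    rw [s.unique (Specializes.of_specialize_ne_zero e)]
    exact e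

variable (κ θ m n) in
/-- The algebraic solution for complex parameters; its last component is not used. -/
def specialState : State N (RatFun N ℂ) where
  κ₀ := 1 / 2 + m + n
  κ₁ := 1 / 2 + m - n
  q i := eulerLog i (special κ θ (m + 1) n / special κ θ m (n + 1)) / qDenominator κ θ m n
  x i := (algebraMap ℂ (RatFun N ℂ) (θ i) + m + n +
    eulerLog i (special κ θ m n / special κ θ m (n + 1))) / 2
  h _ := 0

theorem specialState_q_ne (h : FormulasDefined κ θ m n) (i : Fin N) :
    (specialState κ θ m n).q i ≠ 0 :=
  div_ne_zero (h.numerator_ne i) h.denominator_ne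

theorem specializes_q (h : FormulasDefined κ θ m n) (i : Fin N) :
    Specializes κ θ ((genericState N m n).1.q i) ((specialState κ θ m n).q i) := by
  have h1 := (specializes_eulerLog_left h.special_left_ne h.special_right_ne i).div
    (specializes_qDenominator h.special_left_ne h.special_right_ne) h.denominator_ne
  rw [eulerLog_left_div_right, mul_div_cancel_left₀] at h1
  · exact h1
  · exact mul_ne_zero two_ne_zero (mu_genericState_ne_zero m n)

theorem specializes_x (h : FormulasDefined κ θ m n) (i : Fin N) :
    Specializes κ θ ((genericState N m n).1.x i) ((specialState κ θ m n).x i) := by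
  have h1 := ((((Specializes.theta i).add (Specializes.intCast m)).add
    (Specializes.intCast n)).add (specializes_eulerLog h.special_ne h.special_right_ne i)).div
    Specializes.two two_ne_zero
  rw [eulerLog_div_right] at h1
  have e : (theta N i + m + n + (2 * (genericState N m n).1.x i - theta N i - m - n)) / 2 =
      (genericState N m n).1.x i := by
    field_simp
    ring
  rw [e] at h1
  exact h1

theorem specializes_s (i : Fin N) :
    Specializes κ θ ((genericBackground N).s i) ((ratBackground N ℂ κ θ).s i) := by
  have h := (Specializes.tvar (κ := κ) (θ := θ) i).mul (Specializes.tvar i)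
  rw [← sq, ← sq] at h
  exact h

theorem specializes_w (h : FormulasDefined κ θ m n) (i : Fin N) :
    Specializes κ θ ((genericBackground N).w (genericState N m n).1 i)
      ((ratBackground N ℂ κ θ).w (specialState κ θ m n) i) :=
  (Specializes.two.mul (specializes_x h i)).sub (Specializes.theta i)

theorem specializes_y (h : FormulasDefined κ θ m n) (i : Fin N) :
    Specializes κ θ ((genericBackground N).y (genericState N m n).1 i)
      ((ratBackground N ℂ κ θ).y (specialState κ θ m n) i) :=
  ((specializes_x h i).mul ((specializes_x h i).sub (Specializes.theta i))).div
    (specializes_q h i) (specialState_q_ne h i)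

theorem specializes_κ₁ : Specializes κ θ (genericState N m n).1.κ₁ (specialState κ θ m n).κ₁ := by
  rw [genericState_κ₁]
  exact ((Specializes.one.div Specializes.two two_ne_zero).add (Specializes.intCast m)).sub
    (Specializes.intCast n)

theorem specializes_κ₀ : Specializes κ θ (genericState N m n).1.κ₀ (specialState κ θ m n).κ₀ := by
  rw [genericState_κ₀]
  exact ((Specializes.one.div Specializes.two two_ne_zero).add (Specializes.intCast m)).add
    (Specializes.intCast n)

theorem specializes_X (h : FormulasDefined κ θ m n) :
    Specializes κ θ (Background.X (genericState N m n).1) (Background.X (specialState κ θ m n)) :=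
  Specializes.sum _ fun i => specializes_x h i

theorem specializes_Q (h : FormulasDefined κ θ m n) :
    Specializes κ θ (Q (genericState N m n).1) (Q (specialState κ θ m n)) :=
  Specializes.sum _ fun i => specializes_q h i

theorem specializes_a (h : FormulasDefined κ θ m n) :
    Specializes κ θ ((genericBackground N).a (genericState N m n).1)
      ((ratBackground N ℂ κ θ).a (specialState κ θ m n)) :=
  (specializes_X h).sub (((((specializes_κ₀.add specializes_κ₁).add Specializes.kinf).add
    (Specializes.sum _ fun i => Specializes.theta i)).sub Specializes.one).div Specializes.two
      two_ne_zero)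

theorem specializes_b (h : FormulasDefined κ θ m n) :
    Specializes κ θ ((genericBackground N).b (genericState N m n).1)
      ((ratBackground N ℂ κ θ).b (specialState κ θ m n)) :=
  (specializes_a h).add Specializes.kinf

theorem specializes_g (h : FormulasDefined κ θ m n) (j : Fin N) :
    Specializes κ θ ((genericBackground N).g (genericState N m n).1 j)
      ((ratBackground N ℂ κ θ).g (specialState κ θ m n) j) :=
  (((specializes_q h j).mul ((specializes_a h).add (specializes_b h))).sub
    ((specializes_s j).mul (specializes_w h j))).div ((specializes_s j).sub Specializes.one)
      ((ratBackground N ℂ κ θ).s_ne_one j)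

/-- The algebraic solution for complex parameters solves the Garnier system. -/
theorem isFlow_specialState (h : FormulasDefined κ θ m n) :
    (ratBackground N ℂ κ θ).IsFlow (specialState κ θ m n) where
  -- In every field, the left side specializes the generic left side; rewriting with the generic
  -- equation shows that the right side specializes the same element.
  dκ₀ j := (specializes_κ₀.δ j).unique (by
    rw [(genericState N m n).2.flow.dκ₀]
    simpa using Specializes.intCast (κ := κ) (θ := θ) 0)
  dκ₁ j := (specializes_κ₁.δ j).unique (by
    rw [(genericState N m n).2.flow.dκ₁]
    simpa using Specializes.intCast (κ := κ) (θ := θ) 0)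
  dx i j := (((specializes_s j).sub (specializes_s i)).mul ((specializes_x h i).δ j)).unique (by
    rw [(genericState N m n).2.flow.dx]
    exact (((specializes_s j).mul (specializes_y h j)).mul (specializes_q h i)).sub
      (((specializes_s i).mul (specializes_y h i)).mul (specializes_q h j)))
  dX j := (((specializes_s j).sub Specializes.one).mul ((specializes_X h).δ j)).unique (by
    rw [(genericState N m n).2.flow.dX]
    exact ((specializes_s j).mul (specializes_y h j)).sub
      ((specializes_q h j).mul ((specializes_a h).mul (specializes_b h))))
  dq i j := (((specializes_s j).sub (specializes_s i)).mul (((specializes_q h i).δ j).sub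
      ((specializes_g h j).mul (specializes_q h i)))).unique (by
    rw [(genericState N m n).2.flow.dq]
    exact (((specializes_s j).mul (specializes_w h j)).mul (specializes_q h i)).sub
      (((specializes_s i).mul (specializes_w h i)).mul (specializes_q h j)))
  dQ j := ((specializes_Q h).δ j).unique (by
    rw [(genericState N m n).2.flow.dQ]
    exact (((specializes_Q h).sub Specializes.one).mul (specializes_g h j)).add
      (specializes_κ₁.mul (specializes_q h j)))

end Formulas

end Specialization

/-! ### Hamilton's equations -/

section PartialDerivatives

variable {N : ℕ} {L : Type} [Field L]

theorem pderiv_inr_qvar (i k : Fin N) :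
    pderiv (Sum.inr i) (qvar k : MvPolynomial (Fin N ⊕ Fin N) L) = 0 := by
  rw [qvar, pderiv_X_of_ne (by simp)]

theorem pderiv_inr_pvar (i k : Fin N) :
    pderiv (Sum.inr i) (pvar k : MvPolynomial (Fin N ⊕ Fin N) L) = if k = i then 1 else 0 := by
  rw [pvar, pderiv_X, Pi.single_apply]; simp

theorem pderiv_inl_pvar (i k : Fin N) :
    pderiv (Sum.inl i) (pvar k : MvPolynomial (Fin N ⊕ Fin N) L) = 0 := by
  rw [pvar, pderiv_X_of_ne (by simp)]

theorem pderiv_inl_qvar (i k : Fin N) :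
    pderiv (Sum.inl i) (qvar k : MvPolynomial (Fin N ⊕ Fin N) L) = if k = i then 1 else 0 := by
  rw [qvar, pderiv_X, Pi.single_apply]; simp

end PartialDerivatives

section Coefficients

variable {N : ℕ} {L : Type} [Field L] (B : Background N L)

theorem Rcoef_swap {i j : Fin N} (hij : i ≠ j) : Rcoef B.s j i = 1 - Rcoef B.s i j := by
  have h1 := B.s_ne i j hij
  have h2 := B.s_ne j i hij.symm
  rw [Rcoef, Rcoef, show B.s i - B.s j = -(B.s j - B.s i) by ring]
  field_simp
  ring

theorem Scoef_eq {i j : Fin N} (hij : i ≠ j) :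
    Scoef B.s j i = B.s j - 1 + Rcoef B.s i j := by
  have h1 := B.s_ne i j hij
  rw [Rcoef, Scoef]
  field_simp
  ring

theorem Rcoef_mul {i j : Fin N} (hij : i ≠ j) :
    (B.s j - B.s i) * Rcoef B.s i j = B.s i * (B.s j - 1) := by
  have h1 := B.s_ne i j hij
  rw [Rcoef]
  field_simp

end Coefficients

namespace Background.IsFlow

variable {N : ℕ} {L : Type} [Field L] {B : Background N L} {S : State N L}

/-- The coefficients of the Hamiltonian all reduce to R_{ij}, by R_{ji} = 1 - R_{ij} and S_{ji} =
s_j - 1 + R_{ij}. Clearing s_j - s_i then gives `dq`. -/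
theorem dq_of_ne (hS : B.IsFlow S) {i j : Fin N} (hij : i ≠ j) :
    (B.s j - 1) * B.δ j (S.q i) = S.q i * (S.q j * (B.a S + B.b S) - B.s j * B.w S j)
      + Scoef B.s j i * S.q i * B.w S j - S.q j * B.w S i + Rcoef B.s j i * B.w S i * S.q j := by
  rw [Scoef_eq B hij, Rcoef_swap B hij]
  apply mul_left_cancel₀ (B.s_ne i j hij)
  linear_combination (B.s j - 1) * hS.dq i j
    + (B.s j - B.s i) * S.q i * g_spec (B := B) (S := S) j
    - (S.q i * B.w S j - B.w S i * S.q j) * Rcoef_mul B hij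

theorem dx_of_ne (hS : B.IsFlow S) {i j : Fin N} (hij : i ≠ j) :
    (B.s j - 1) * B.δ j (S.x i) =
      Scoef B.s j i * S.q i * B.y S j - Rcoef B.s i j * B.y S i * S.q j := by
  rw [Scoef_eq B hij]
  apply mul_left_cancel₀ (B.s_ne i j hij)
  linear_combination (B.s j - 1) * hS.dx i j
    - (S.q i * B.y S j - B.y S i * S.q j) * Rcoef_mul B hij

end Background.IsFlow

section Hamilton

variable {N : ℕ} {L : Type} [Field L] [Algebra ℂ L] {B : Background N L} {S : State N L}
  {κ : Params N} {p : Fin N → L}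

/-- The state `S` and the momenta `p` have parameters `κ`. -/
structure Matches (B : Background N L) (S : State N L) (κ : Params N) (p : Fin N → L) : Prop where
  flow : B.IsFlow S
  q_ne : ∀ i, S.q i ≠ 0
  θ_eq : ∀ i, algebraMap ℂ L (κ.θ i) = B.θ i
  κ_eq : algebraMap ℂ L κ.κinf = B.κ
  κ₀_eq : algebraMap ℂ L κ.κ₀ = S.κ₀
  κ₁_eq : algebraMap ℂ L κ.κ₁ = S.κ₁
  x_eq : ∀ i, S.x i = S.q i * p i

namespace Matches

open Background

variable (hM : Matches B S κ p)
include hM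

theorem a_eq : algebraMap ℂ L κ.α + ∑ i, S.q i * p i = B.a S := by
  have h : (algebraMap ℂ L) 2⁻¹ = 2⁻¹ := by rw [map_inv₀, map_ofNat]
  simp only [Params.α, map_mul, map_neg, map_sub, map_add, map_sum, map_one, one_div,
    hM.θ_eq, hM.κ_eq, hM.κ₀_eq, hM.κ₁_eq, a, Background.X, hM.x_eq, h]
  ring

theorem b_eq :
    algebraMap ℂ L κ.α + algebraMap ℂ L κ.κinf + ∑ i, S.q i * p i = B.b S := by
  rw [b, ← hM.a_eq, hM.κ_eq]; ring

theorem w_eq (i : Fin N) : B.w S i = 2 * (S.q i * p i) - B.θ i := by rw [w, hM.x_eq]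

theorem y_eq (i : Fin N) : B.y S i = p i * (S.q i * p i - B.θ i) := by
  have := hM.q_ne i
  rw [y, hM.x_eq]
  field_simp

theorem eval_inr_of_ne {i j : Fin N} (hij : j ≠ i) :
    (B.s j - 1) * (B.s j *
      eval (Sum.elim S.q p) (pderiv (Sum.inr i) (hamiltonian κ B.s j))) =
    S.q i * S.q j * (B.a S + B.b S) - Rcoef B.s i j * B.w S i * S.q j
      - Rcoef B.s j i * S.q i * B.w S j := by
  simp only [hamiltonian, cst, map_add, map_sub, map_mul, map_sum, Derivation.leibniz, pderiv_C,
    pderiv_inr_qvar, pderiv_inr_pvar, smul_eq_mul, mul_zero, zero_add, add_zero, sub_zero,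
    if_neg hij]
  simp only [qvar, pvar, eval_C, eval_X, Sum.elim_inl,
    Sum.elim_inr, apply_ite (eval _), map_zero, map_one, mul_ite, mul_one, mul_zero,
    Finset.sum_ite_eq', Finset.sum_add_distrib, Finset.mem_erase, Finset.mem_univ, if_true,
    hij.symm, ne_eq, not_false_eq_true, and_true, sub_zero,
    Finset.sum_const_zero]
  rw [hM.a_eq, hM.b_eq, hM.θ_eq, hM.θ_eq, hM.w_eq, hM.w_eq]
  have h1 := B.s_ne_zero j
  have h2 := B.s_ne_one j
  field_simp
  ring

theorem eval_inl_of_ne {i j : Fin N} (hij : j ≠ i) :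
    (B.s j - 1) * (B.s j *
      eval (Sum.elim S.q p) (pderiv (Sum.inl i) (hamiltonian κ B.s j))) =
    p i * S.q j * (B.a S + B.b S) - Rcoef B.s i j * p i ^ 2 * S.q j
      - Scoef B.s j i * B.y S j - Rcoef B.s j i * p i * B.w S j := by
  simp only [hamiltonian, cst, map_add, map_sub, map_mul, map_sum, Derivation.leibniz, pderiv_C,
    pderiv_inl_qvar, pderiv_inl_pvar, smul_eq_mul, mul_zero, zero_add, add_zero, sub_zero,
    if_neg hij]
  simp only [qvar, pvar, eval_C, eval_X, Sum.elim_inl,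
    Sum.elim_inr, apply_ite (eval _), map_zero, map_one, mul_ite, mul_one, mul_zero,
    Finset.sum_ite_eq', Finset.mem_erase, Finset.mem_univ, if_true,
    hij.symm, ne_eq, not_false_eq_true, and_true]
  rw [hM.a_eq, hM.b_eq, hM.θ_eq, hM.y_eq, hM.w_eq]
  have h1 := B.s_ne_zero j
  have h2 := B.s_ne_one j
  field_simp
  ring

theorem eval_inr_self (j : Fin N) :
    (B.s j - 1) * (B.s j *
      eval (Sum.elim S.q p) (pderiv (Sum.inr j) (hamiltonian κ B.s j))) =
    S.q j ^ 2 * (B.a S + B.b S) + B.s j * B.w S j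
      - B.w S j * (∑ k ∈ Finset.univ.erase j, Scoef B.s j k * S.q k)
      - S.q j * (∑ k ∈ Finset.univ.erase j, Rcoef B.s j k * B.w S k)
      - (B.s j + 1) * B.w S j * S.q j + (S.κ₁ * B.s j + S.κ₀ - 1) * S.q j := by
  simp only [hamiltonian, cst, map_add, map_sub, map_mul, map_sum, Derivation.leibniz, pderiv_C,
    pderiv_inr_qvar, pderiv_inr_pvar, smul_eq_mul, mul_zero, zero_add, add_zero, sub_zero]
  simp only [qvar, pvar, eval_C, eval_X, Sum.elim_inl,
    Sum.elim_inr, apply_ite (eval _), map_zero, map_one, mul_ite, mul_one, mul_zero,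
    Finset.sum_ite_eq', Finset.sum_add_distrib, Finset.mem_erase, Finset.mem_univ, if_true,
    ne_eq, not_true, if_false, and_true, zero_add, sub_zero, add_zero]
  have e1 : ∑ x ∈ Finset.univ.erase j, Scoef B.s j x * (S.q j * p j - B.θ j) * S.q x
      + ∑ x ∈ Finset.univ.erase j, p j * (S.q x * (Scoef B.s j x * S.q j)) =
      B.w S j * ∑ k ∈ Finset.univ.erase j, Scoef B.s j k * S.q k := by
    rw [← Finset.sum_add_distrib, Finset.mul_sum]
    exact Finset.sum_congr rfl fun k _ => by rw [hM.w_eq]; ring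
  have e2 : ∑ x ∈ Finset.univ.erase j, Rcoef B.s j x * S.q x * p x * S.q j
      + ∑ x ∈ Finset.univ.erase j, (S.q x * p x - B.θ x) * (Rcoef B.s j x * S.q j) =
      S.q j * ∑ k ∈ Finset.univ.erase j, Rcoef B.s j k * B.w S k := by
    rw [← Finset.sum_add_distrib, Finset.mul_sum]
    exact Finset.sum_congr rfl fun k _ => by rw [hM.w_eq]; ring
  simp only [hM.θ_eq, hM.κ₀_eq, hM.κ₁_eq]
  rw [hM.a_eq, hM.b_eq, ← e1, ← e2, hM.w_eq]
  have h1 := B.s_ne_zero j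
  have h2 := B.s_ne_one j
  field_simp
  ring

theorem eval_inl_self (j : Fin N) :
    (B.s j - 1) * (B.s j *
      eval (Sum.elim S.q p) (pderiv (Sum.inl j) (hamiltonian κ B.s j))) =
    B.a S * B.b S + S.q j * p j * (B.a S + B.b S) + B.s j * p j ^ 2
      - (∑ k ∈ Finset.univ.erase j, Rcoef B.s k j * B.y S k)
      - p j ^ 2 * (∑ k ∈ Finset.univ.erase j, Scoef B.s j k * S.q k)
      - p j * (∑ k ∈ Finset.univ.erase j, Rcoef B.s j k * B.w S k)
      - (B.s j + 1) * B.w S j * p j + (S.κ₁ * B.s j + S.κ₀ - 1) * p j := by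
  simp only [hamiltonian, cst, map_add, map_sub, map_mul, map_sum, Derivation.leibniz, pderiv_C,
    pderiv_inl_qvar, pderiv_inl_pvar, smul_eq_mul, mul_zero, zero_add, add_zero, sub_zero]
  simp only [qvar, pvar, eval_C, eval_X, Sum.elim_inl,
    Sum.elim_inr, apply_ite (eval _), map_zero, map_one, mul_ite, mul_one, mul_zero,
    Finset.sum_ite_eq', Finset.sum_add_distrib, Finset.mem_erase, Finset.mem_univ, if_true,
    ne_eq, not_true, if_false, and_true, zero_add, add_zero]
  have e1 : ∑ x ∈ Finset.univ.erase j, p x * (Rcoef B.s x j * (S.q x * p x - B.θ x) +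
        if x = j then S.q j * (Rcoef B.s x j * p x) else 0) =
      ∑ k ∈ Finset.univ.erase j, Rcoef B.s k j * B.y S k :=
    Finset.sum_congr rfl fun k hk => by
      rw [hM.y_eq, if_neg (Finset.ne_of_mem_erase hk)]; ring
  have e2 : ∑ x ∈ Finset.univ.erase j, p j * ((if x = j then
        Scoef B.s j x * (S.q j * p j - B.θ j) else 0) + S.q x * (Scoef B.s j x * p j)) =
      p j ^ 2 * ∑ k ∈ Finset.univ.erase j, Scoef B.s j k * S.q k := by
    rw [Finset.mul_sum]
    exact Finset.sum_congr rfl fun k hk => by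
      rw [if_neg (Finset.ne_of_mem_erase hk)]; ring
  have e3 : ∑ x ∈ Finset.univ.erase j, Rcoef B.s j x * S.q x * p x * p j
      + ∑ x ∈ Finset.univ.erase j, (S.q x * p x - B.θ x) * (p j * Rcoef B.s j x) =
      p j * ∑ k ∈ Finset.univ.erase j, Rcoef B.s j k * B.w S k := by
    rw [← Finset.sum_add_distrib, Finset.mul_sum]
    exact Finset.sum_congr rfl fun k _ => by rw [hM.w_eq]; ring
  simp only [hM.θ_eq, hM.κ₀_eq, hM.κ₁_eq]
  rw [hM.a_eq, hM.b_eq, e1, e2, ← e3, hM.w_eq]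
  have h1 := B.s_ne_zero j
  have h2 := B.s_ne_one j
  field_simp
  ring

end Matches

namespace Matches

open Background

variable [CharZero L] (hM : Matches B S κ p)
include hM

/-- For i ≠ j this is `dq`. The diagonal equation is recovered by subtracting the off-diagonal ones
from `dQ`, with `sum_w` producing the term in κ_0. -/
theorem hamilton_q (i j : Fin N) :
    B.δ j (S.q i) =
      B.s j * eval (Sum.elim S.q p) (pderiv (Sum.inr i) (hamiltonian κ B.s j)) := by
  apply mul_left_cancel₀ (B.s_ne_one j)
  by_cases hij : i = j
  · subst hij
    rw [hM.eval_inr_self]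
    have h1 := Finset.sum_congr rfl fun k (hk : k ∈ Finset.univ.erase i) =>
      hM.flow.dq_of_ne (Finset.ne_of_mem_erase hk)
    simp only [Finset.sum_add_distrib, Finset.sum_sub_distrib, ← Finset.mul_sum,
      ← Finset.sum_mul, ← map_sum] at h1
    have h2 : ∑ k ∈ Finset.univ.erase i, S.q k = Q S - S.q i :=
      eq_sub_of_add_eq (Finset.sum_erase_add _ _ (Finset.mem_univ i))
    have h3 : ∑ k ∈ Finset.univ.erase i, B.w S k = B.a S + B.b S + S.κ₀ + S.κ₁ - 1 - B.w S i :=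
      (eq_sub_of_add_eq (Finset.sum_erase_add _ _ (Finset.mem_univ i))).trans (by rw [sum_w])
    rw [h2, h3, map_sub] at h1
    linear_combination (B.s i - 1) * hM.flow.dQ i - h1
      + (Q S - 1) * g_spec (B := B) (S := S) i
  · rw [hM.eval_inr_of_ne (Ne.symm hij), hM.flow.dq_of_ne hij, Scoef_eq B hij, Rcoef_swap B hij]
    ring

/-- Since x_i = q_i p_i, q_i δ_j p_i = δ_j x_i - p_i δ_j q_i. The diagonal case again uses the
equation for the sum, `dX`. -/
theorem hamilton_p (i j : Fin N) :
    B.δ j (p i) =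
      -(B.s j * eval (Sum.elim S.q p) (pderiv (Sum.inl i) (hamiltonian κ B.s j))) := by
  have hx : B.δ j (S.x i) = S.q i * B.δ j (p i) + p i * B.δ j (S.q i) := by
    rw [hM.x_eq, Derivation.leibniz, smul_eq_mul, smul_eq_mul]
  have hq := hM.hamilton_q i j
  apply mul_left_cancel₀ (hM.q_ne i)
  apply mul_left_cancel₀ (B.s_ne_one j)
  by_cases hij : i = j
  · subst hij
    have e1 := hM.eval_inr_self i
    have e2 := hM.eval_inl_self i
    have h1 := Finset.sum_congr rfl fun k (hk : k ∈ Finset.univ.erase i) =>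
      hM.flow.dx_of_ne (Finset.ne_of_mem_erase hk)
    simp only [Finset.sum_sub_distrib, ← Finset.mul_sum, ← Finset.sum_mul, ← map_sum] at h1
    have h2 : ∑ k ∈ Finset.univ.erase i, S.x k = X S - S.x i :=
      eq_sub_of_add_eq (Finset.sum_erase_add _ _ (Finset.mem_univ i))
    rw [h2, map_sub] at h1
    have hw := hM.w_eq i
    have hy := hM.y_eq i
    rw [hw] at e1 e2
    rw [hy] at h1
    have hX := hM.flow.dX i
    rw [hy] at hX
    linear_combination -(B.s i - 1) * hx - p i * (B.s i - 1) * hq + hX - h1 - p i * e1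
      + S.q i * e2
  · have e1 := hM.eval_inr_of_ne (Ne.symm hij)
    have e2 := hM.eval_inl_of_ne (Ne.symm hij)
    have h1 := hM.flow.dx_of_ne hij
    rw [hM.y_eq i] at h1
    rw [hM.w_eq i] at e1
    linear_combination -(B.s j - 1) * hx - p i * (B.s j - 1) * hq + h1 - p i * e1 + S.q i * e2

end Matches

end Hamilton

/-! ### Algebraicity over the field of rational functions of `s` -/

section Algebraicity

variable {N : ℕ}

theorem algebraicIndependent_tvar :
    AlgebraicIndependent ℂ (tvar : Fin N → RatFun N ℂ) :=
  (algebraicIndependent_X (Fin N) ℂ).map' (f := IsScalarTower.toAlgHom ℂ _ (RatFun N ℂ))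
    (IsFractionRing.injective _ _)

theorem algebraicIndependent_svar :
    AlgebraicIndependent ℂ (svar : Fin N → RatFun N ℂ) := by
  have h := algebraicIndependent_tvar (N := N).polynomial_aeval_of_transcendental
    (f := fun _ => Polynomial.X ^ 2) fun _ =>
      (Polynomial.transcendental_X ℂ).pow two_pos
  simp only [map_pow, Polynomial.aeval_X] at h
  exact h

theorem isAlgebraic_tvar (i : Fin N) :
    IsAlgebraic (IntermediateField.adjoin ℂ (Set.range (svar : Fin N → RatFun N ℂ)))
      (tvar i : RatFun N ℂ) := by
  refine IsAlgebraic.of_pow two_pos ?_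
  exact isAlgebraic_algebraMap (⟨svar i, IntermediateField.subset_adjoin ℂ _ ⟨i, rfl⟩⟩ :
    IntermediateField.adjoin ℂ (Set.range (svar : Fin N → RatFun N ℂ)))

theorem isAlgebraic_algebraMap_mvPolynomial (f : MvPolynomial (Fin N) ℂ) :
    IsAlgebraic (IntermediateField.adjoin ℂ (Set.range (svar : Fin N → RatFun N ℂ)))
      (algebraMap (MvPolynomial (Fin N) ℂ) (RatFun N ℂ) f) := by
  induction f using MvPolynomial.induction_on with
  | C c =>
    rw [← MvPolynomial.algebraMap_eq, ← IsScalarTower.algebraMap_apply]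
    exact (isAlgebraic_algebraMap c).tower_top _
  | add f g hf hg => rw [map_add]; exact hf.add hg
  | mul_X f i hf => rw [map_mul]; exact hf.mul (isAlgebraic_tvar i)

theorem isAlgebraic_ratFun (f : RatFun N ℂ) :
    IsAlgebraic (IntermediateField.adjoin ℂ (Set.range (svar : Fin N → RatFun N ℂ))) f := by
  obtain ⟨a, b, -, rfl⟩ := IsFractionRing.div_surjective (A := MvPolynomial (Fin N) ℂ) f
  rw [div_eq_mul_inv]
  exact (isAlgebraic_algebraMap_mvPolynomial a).mul (isAlgebraic_algebraMap_mvPolynomial b).inv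

theorem dsvar_apply (j : Fin N) (f : RatFun N ℂ) :
    dsvar j f = (2 * tvar j)⁻¹ * dt j f := rfl

theorem dsvar_svar (i j : Fin N) : dsvar j (svar i) = if i = j then 1 else 0 := by
  rw [dsvar_apply, svar, Derivation.leibniz_pow, dt_tvar]
  have := tvar_ne_zero (A := ℂ) i
  split_ifs with h
  · subst h
    simp only [smul_eq_mul, nsmul_eq_mul, Nat.cast_ofNat, mul_one, Nat.add_one_sub_one, pow_one]
    field_simp
  · simp

theorem svar_mul_dsvar (κ : ℂ) (θ : Fin N → ℂ) (j : Fin N) (f : RatFun N ℂ) :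
    (ratBackground N ℂ κ θ).δ j f = svar j * dsvar j f := by
  change tvar j / 2 * dt j f = _
  rw [dsvar_apply, svar]
  have := tvar_ne_zero (A := ℂ) j
  field_simp

end Algebraicity

/-! ### The algebraic solution. -/

theorem matches_specialState {N : ℕ} {κ : Params N} {m n : ℤ} (h₀ : κ.κ₀ = 1 / 2 + m + n)
    (h₁ : κ.κ₁ = 1 / 2 + m - n) (h : FormulasDefined κ.κinf κ.θ m n) :
    Matches (ratBackground N ℂ κ.κinf κ.θ) (specialState κ.κinf κ.θ m n) κ
      fun i => (specialState κ.κinf κ.θ m n).x i / (specialState κ.κinf κ.θ m n).q i where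
  flow := isFlow_specialState h
  q_ne := specialState_q_ne h
  θ_eq _ := rfl
  κ_eq := rfl
  κ₀_eq := by
    rw [h₀, map_add, map_add, map_div₀, map_one, map_ofNat, map_intCast, map_intCast]; rfl
  κ₁_eq := by
    rw [h₁, map_sub, map_add, map_div₀, map_one, map_ofNat, map_intCast, map_intCast]; rfl
  x_eq i := (mul_div_cancel₀ _ (specialState_q_ne h i)).symm

theorem isAlgebraicSolution_specialState {N : ℕ} {κ : Params N} {m n : ℤ}
    (h₀ : κ.κ₀ = 1 / 2 + m + n) (h₁ : κ.κ₁ = 1 / 2 + m - n)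
    (h : FormulasDefined κ.κinf κ.θ m n) :
    IsAlgebraicSolution κ svar dsvar (specialState κ.κinf κ.θ m n).q
      fun i => (specialState κ.κinf κ.θ m n).x i / (specialState κ.κinf κ.θ m n).q i where
  independent := algebraicIndependent_svar
  ds_s := dsvar_svar
  q_algebraic _ := isAlgebraic_ratFun _
  p_algebraic _ := isAlgebraic_ratFun _
  q_eq i j := by
    -- Multiplication by s_j = t_j² turns ∂/∂s_j into δ_j.
    apply mul_left_cancel₀ (pow_ne_zero 2 (tvar_ne_zero (A := ℂ) j))
    exact (svar_mul_dsvar _ _ _ _).symm.trans ((matches_specialState h₀ h₁ h).hamilton_q i j)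
  p_eq i j := by
    apply mul_left_cancel₀ (pow_ne_zero 2 (tvar_ne_zero (A := ℂ) j))
    rw [mul_neg]
    exact (svar_mul_dsvar _ _ _ _).symm.trans ((matches_specialState h₀ h₁ h).hamilton_p i j)

end Garnier

end

theorem theorem3p3 (N : ℕ) (m n : ℤ) :
    (∃ G : MvPolynomial (Option (Fin N)) ℂ, G ≠ 0 ∧
      ∀ (κinf : ℂ) (θ : Fin N → ℂ),
        MvPolynomial.eval (fun o : Option (Fin N) => o.elim κinf θ) G ≠ 0 →
          Garnier.FormulasDefined κinf θ m n) ∧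
    ∀ κ : Garnier.Params N,
      κ.κ₀ = 1 / 2 + m + n → κ.κ₁ = 1 / 2 + m - n →
      Garnier.FormulasDefined κ.κinf κ.θ m n →
      ∃ q p : Fin N → Garnier.RatFun N ℂ,
        (∀ i, q i =
          Garnier.eulerLog i
              (Garnier.special κ.κinf κ.θ (m + 1) n / Garnier.special κ.κinf κ.θ m (n + 1)) /
            ((∑ j, Garnier.eulerLog j
              (Garnier.special κ.κinf κ.θ (m + 1) n / Garnier.special κ.κinf κ.θ m (n + 1)))
              - 2 * m + 2 * n - 1)) ∧
        (∀ i, 2 * q i * p i =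
          algebraMap ℂ (Garnier.RatFun N ℂ) (κ.θ i) + m + n +
            Garnier.eulerLog i
              (Garnier.special κ.κinf κ.θ m n / Garnier.special κ.κinf κ.θ m (n + 1))) ∧
        Garnier.IsAlgebraicSolution κ Garnier.svar Garnier.dsvar q p := by
  refine ⟨Garnier.exists_formulasDefined N m n, fun κ h₀ h₁ h => ⟨_, _, fun i => rfl, fun i => ?_,
    Garnier.isAlgebraicSolution_specialState h₀ h₁ h⟩⟩
  -- The momenta are x_i / q_i, so 2 q_i p_i = 2 x_i; the numerator in the definition of x_i is the
  -- required right side.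
  have hx := (Garnier.matches_specialState h₀ h₁ h).x_eq i
  exact (mul_assoc _ _ _).trans
    ((congrArg (2 * ·) hx.symm).trans (mul_div_cancel₀ _ two_ne_zero))
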